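/- All graphs are finite and simple. A subdivision of $K_4$ is a graph obtained from the complete graph $K_4$ by repeatedly subdividing edges (equivalently, by replacing its edges with internally disjoint paths of length at least one). A graph is ISK4-free if none of its induced subgraphs is a subdivision of $K_4$, and series-parallel if none of its subgraphs, induced or not, is a subdivision of $K_4$. A cutset of a graph $G$ is a set $C$ of vertices such that $G\setminus C$ is disconnected; it is a clique cutset if the vertices of $C$ are pairwise adjacent. A hole is a chordless cycle of length at least $4$. A wheel $(H,x)$ of $G$ consists of a hole $H$ that is an induced subgraph of $G$ and a vertex $x\notin V(H)$ with at least three neighbours on $H$. Let $x_1,\dots,x_n$ be the neighbours of $x$ in $H$, in the order in which they appear along $H$, with indices modulo $n$; for $1\le i\le n$, the sector $S_i$ is the subpath of $H$ with ends $x_i$ and $x_{i+1}$ that has no neighbour of $x$ in its interior. Write $N[x]$ for the set consisting of $x$ and its neighbours. The graph $G$ has a wheel decomposition if for some wheel $(H,x)$ of $G$ and every $i\in\{1,\dots,n\}$, the set $(N[x]\setminus H)\cup\{x_i,x_{i+1}\}$ is a cutset of $G$ that separates $S_i$ from $H\setminus S_i$ (that is, it meets every path of $G$ from $S_i$ to $H\setminus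 S_i$). Theorem. Let $G$ be a triangle-free and ISK4-free graph. Then $G$ is series-parallel, or $G$ is a complete bipartite graph, or $G$ has a clique cutset of size at most two, or $G$ has a wheel decomposition. -/

import Mathlib

namespace ISK4

/-- `H` is a subdivision of `F`: `H` is obtained from `F` by replacing the edges of `F` with
internally disjoint paths of length at least one.  Here `f` gives the branch vertices and
`P a b h` is the path that replaces the edge `ab` (traversed from `a` to `b`). -/
def IsSubdivision {α β : Type*} (F : SimpleGraph α) (H : SimpleGraph β) : Prop :=
  ∃ (f : α → β) (P : ∀ a b : α, F.Adj a b → H.Walk (f a) (f b)),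
    Function.Injective f ∧
    (∀ a b h, (P a b h).IsPath) ∧
    (∀ a b h, P b a h.symm = (P a b h).reverse) ∧
    -- a path meets the branch vertices only in its two ends
    (∀ a b h c, f c ∈ (P a b h).support → c = a ∨ c = b) ∧
    -- paths of different edges meet only in branch vertices
    (∀ a b h a' b' h', s(a, b) ≠ s(a', b') →
      ∀ v ∈ (P a b h).support, v ∈ (P a' b' h').support → v ∈ Set.range f) ∧
    -- `H` has no other vertices and no other edges
    (∀ v, v ∈ Set.range f ∨ ∃ a b h, v ∈ (P a b h).support) ∧
    (∀ u v, H.Adj u v → ∃ a b h, s(u, v) ∈ (P a b h).edges)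

variable {V : Type*}

/-- No induced subgraph of `G` is a subdivision of `K₄`. -/
def ISK4Free (G : SimpleGraph V) : Prop :=
  ∀ S : Set V, ¬ IsSubdivision (⊤ : SimpleGraph (Fin 4)) (G.induce S)

/-- No subgraph of `G`, induced or not, is a subdivision of `K₄`. -/
def SeriesParallel (G : SimpleGraph V) : Prop :=
  ∀ K : G.Subgraph, ¬ IsSubdivision (⊤ : SimpleGraph (Fin 4)) K.coe

/-- `G` is isomorphic to `K_{m,n}` for some `m, n ≥ 1`. -/
def IsCompleteBipartite (G : SimpleGraph V) : Prop :=
  ∃ m n : ℕ, 1 ≤ m ∧ 1 ≤ n ∧ Nonempty (G ≃g completeBipartiteGraph (Fin m) (Fin n))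

/-- `G ∖ C` is disconnected: it has two vertices that no path of it joins. -/
def IsCutset (G : SimpleGraph V) (C : Set V) : Prop :=
  ¬ (G.induce Cᶜ).Preconnected

/-- `G` has a clique cutset with at most `k` vertices. -/
def HasCliqueCutsetLE (G : SimpleGraph V) (k : ℕ) : Prop :=
  ∃ C : Finset V, G.IsClique (C : Set V) ∧ C.card ≤ k ∧ IsCutset G (C : Set V)

/-- Every path of `G` from `A` to `B` meets `C`. -/
def Separates (G : SimpleGraph V) (C A B : Set V) : Prop :=
  ∀ u ∈ A, ∀ v ∈ B, ∀ p : G.Walk u v, ∃ w ∈ p.support, w ∈ C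

/-- `H` is the vertex set of a hole, that is, of a chordless cycle of length at least four. -/
def IsHole (G : SimpleGraph V) (H : Set V) : Prop :=
  ∃ n : ℕ, 4 ≤ n ∧ Nonempty (G.induce H ≃g SimpleGraph.cycleGraph n)

/-- `(H, x)` is a wheel of `G`. -/
def IsWheel (G : SimpleGraph V) (H : Set V) (x : V) : Prop :=
  IsHole G H ∧ x ∉ H ∧ 3 ≤ (H ∩ G.neighborSet x).ncard

/-- `S` is a sector of the wheel `(H, x)`: a path in `H` (it is a subpath of the cycle, since
`H` has no chord) whose ends are two neighbours of `x` and whose interior vertices are not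
adjacent to `x`. -/
def IsSector (G : SimpleGraph V) (H : Set V) (x : V) {a b : V} (S : G.Walk a b) : Prop :=
  S.IsPath ∧ a ≠ b ∧ (∀ v ∈ S.support, v ∈ H) ∧ G.Adj x a ∧ G.Adj x b ∧
    ∀ v ∈ S.support, G.Adj x v → v = a ∨ v = b

/-- The set `(N[x] ∖ H) ∪ {a, b}`. -/
def wheelCut (G : SimpleGraph V) (H : Set V) (x a b : V) : Set V :=
  (insert x (G.neighborSet x) \ H) ∪ {a, b}

/-- For some wheel `(H, x)` and every sector `S` of it, with ends `a` and `b`, the set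
`(N[x] ∖ H) ∪ {a, b}` is a cutset of `G` that separates `S` from `H ∖ S`. -/
def HasWheelDecomposition (G : SimpleGraph V) : Prop :=
  ∃ (H : Set V) (x : V), IsWheel G H x ∧
    ∀ (a b : V) (S : G.Walk a b), IsSector G H x S →
      IsCutset G (wheelCut G H x a b) ∧
      Separates G (wheelCut G H x a b) {v | v ∈ S.support} (H \ {v | v ∈ S.support})

end ISK4

/-! The engine is `no_three_links`. If a connected set is joined to a disjoint hole by exactly three
edges, with distinct ends on the hole, then the hole, the three edges and an induced subdivided claw
inside the connected set form an induced subdivision of K₄. Triangle-freeness provides the claw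
(`exists_claw`), because three vertices of a connected set can otherwise only be joined through a
triangle. Almost every contradiction below is such a triple of links, a triangle, or a violation of
an extremal choice.

Without wheels. A subdivision of K₄ contains a cycle C and a disjoint connected set D with at least
three attachments on C. Choose such a pair with C ∪ D minimal, and then D smallest. A chord of C
would give a smaller pair or a triangle, so C is a hole, and D is an induced subdivided claw. If the
three legs are proper, C and D have exactly three links. Otherwise D is a path. A single vertex
would be the centre of a wheel, a longer path with three attachments again gives three links, and
four attachments collapse to K₃,₃.

With K₃,₃. Enlarge it to a maximal complete bipartite subgraph with sides A and B. A shortest path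
outside A ∪ B linking two vertices of one side would give three links to a 4-cycle. Hence a
component outside attaches to at most one vertex of each side, and these attachments form a clique
cutset. If nothing lies outside, the graph is complete bipartite.

With wheels. Call a sector good if no vertex outside N[x] has three neighbours in it. Among the
wheels with at most one sector allowed to fail this (`AG`), choose one with the fewest spokes. The
main claim (`Ctx.not_bad`) is that no path avoiding the hole and N[x] joins two hole vertices whose
two arcs both have a spoke inside. In a shortest counterexample, the path and pieces of the hole
form another hole, which is either an `AG` wheel with fewer spokes or has three links to a set
containing x or a path vertex and stretches of the old hole. The claim is used twice: first for
one-vertex paths {u}, to show that a suitably minimal wheel has no exceptional sector at all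
(`AG.all_good`), and then for all paths, where it is the required separation. For this reason `Ctx`
carries the vertex set `W` and tolerates a bad sector only when `W` is a single vertex. -/

namespace ISK4

variable {V : Type*} {G : SimpleGraph V}

/-! ### Induced paths and holes as lists of vertices -/

/-- The lists `A` and `B` are disjoint and no edge of `G` joins them. -/
def NE (G : SimpleGraph V) (A B : List V) : Prop := ∀ u ∈ A, ∀ v ∈ B, u ≠ v ∧ ¬ G.Adj u v

theorem NE.symm {A B : List V} (h : NE G A B) : NE G B A :=
  fun u hu v hv => ⟨(h v hv u hu).1.symm, fun e => (h v hv u hu).2 e.symm⟩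

theorem NE.mono {A B A' B' : List V} (h : NE G A B) (hA : A' ⊆ A) (hB : B' ⊆ B) : NE G A' B' :=
  fun u hu v hv => h u (hA hu) v (hB hv)

@[simp] theorem NE_nil_left {B : List V} : NE G [] B := by simp [NE]
@[simp] theorem NE_nil_right {B : List V} : NE G B [] := by simp [NE]
@[simp] theorem NE_append_left {A B C : List V} : NE G (A ++ B) C ↔ NE G A C ∧ NE G B C := by
  simp only [NE, List.mem_append]; grind
@[simp] theorem NE_append_right {A B C : List V} : NE G C (A ++ B) ↔ NE G C A ∧ NE G C B := by
  simp only [NE, List.mem_append]; grind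
theorem NE_cons_left {a : V} {B C : List V} : NE G (a :: B) C ↔ NE G [a] C ∧ NE G B C := by
  simp only [NE, List.mem_cons]; grind
theorem NE_cons_right {a : V} {B C : List V} : NE G C (a :: B) ↔ NE G C [a] ∧ NE G C B := by
  simp only [NE, List.mem_cons]; grind
@[simp] theorem NE_reverse_left {A B : List V} : NE G A.reverse B ↔ NE G A B := by simp [NE]
@[simp] theorem NE_reverse_right {A B : List V} : NE G A B.reverse ↔ NE G A B := by simp [NE]
theorem NE_comm {A B : List V} : NE G A B ↔ NE G B A := ⟨NE.symm, NE.symm⟩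

/-- `l` lists the vertices of an induced path of `G`, in order. -/
def IndPath (G : SimpleGraph V) : List V → Prop
  | [] => True
  | [_] => True
  | a :: b :: l => G.Adj a b ∧ NE G [a] l ∧ IndPath G (b :: l)

@[simp] theorem indPath_nil : IndPath G [] := trivial
@[simp] theorem indPath_singleton {a : V} : IndPath G [a] := trivial
theorem indPath_cons_cons {a b : V} {l : List V} :
    IndPath G (a :: b :: l) ↔ G.Adj a b ∧ NE G [a] l ∧ IndPath G (b :: l) := Iff.rfl
@[simp] theorem indPath_pair {a b : V} : IndPath G [a, b] ↔ G.Adj a b := by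
  simp [indPath_cons_cons]

/-- Cutting at an inner vertex: the only adjacencies not seen by the two halves are those across the
cut. Induced paths are assembled and dismantled through this equivalence. -/
theorem indPath_append_cons {l₁ l₂ : List V} {c : V} :
    IndPath G (l₁ ++ c :: l₂) ↔
      IndPath G (l₁ ++ [c]) ∧ IndPath G (c :: l₂) ∧ NE G l₁ l₂ := by
  induction l₁ with
  | nil => simp
  | cons a l ih =>
    cases l with
    | nil => simp [indPath_cons_cons]; tauto
    | cons b l =>
      have e : ∀ m, (a :: b :: l) ++ m = a :: b :: (l ++ m) := fun m => rfl
      have e' : ∀ m, (b :: l) ++ m = b :: (l ++ m) := fun m => rfl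
      rw [e, e, indPath_cons_cons, indPath_cons_cons, ← e', ← e', ih,
        NE_append_right, NE_append_right, NE_cons_right (a := c) (B := l₂),
        NE_cons_left (a := a) (B := b :: l)]
      tauto

theorem IndPath.reverse {l : List V} (h : IndPath G l) : IndPath G l.reverse := by
  induction l with
  | nil => simp
  | cons a l ih =>
    cases l with
    | nil => simp
    | cons b l =>
      obtain ⟨h1, h2, h3⟩ := indPath_cons_cons.1 h
      have := ih h3
      simp only [List.reverse_cons, List.append_assoc, List.singleton_append] at this ⊢
      rw [indPath_append_cons]
      exact ⟨this, by simpa using h1.symm, by simpa using h2.symm⟩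

@[simp] theorem indPath_reverse {l : List V} : IndPath G l.reverse ↔ IndPath G l :=
  ⟨fun h => by simpa using h.reverse, IndPath.reverse⟩

theorem IndPath.right {l₁ l₂ : List V} (h : IndPath G (l₁ ++ l₂)) : IndPath G l₂ := by
  cases l₂ with
  | nil => simp
  | cons c l => exact (indPath_append_cons.1 h).2.1

theorem IndPath.left {l₁ l₂ : List V} (h : IndPath G (l₁ ++ l₂)) : IndPath G l₁ := by
  have := h.reverse
  rw [List.reverse_append] at this
  simpa using this.right

theorem IndPath.infix {l m : List V} (h : IndPath G l) (hm : m <:+: l) : IndPath G m := by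
  obtain ⟨s, t, rfl⟩ := hm
  exact h.left.right

theorem IndPath.ne {l₁ l₂ : List V} {c : V} (h : IndPath G (l₁ ++ c :: l₂)) : NE G l₁ l₂ :=
  (indPath_append_cons.1 h).2.2

theorem IndPath.isChain {l : List V} (h : IndPath G l) : l.IsChain G.Adj := by
  induction l with
  | nil => simp
  | cons a l ih =>
    cases l with
    | nil => simp
    | cons b l =>
      obtain ⟨h1, h2, h3⟩ := indPath_cons_cons.1 h
      simp [h1, ih h3]

theorem IndPath.nodup {l : List V} (h : IndPath G l) : l.Nodup := by
  induction l with
  | nil => simp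
  | cons a l ih =>
    cases l with
    | nil => simp
    | cons b l =>
      obtain ⟨h1, h2, h3⟩ := indPath_cons_cons.1 h
      refine List.nodup_cons.2 ⟨?_, ih h3⟩
      rintro (h | h)
      · exact h1.ne rfl
      · rename_i h; exact (h2 a (by simp) a h).1 rfl

/-- `u` and `v` are consecutive in `l`. -/
def Cons (l : List V) (u v : V) : Prop := [u, v] <:+: l ∨ [v, u] <:+: l

theorem Cons.symm {l : List V} {u v : V} (h : Cons l u v) : Cons l v u := Or.symm h

theorem Cons.mono {l m : List V} {u v : V} (h : Cons l u v) (hm : l <:+: m) : Cons m u v :=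
  h.imp (fun h => h.trans hm) (fun h => h.trans hm)

theorem Cons.reverse {l : List V} {u v : V} (h : Cons l u v) : Cons l.reverse u v := by
  have : ∀ {a b : V}, [a, b] <:+: l → [b, a] <:+: l.reverse := by
    intro a b h; simpa using List.reverse_infix.2 h
  exact h.symm.imp this this

theorem IndPath.cons_of_adj {l : List V} (h : IndPath G l) {u v : V} (hu : u ∈ l) (hv : v ∈ l)
    (e : G.Adj u v) : Cons l u v := by
  induction l with
  | nil => simp at hu
  | cons a l ih =>
    cases l with
    | nil => simp at hu hv; subst hu hv; exact absurd rfl e.ne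
    | cons b l =>
      obtain ⟨h1, h2, h3⟩ := indPath_cons_cons.1 h
      have key : ∀ w ∈ b :: l, G.Adj a w → w = b := by
        intro w hw e
        rcases List.mem_cons.1 hw with rfl | hw
        · rfl
        · exact absurd e (h2 a (by simp) w hw).2
      rcases List.mem_cons.1 hu with rfl | hu'
      · rcases List.mem_cons.1 hv with rfl | hv
        · exact absurd rfl e.ne
        · rw [key v hv e]; exact Or.inl ⟨[], l, rfl⟩
      · rcases List.mem_cons.1 hv with rfl | hv'
        · rw [key _ hu' e.symm]; exact Or.inr ⟨[], l, rfl⟩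
        · exact (ih h3 hu' hv' ).mono ⟨[a], [], by simp⟩

theorem cons_append_cons {X Y : List V} {b u v : V} (h : Cons (X ++ b :: Y) u v) :
    Cons (X ++ [b]) u v ∨ Cons (b :: Y) u v := by
  have : ∀ {X : List V} {u v : V}, [u, v] <:+: X ++ b :: Y → [u, v] <:+: X ++ [b] ∨
      [u, v] <:+: b :: Y := by
    intro X
    induction X with
    | nil => intro u v h; exact Or.inr h
    | cons a X ih =>
      intro u v h
      rw [List.cons_append, List.infix_cons_iff] at h
      rcases h with h | h
      · left
        cases X with
        | nil => simp at h; obtain ⟨rfl, rfl⟩ := h; simp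
        | cons c X => simp at h; obtain ⟨rfl, rfl⟩ := h; exact ⟨[], X ++ [b], by simp⟩
      · rcases ih h with h | h
        · left; exact h.trans ⟨[a], [], by simp⟩
        · exact Or.inr h
  rcases h with h | h
  · exact (this h).imp Or.inl Or.inl
  · exact (this h).imp Or.inr Or.inr

/-- `l` lists the vertices of a hole of `G`, in cyclic order. -/
def HoleL (G : SimpleGraph V) (l : List V) : Prop :=
  ∃ a b m c, l = a :: b :: (m ++ [c]) ∧ m ≠ [] ∧ IndPath G (b :: (m ++ [c])) ∧
    G.Adj a b ∧ G.Adj c a ∧ NE G [a] m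

/-- A hole is two induced paths with common ends and with interiors that do not see each other. Both
interiors must be nonempty, as otherwise the ends would be adjacent. New holes are mostly built in
this form. -/
theorem holeL_glue {y y' : V} {A B : List V} (hA : A ≠ []) (hB : B ≠ []) :
    HoleL G (y :: A ++ y' :: B) ↔
      IndPath G (y :: A ++ [y']) ∧ IndPath G (y' :: B ++ [y]) ∧ NE G A B := by
  obtain ⟨b, A, rfl⟩ := List.exists_cons_of_ne_nil hA
  obtain ⟨B, c, rfl⟩ : ∃ B' c, B = B' ++ [c] := ⟨_, _, (List.dropLast_append_getLast hB).symm⟩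
  have e1 : IndPath G (y :: (b :: A) ++ [y']) ↔
      G.Adj y b ∧ NE G [y] (A ++ [y']) ∧ IndPath G (b :: A ++ [y']) := Iff.rfl
  have e2 : IndPath G (y' :: (B ++ [c]) ++ [y]) ↔
      IndPath G (y' :: (B ++ [c])) ∧ G.Adj c y ∧ NE G (y' :: B) [y] := by
    have : y' :: (B ++ [c]) ++ [y] = (y' :: B) ++ c :: [y] := by simp
    rw [this, indPath_append_cons, indPath_pair]; simp
  have e3 : IndPath G (b :: (A ++ y' :: B ++ [c])) ↔
      IndPath G (b :: A ++ [y']) ∧ IndPath G (y' :: (B ++ [c])) ∧ NE G (b :: A) (B ++ [c]) := by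
    have : b :: (A ++ y' :: B ++ [c]) = (b :: A) ++ y' :: (B ++ [c]) := by simp
    rw [this, indPath_append_cons]
  rw [e1, e2]
  have e4 : NE G (y' :: B) [y] ↔ NE G [y] [y'] ∧ NE G [y] B := by
    rw [NE_comm, NE_cons_right]
  have e5 : NE G [y] (A ++ y' :: B) ↔ NE G [y] (A ++ [y']) ∧ NE G [y] B := by
    rw [NE_append_right, NE_append_right, NE_cons_right (a := y')]; tauto
  constructor
  · rintro ⟨a, b', m, c', h, hm, h1, h2, h3, h4⟩
    have h : y :: b :: ((A ++ y' :: B) ++ [c]) = a :: b' :: (m ++ [c']) := by simpa using h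
    obtain ⟨rfl, h'⟩ := List.cons.inj h
    obtain ⟨rfl, h''⟩ := List.cons.inj h'
    obtain ⟨rfl, hc⟩ := List.append_inj' h'' rfl
    obtain rfl := (List.cons.inj hc).1
    rw [e3] at h1
    rw [e5] at h4
    have : NE G [y] [y'] := by
      have := h4.1; rw [NE_append_right] at this; exact this.2
    exact ⟨⟨h2, h4.1, h1.1⟩, ⟨h1.2.1, h3, e4.2 ⟨this, h4.2⟩⟩, h1.2.2⟩
  · rintro ⟨⟨h1, h2, h3⟩, ⟨h4, h5, h6⟩, h7⟩
    exact ⟨y, b, A ++ y' :: B, c, by simp, by simp, e3.2 ⟨h3, h4, h7⟩, h1, h5,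
      e5.2 ⟨h2, (e4.1 h6).2⟩⟩

theorem HoleL.rotate_one {a : V} {l : List V} (h : HoleL G (a :: l)) : HoleL G (l ++ [a]) := by
  obtain ⟨a', b, m, c, h, hm, h1, h2, h3, h4⟩ := h
  obtain ⟨rfl, rfl⟩ := List.cons.inj h
  obtain ⟨d, m, rfl⟩ := List.exists_cons_of_ne_nil hm
  have h1' : G.Adj b d ∧ NE G [b] (m ++ [c]) ∧ IndPath G (d :: (m ++ [c])) := h1
  refine ⟨b, d, m ++ [c], a, by simp, by simp, ?_, h1'.1, h2, h1'.2.1⟩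
  have : d :: (m ++ [c] ++ [a]) = (d :: m) ++ c :: [a] := by simp
  rw [this, indPath_append_cons]
  exact ⟨h1'.2.2, by simpa using h3, h4.symm⟩

theorem HoleL.rotated {l l' : List V} (h : HoleL G l) (hr : l ~r l') : HoleL G l' := by
  obtain ⟨n, rfl⟩ := hr
  induction n generalizing l with
  | zero => simpa using h
  | succ n ih =>
    cases l with
    | nil => obtain ⟨_, _, _, _, h, _⟩ := h; simp at h
    | cons a l => simpa using ih h.rotate_one

theorem HoleL.swap {l l' : List V} (h : HoleL G (l ++ l')) : HoleL G (l' ++ l) :=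
  h.rotated List.isRotated_append

theorem HoleL.reverse {l : List V} (h : HoleL G l) : HoleL G l.reverse := by
  obtain ⟨a, b, m, c, rfl, hm, h1, h2, h3, h4⟩ := h
  have : (a :: b :: (m ++ [c])).reverse = c :: (m.reverse ++ [b]) ++ [a] := by simp
  rw [this]
  refine HoleL.swap (l := [a]) ⟨a, c, m.reverse, b, by simp, by simpa using hm, ?_, h3.symm,
    h2.symm, by simpa using h4⟩
  simpa using h1.reverse

theorem HoleL.nodup {l : List V} (h : HoleL G l) : l.Nodup := by
  obtain ⟨a, b, m, c, rfl, hm, h1, h2, h3, h4⟩ := h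
  refine List.nodup_cons.2 ⟨?_, h1.nodup⟩
  simp only [List.mem_cons, List.mem_append, List.not_mem_nil, or_false]
  rintro (rfl | h | rfl)
  · exact h2.ne rfl
  · exact (h4 a (by simp) a h).1 rfl
  · exact h3.ne rfl

theorem HoleL.cons_of_adj {a : V} {l : List V} (h : HoleL G (a :: l)) {u v : V}
    (hu : u ∈ a :: l) (hv : v ∈ a :: l) (e : G.Adj u v) : Cons (a :: l ++ [a]) u v := by
  obtain ⟨a', b, m, c, h, hm, h1, h2, h3, h4⟩ := h
  obtain ⟨rfl, rfl⟩ := List.cons.inj h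
  have key : ∀ w ∈ b :: (m ++ [c]), G.Adj a w → w = b ∨ w = c := by
    intro w hw e
    simp only [List.mem_cons, List.mem_append, List.not_mem_nil, or_false] at hw
    rcases hw with rfl | hw | rfl
    · simp
    · exact absurd e (h4 a (by simp) w hw).2
    · simp
  have k1 : Cons (a :: (b :: (m ++ [c])) ++ [a]) a b := Or.inl ⟨[], m ++ [c] ++ [a], by simp⟩
  have k2 : Cons (a :: (b :: (m ++ [c])) ++ [a]) a c := Or.inr ⟨a :: b :: m, [], by simp⟩
  rcases List.mem_cons.1 hu with rfl | hu'
  · rcases List.mem_cons.1 hv with rfl | hv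
    · exact absurd rfl e.ne
    · rcases key v hv e with rfl | rfl
      · exact k1
      · exact k2
  · rcases List.mem_cons.1 hv with rfl | hv'
    · rcases key u hu' e.symm with rfl | rfl
      · exact k1.symm
      · exact k2.symm
    · exact (h1.cons_of_adj hu' hv' e).mono ⟨[a], [a], by simp⟩

/-! ### Connected sets and shortest paths -/

/-- `D` is a connected set of vertices. -/
def Conn (G : SimpleGraph V) (D : Set V) : Prop :=
  ∀ a ∈ D, ∀ b ∈ D, Relation.ReflTransGen (fun u v => u ∈ D ∧ v ∈ D ∧ G.Adj u v) a b

theorem linked_symm {D : Set V} {a b : V}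
    (h : Relation.ReflTransGen (fun u v => u ∈ D ∧ v ∈ D ∧ G.Adj u v) a b) :
    Relation.ReflTransGen (fun u v => u ∈ D ∧ v ∈ D ∧ G.Adj u v) b a :=
  have : Std.Symm (fun u v => u ∈ D ∧ v ∈ D ∧ G.Adj u v) := ⟨fun _ _ h => ⟨h.2.1, h.1, h.2.2.symm⟩⟩
  Relation.ReflTransGen.stdSymm.symm _ _ h

theorem linked_mono {D D' : Set V} (hD : D ⊆ D') {a b : V}
    (h : Relation.ReflTransGen (fun u v => u ∈ D ∧ v ∈ D ∧ G.Adj u v) a b) :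
    Relation.ReflTransGen (fun u v => u ∈ D' ∧ v ∈ D' ∧ G.Adj u v) a b :=
  Relation.ReflTransGen.mono (fun _ _ (h : _ ∧ _) => ⟨hD h.1, hD h.2.1, h.2.2⟩) _ _ h

theorem Conn.union {D D' : Set V} (h : Conn G D) (h' : Conn G D') {a b : V} (ha : a ∈ D)
    (hb : b ∈ D') (e : a = b ∨ G.Adj a b) : Conn G (D ∪ D') := by
  have hab : Relation.ReflTransGen (fun u v => u ∈ D ∪ D' ∧ v ∈ D ∪ D' ∧ G.Adj u v) a b := by
    rcases e with rfl | e
    · exact .refl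
    · exact .single ⟨Or.inl ha, Or.inr hb, e⟩
  have key : ∀ u ∈ D ∪ D', Relation.ReflTransGen
      (fun u v => u ∈ D ∪ D' ∧ v ∈ D ∪ D' ∧ G.Adj u v) u b := by
    rintro u (hu | hu)
    · exact (linked_mono Set.subset_union_left (h u hu a ha)).trans hab
    · exact linked_mono Set.subset_union_right (h' u hu b hb)
  exact fun u hu v hv => (key u hu).trans (linked_symm (key v hv))

theorem conn_singleton {a : V} : Conn G {a} := by
  rintro u rfl v rfl; exact .refl

theorem conn_of_isChain {l : List V} (h : l.IsChain G.Adj) : Conn G {v | v ∈ l} := by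
  induction l with
  | nil => intro u hu; simp at hu
  | cons a l ih =>
    cases l with
    | nil =>
      have : {v | v ∈ [a]} = ({a} : Set V) := by ext; simp
      rw [this]; exact conn_singleton
    | cons b l =>
      rw [List.isChain_cons_cons] at h
      have : {v | v ∈ a :: b :: l} = {a} ∪ {v | v ∈ b :: l} := by ext; simp
      rw [this]
      exact conn_singleton.union (ih h.2) rfl (b := b) (by simp) (Or.inr h.1)

theorem exists_chain_of_linked {D : Set V} {a b : V} (ha : a ∈ D)
    (h : Relation.ReflTransGen (fun u v => u ∈ D ∧ v ∈ D ∧ G.Adj u v) a b) :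
    ∃ L : List V, L.IsChain G.Adj ∧ (∀ v ∈ L, v ∈ D) ∧ L.head? = some a ∧
      L.getLast? = some b := by
  induction h with
  | refl => exact ⟨[a], by simp, by simpa using ha, rfl, rfl⟩
  | tail _ h ih =>
    obtain ⟨L, h1, h2, h3, h4⟩ := ih
    rename_i c d _
    refine ⟨L ++ [d], ?_, ?_, ?_, by simp⟩
    · rw [List.isChain_append]
      refine ⟨h1, by simp, ?_⟩
      intro x hx y hy
      rw [h4] at hx
      simp at hx hy
      subst hx hy
      exact h.2.2
    · simp only [List.mem_append, List.mem_singleton]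
      rintro v (hv | rfl)
      · exact h2 v hv
      · exact h.2.1
    · cases L with
      | nil => simp at h3
      | cons _ _ => simpa using h3

theorem getLast?_append_cons {l m : List V} {v : V} :
    (l ++ v :: m).getLast? = (v :: m).getLast? := by
  rw [List.getLast?_append_of_ne_nil _ (by simp)]

theorem getLast?_cons_append_cons {l m : List V} {u v : V} :
    (u :: (l ++ v :: m)).getLast? = (v :: m).getLast? :=
  getLast?_append_cons (l := u :: l)

/-- A shortest chain with given kinds of ends is an induced path. -/
theorem indPath_of_shortest {L : List V} (h : L.IsChain G.Adj)
    (hmin : ∀ L' : List V, L'.IsChain G.Adj → L' ⊆ L → L'.head? = L.head? →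
      L'.getLast? = L.getLast? → L.length ≤ L'.length) : IndPath G L := by
  induction L with
  | nil => simp
  | cons a l ih =>
    cases l with
    | nil => simp
    | cons b l =>
      rw [List.isChain_cons_cons] at h
      refine ⟨h.1, ?_, ?_⟩
      · intro u hu v hv
        simp at hu
        subst hu
        obtain ⟨s, t, rfl⟩ := List.append_of_mem hv
        have hc : List.IsChain G.Adj (v :: t) := h.2.right_of_append (l₁ := b :: s)
        refine ⟨?_, ?_⟩
        · rintro rfl
          have := hmin (u :: t) hc (by intro x; simp; tauto) (by simp)
            (by cases t <;> simp [getLast?_cons_append_cons, List.getLast?_cons_cons])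
          simp at this; omega
        · intro e
          have := hmin (u :: v :: t) (by simp [e, hc]) (by intro x; simp; tauto) (by simp)
            (by cases t <;> simp [getLast?_cons_append_cons, List.getLast?_cons_cons])
          simp at this; omega
      · refine ih h.2 ?_
        intro L' h1 h2 h3 h4
        cases L' with
        | nil => simp at h3
        | cons c L' =>
          simp at h3
          subst h3
          have := hmin (a :: c :: L') (by simp [h.1, h1])
            (List.cons_subset_cons _ h2) (by simp)
            (by rw [List.getLast?_cons_cons, h4, List.getLast?_cons_cons])
          simp at this ⊢; omega

/-- A shortest chain inside `D` from `X` to `Y` works: a chord would shorten it, and so would a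
second vertex in `X` or an earlier vertex in `Y`. The last two clauses therefore say that only the
first vertex lies in `X` and only the last in `Y`. -/
theorem exists_indPath {D X Y : Set V} {a b : V} (ha : a ∈ D) (haX : a ∈ X) (hbY : b ∈ Y)
    (h : Relation.ReflTransGen (fun u v => u ∈ D ∧ v ∈ D ∧ G.Adj u v) a b) :
    ∃ L : List V, L ≠ [] ∧ IndPath G L ∧ (∀ v ∈ L, v ∈ D) ∧
      (∃ s ∈ X, L.head? = some s) ∧ (∃ t ∈ Y, L.getLast? = some t) ∧
      (∀ v ∈ L.tail, v ∉ X) ∧ (∀ v ∈ L.dropLast, v ∉ Y) := by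
  classical
  let Q : ℕ → Prop := fun n => ∃ L : List V, L.length = n ∧ L.IsChain G.Adj ∧ (∀ v ∈ L, v ∈ D) ∧
    (∃ s ∈ X, L.head? = some s) ∧ (∃ t ∈ Y, L.getLast? = some t)
  have hQ : ∃ n, Q n := by
    obtain ⟨L, h1, h2, h3, h4⟩ := exists_chain_of_linked ha h
    exact ⟨_, L, rfl, h1, h2, ⟨a, haX, h3⟩, ⟨b, hbY, h4⟩⟩
  obtain ⟨L, hn, h1, h2, ⟨s, hs, h3⟩, ⟨t, ht, h4⟩⟩ := Nat.find_spec hQ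
  have hmin : ∀ L' : List V, L'.IsChain G.Adj → (∀ v ∈ L', v ∈ D) →
      (∃ s ∈ X, L'.head? = some s) → (∃ t ∈ Y, L'.getLast? = some t) → L.length ≤ L'.length := by
    intro L' h1 h2 h3 h4
    rw [hn]
    exact Nat.find_min' hQ ⟨L', rfl, h1, h2, h3, h4⟩
  refine ⟨L, by rintro rfl; simp at h3, ?_, h2, ⟨s, hs, h3⟩, ⟨t, ht, h4⟩, ?_, ?_⟩
  · apply indPath_of_shortest h1
    intro L' k1 k2 k3 k4
    exact hmin L' k1 (fun v hv => h2 v (k2 hv)) ⟨s, hs, by rw [k3, h3]⟩ ⟨t, ht, by rw [k4, h4]⟩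
  · intro v hv hvX
    obtain ⟨p, q, e⟩ := List.append_of_mem hv
    cases L with
    | nil => simp at hv
    | cons c L =>
      simp at e
      subst e
      have := hmin (v :: q) (h1.right_of_append (l₁ := c :: p))
        (fun w hw => h2 w (by simp at hw ⊢; tauto)) ⟨v, hvX, rfl⟩
        ⟨t, ht, by rw [← h4, getLast?_cons_append_cons]⟩
      simp at this; omega
  · intro v hv hvY
    obtain ⟨p, q, e⟩ := List.append_of_mem hv
    have hL : L ≠ [] := by rintro rfl; simp at hv
    have e' : L = p ++ v :: (q ++ [L.getLast hL]) := by
      conv_lhs => rw [← List.dropLast_append_getLast hL, e]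
      simp
    have e2 : L = (p ++ [v]) ++ (q ++ [L.getLast hL]) := by simpa using e'
    have := hmin (p ++ [v]) (by rw [e2] at h1; exact h1.left_of_append)
        (fun w hw => h2 w (by rw [e2]; exact List.mem_append_left _ hw))
        ⟨s, hs, by rw [← h3]; conv_rhs => rw [e']
                   cases p <;> simp⟩ ⟨v, hvY, by simp⟩
    have e3 := congrArg List.length e2
    simp only [List.length_append] at this e3
    simp only [List.length_singleton] at this e3
    omega

/-! ### Recognising an induced subdivision of K₄ -/

theorem exists_walk_induce {S : Set V} {l : List V} {a b : V} (ha : a ∈ S) (hb : b ∈ S)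
    (hl : ∀ v ∈ l, v ∈ S) (hc : (a :: l ++ [b]).IsChain G.Adj) :
    ∃ w : (G.induce S).Walk ⟨a, ha⟩ ⟨b, hb⟩, w.support.map Subtype.val = a :: l ++ [b] := by
  lift l to List S using hl
  have hc' : ((⟨a, ha⟩ : S)  :: l ++ [(⟨b, hb⟩ : S)]).IsChain (G.induce S).Adj := by
    have : (List.map Subtype.val ((⟨a, ha⟩ : S) :: l ++ [⟨b, hb⟩])).IsChain G.Adj := by
      simpa using hc
    rw [List.isChain_map] at this
    exact this
  have key : ∀ (m : List S) (hne : m ≠ []) (_ : m.IsChain (G.induce S).Adj) (a b : S),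
      m.head hne = a → m.getLast hne = b → ∃ w : (G.induce S).Walk a b, w.support = m := by
    rintro m hne hm _ _ rfl rfl
    exact ⟨SimpleGraph.Walk.ofSupport m hne hm, SimpleGraph.Walk.support_ofSupport hne hm⟩
  obtain ⟨w, hw⟩ := key _ (List.cons_ne_nil _ _) hc' ⟨a, ha⟩ ⟨b, hb⟩ rfl (by simp)
  exact ⟨w, by rw [hw]; simp⟩

/-- Bridge from lists to `IsSubdivision`: the branch vertices are the values of `f`, and `L i j` for
`i < j` is the interior of the path replacing the edge ij. The hypothesis `hE` makes the subdivision
induced. -/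
theorem isSubdivision_of_lists (f : Fin 4 → V) (L : Fin 4 → Fin 4 → List V) (S : Set V)
    (hf : Function.Injective f)
    (hchain : ∀ i j, i < j → (f i :: L i j ++ [f j]).IsChain G.Adj)
    (hnd : ∀ i j, i < j → (L i j).Nodup)
    (hfL : ∀ i j, i < j → ∀ c, f c ∉ L i j)
    (hdisj : ∀ i j i' j', i < j → i' < j' → (i, j) ≠ (i', j') → ∀ v ∈ L i j, v ∉ L i' j')
    (hS : ∀ v, v ∈ S ↔ (∃ i, v = f i) ∨ ∃ i j, i < j ∧ v ∈ L i j)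
    (hE : ∀ u ∈ S, ∀ v ∈ S, G.Adj u v → ∃ i j, i < j ∧ Cons (f i :: L i j ++ [f j]) u v) :
    IsSubdivision (⊤ : SimpleGraph (Fin 4)) (G.induce S) := by
  have hfS : ∀ i, f i ∈ S := fun i => (hS _).2 (Or.inl ⟨i, rfl⟩)
  have hQ : ∀ i j : Fin 4, i < j → ∃ w : (G.induce S).Walk ⟨f i, hfS i⟩ ⟨f j, hfS j⟩,
      w.support.map Subtype.val = f i :: L i j ++ [f j] := fun i j hij =>
    exists_walk_induce _ _ (fun v hv => (hS v).2 (Or.inr ⟨i, j, hij, hv⟩)) (hchain i j hij)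
  choose Q hQ using hQ
  have hlt : ∀ {i j : Fin 4}, (⊤ : SimpleGraph (Fin 4)).Adj i j → ¬ i < j → j < i :=
    fun h h' => lt_of_le_of_ne (not_lt.1 h') h.ne'
  let f' : Fin 4 → S := fun i => ⟨f i, hfS i⟩
  -- Interiors are prescribed only for `i < j`; the opposite direction has to be the reversed walk.
  let P : ∀ i j : Fin 4, (⊤ : SimpleGraph (Fin 4)).Adj i j → (G.induce S).Walk (f' i) (f' j) :=
    fun i j h => if hij : i < j then Q i j hij else (Q j i (hlt h hij)).reverse
  have P1 : ∀ i j h (hij : i < j), P i j h = Q i j hij := fun i j h hij => dif_pos hij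
  have P2 : ∀ i j h (hij : j < i), P i j h = (Q j i hij).reverse :=
    fun i j h hij => dif_neg (not_lt.2 hij.le)
  have Qm : ∀ i j (hij : i < j) (v : S), v ∈ (Q i j hij).support ↔
      v.1 = f i ∨ v.1 = f j ∨ v.1 ∈ L i j := by
    intro i j hij v
    rw [← List.mem_map_of_injective Subtype.val_injective, hQ]
    simp; tauto
  have Pm : ∀ i j h (v : S), v ∈ (P i j h).support ↔
      v.1 = f i ∨ v.1 = f j ∨ v.1 ∈ L (min i j) (max i j) := by
    intro i j h v
    rcases lt_or_gt_of_ne h.ne with hij | hij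
    · rw [P1 i j h hij, Qm, min_eq_left hij.le, max_eq_right hij.le]
    · rw [P2 i j h hij, SimpleGraph.Walk.support_reverse, List.mem_reverse, Qm,
        min_eq_right hij.le, max_eq_left hij.le]
      tauto
  have hmm : ∀ i j : Fin 4, (⊤ : SimpleGraph (Fin 4)).Adj i j → min i j < max i j :=
    fun i j h => min_lt_max.2 h.ne
  have Qp : ∀ i j hij, (Q i j hij).IsPath := by
    intro i j hij
    rw [SimpleGraph.Walk.isPath_def]
    apply List.Nodup.of_map Subtype.val
    rw [hQ]
    simp only [List.cons_append, List.nodup_cons, List.mem_append, List.mem_singleton,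
      List.nodup_append]
    refine ⟨?_, hnd i j hij, by simp, ?_⟩
    · rintro (h | h)
      · exact hfL i j hij i h
      · exact hij.ne (hf h)
    · rintro a ha b rfl rfl
      exact hfL i j hij j ha
  refine ⟨f', P, ?_, ?_, ?_, ?_, ?_, ?_, ?_⟩
  · intro i j h
    exact hf (congrArg Subtype.val h)
  · intro i j h
    rcases lt_or_gt_of_ne h.ne with hij | hij
    · rw [P1 i j h hij]; exact Qp _ _ _
    · rw [P2 i j h hij]; exact (Qp _ _ _).reverse
  · intro i j h
    rcases lt_or_gt_of_ne h.ne with hij | hij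
    · rw [P1 i j h hij, P2 j i h.symm hij]
    · rw [P2 i j h hij, P1 j i h.symm hij, SimpleGraph.Walk.reverse_reverse]
  · intro i j h c hc
    rw [Pm _ _ h] at hc
    rcases hc with hc | hc | hc
    · exact Or.inl (hf hc)
    · exact Or.inr (hf hc)
    · exact absurd hc (hfL _ _ (hmm i j h) c)
  · intro i j h i' j' h' hne v hv hv'
    rw [Pm _ _ h] at hv
    rw [Pm _ _ h'] at hv'
    rcases hv with hv | hv | hv
    · exact ⟨i, Subtype.ext hv.symm⟩
    · exact ⟨j, Subtype.ext hv.symm⟩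
    rcases hv' with hv' | hv' | hv'
    · exact ⟨i', Subtype.ext hv'.symm⟩
    · exact ⟨j', Subtype.ext hv'.symm⟩
    refine absurd hv' (hdisj _ _ _ _ (hmm i j h) (hmm i' j' h') ?_ v.1 hv)
    intro e
    apply hne
    have e1 := congrArg Prod.fst e
    have e2 := congrArg Prod.snd e
    simp only at e1 e2
    rw [Sym2.eq_iff]
    rcases le_total i j with a | a <;> rcases le_total i' j' with b | b <;>
      simp only [min_eq_left, min_eq_right, max_eq_left, max_eq_right, a, b] at e1 e2 <;> tauto
  · rintro ⟨v, hv⟩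
    rcases (hS v).1 hv with ⟨i, rfl⟩ | ⟨i, j, hij, h⟩
    · exact Or.inl ⟨i, rfl⟩
    · refine Or.inr ⟨i, j, hij.ne, ?_⟩
      rw [Pm _ _ hij.ne, min_eq_left hij.le, max_eq_right hij.le]
      exact Or.inr (Or.inr h)
  · rintro ⟨u, hu⟩ ⟨v, hv⟩ e
    obtain ⟨i, j, hij, h⟩ := hE u hu v hv e
    refine ⟨i, j, hij.ne, ?_⟩
    rw [← SimpleGraph.Walk.infix_support_iff_mem_edges, P1 i j hij.ne hij]
    have key : ∀ a b : S, [a.1, b.1] <:+: f i :: L i j ++ [f j] →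
        [a, b] <:+: (Q i j hij).support := by
      rintro a b ⟨s, t, h⟩
      rw [← hQ i j hij] at h
      obtain ⟨x, y, h1, h2, h3⟩ := List.append_eq_map_iff.1 h
      obtain ⟨x', y', h4, h5, h6⟩ := List.append_eq_map_iff.1 h2.symm
      have : y' = [a, b] :=
        List.map_injective_iff.2 Subtype.val_injective (by rw [h6]; rfl)
      rw [h1, h4, this]
      exact ⟨x', y, rfl⟩
    exact h.imp (key ⟨u, hu⟩ ⟨v, hv⟩) (key ⟨v, hv⟩ ⟨u, hu⟩)

theorem exists_first {p : V → Prop} {l : List V} (h : ∃ v ∈ l, p v) :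
    ∃ l₁ v l₂, l = l₁ ++ v :: l₂ ∧ p v ∧ ∀ w ∈ l₁, ¬ p w := by
  induction l with
  | nil => simp at h
  | cons a l ih =>
    by_cases ha : p a
    · exact ⟨[], a, l, rfl, ha, by simp⟩
    · obtain ⟨v, hv, hp⟩ := h
      rcases List.mem_cons.1 hv with rfl | hv
      · exact absurd hp ha
      · obtain ⟨l₁, w, l₂, rfl, h1, h2⟩ := ih ⟨v, hv, hp⟩
        exact ⟨a :: l₁, w, l₂, rfl, h1, by simpa using ⟨ha, h2⟩⟩

theorem exists_last {p : V → Prop} {l : List V} (h : ∃ v ∈ l, p v) :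
    ∃ l₁ v l₂, l = l₁ ++ v :: l₂ ∧ p v ∧ ∀ w ∈ l₂, ¬ p w := by
  obtain ⟨l₁, v, l₂, e, h1, h2⟩ := exists_first (l := l.reverse) (p := p) (by simpa using h)
  refine ⟨l₂.reverse, v, l₁.reverse, ?_, h1, by simpa using h2⟩
  rw [← List.reverse_reverse l, e]; simp

/-! ### Three links between a hole and a connected set -/

/-- `G` has no triangle. -/
def TriFree (G : SimpleGraph V) : Prop := ∀ a b c, G.Adj a b → G.Adj b c → ¬ G.Adj a c

theorem triFree_of_cliqueFree (h : G.CliqueFree 3) : TriFree G := by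
  classical
  intro a b c h1 h2 h3
  exact h {a, b, c} (SimpleGraph.is3Clique_triple_iff.2 ⟨h1, h3, h2⟩)

/-- An induced subdivided claw (with possibly trivial legs) joining three given vertices. -/
def Claw (G : SimpleGraph V) (d : V) (La Lb Lc : List V) (a b c : V) : Prop :=
  IndPath G (d :: La) ∧ IndPath G (d :: Lb) ∧ IndPath G (d :: Lc) ∧
    NE G La Lb ∧ NE G La Lc ∧ NE G Lb Lc ∧
    (d :: La).getLast? = some a ∧ (d :: Lb).getLast? = some b ∧ (d :: Lc).getLast? = some c

theorem claw_of {Q₁ Q₂ R : List V} {d a b c : V} (h : IndPath G (Q₁ ++ d :: Q₂))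
    (hR : IndPath G (d :: R)) (h1 : NE G R Q₁) (h2 : NE G R Q₂)
    (ha : (Q₁ ++ d :: Q₂).head? = some a) (hb : (Q₁ ++ d :: Q₂).getLast? = some b)
    (hc : (d :: R).getLast? = some c) : Claw G d Q₁.reverse Q₂ R a b c := by
  rw [indPath_append_cons] at h
  refine ⟨?_, h.2.1, hR, by simpa using h.2.2, by simpa using h1.symm, h2.symm, ?_, ?_, hc⟩
  · have := h.1.reverse
    simpa using this
  · rw [← ha]
    have : d :: Q₁.reverse = (Q₁ ++ [d]).reverse := by simp
    rw [this, List.getLast?_reverse]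
    cases Q₁ <;> simp
  · rw [← hb, getLast?_append_cons]

/-- Take a shortest path Q from a to b, and a shortest path R from c to the closed neighbourhood of
Q. If the last vertex of R has one neighbour on Q, that neighbour is the centre. If it has several,
it becomes the centre itself and replaces the part of Q between its first and last neighbours, which
are not adjacent because there is no triangle. The vertices a, b, c may coincide, so legs may be
empty. -/
theorem exists_claw (hT : TriFree G) {D : Set V} (hD : Conn G D) {a b c : V} (ha : a ∈ D)
    (hb : b ∈ D) (hc : c ∈ D) :
    ∃ d La Lb Lc, Claw G d La Lb Lc a b c ∧ d ∈ D ∧ (∀ v ∈ La, v ∈ D) ∧ (∀ v ∈ Lb, v ∈ D) ∧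
      (∀ v ∈ Lc, v ∈ D) := by
  obtain ⟨Q, hQ, hQi, hQD, ⟨s, rfl, hs⟩, ⟨t, rfl, ht⟩, -, -⟩ :=
    exists_indPath (X := {a}) (Y := {b}) ha rfl rfl (hD a ha b hb)
  by_cases hcQ : c ∈ Q
  · obtain ⟨Q₁, Q₂, rfl⟩ := List.append_of_mem hcQ
    refine ⟨c, Q₁.reverse, Q₂, [], claw_of hQi (by simp) (by simp) (by simp) hs ht rfl,
      hc, ?_, ?_, by simp⟩
    · intro v hv; exact hQD v (by simp at hv ⊢; tauto)
    · intro v hv; exact hQD v (by simp at hv ⊢; tauto)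
  · have haQ : s ∈ Q := List.mem_of_mem_head? hs
    obtain ⟨R, hR, hRi, hRD, ⟨c', rfl, hc'⟩, ⟨r, hr, hr'⟩, -, hRY⟩ :=
      exists_indPath (X := {c}) (Y := {w | w ∈ Q ∨ ∃ q ∈ Q, G.Adj w q}) hc rfl (Or.inl haQ)
        (hD c hc s ha)
    obtain ⟨R₀, r', rfl⟩ : ∃ B' c, R = B' ++ [c] := ⟨_, _, (List.dropLast_append_getLast hR).symm⟩
    simp at hr'
    subst hr'
    simp only [List.dropLast_concat, Set.mem_ofPred_eq, not_or, not_exists, not_and] at hRY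
    -- If R ended on Q, the vertex before the end would already be adjacent to Q, and R would have
    -- stopped there.
    have hrQ : r' ∉ Q := by
      intro h
      rcases List.eq_nil_or_concat R₀ with rfl | ⟨R₁, w, rfl⟩
      · simp at hc'; subst hc'; exact hcQ h
      · have : IndPath G (R₁ ++ w :: [r']) := by simpa using hRi
        have := this.right
        exact (hRY w (by simp)).2 r' h (by simpa using this)
    have hr : ∃ q ∈ Q, G.Adj r' q := hr.resolve_left hrQ
    have hNE : NE G R₀ Q := fun u hu v hv =>
      ⟨fun h => (hRY u hu).1 (h ▸ hv), (hRY u hu).2 v hv⟩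
    have hRr : IndPath G (r' :: R₀.reverse) := by simpa using hRi.reverse
    have hRl : (r' :: R₀.reverse).getLast? = some c' := by
      rw [← hc']
      have : r' :: R₀.reverse = (R₀ ++ [r']).reverse := by simp
      rw [this, List.getLast?_reverse]
    obtain ⟨Q₁, q, Q₂, rfl, hq, hQ₁⟩ := exists_first hr
    by_cases h2 : ∃ v ∈ Q₂, G.Adj r' v
    · obtain ⟨Q₃, q', Q₄, rfl, hq', hQ₄⟩ := exists_last h2
      have n1 : NE G Q₁ (q' :: Q₄) := hQi.ne.mono (by simp) (by simp)
      have n2 : NE G (q :: Q₃) Q₄ := by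
        have := hQi.right
        rw [← List.cons_append] at this
        exact this.ne
      have n3 : NE G [r'] (Q₁ ++ Q₄) := by
        intro u hu v hv
        simp at hu; subst hu
        refine ⟨?_, ?_⟩
        · rintro rfl; apply hrQ; simp at hv ⊢; tauto
        · simp at hv
          rcases hv with hv | hv
          · exact hQ₁ v hv
          · exact hQ₄ v hv
      have hqq : q ≠ q' := by
        have := hQi.right.nodup
        rintro rfl
        simp at this
      have n4 : NE G [q] [q'] := by
        intro u hu v hv
        simp at hu hv; subst hu hv
        exact ⟨hqq, fun e => hT _ _ _ hq.symm hq' e⟩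
      -- The detour through r' is again an induced path from a to b, now with r' in its interior, so
      -- that R hangs from it without further edges.
      have hi : IndPath G ((Q₁ ++ [q]) ++ r' :: (q' :: Q₄)) := by
        have k1 : IndPath G (Q₁ ++ q :: [r']) := by
          rw [indPath_append_cons]
          refine ⟨IndPath.left (l₂ := Q₃ ++ q' :: Q₄) (by simpa using hQi), by simpa using hq.symm, ?_⟩
          rw [NE_append_right] at n3; exact n3.1.symm
        have k2 : IndPath G (q' :: Q₄) := IndPath.right (l₁ := Q₁ ++ q :: Q₃) (by simpa using hQi)
        rw [indPath_append_cons]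
        refine ⟨by simpa using k1, ⟨hq', ?_, k2⟩, ?_⟩
        · rw [NE_append_right] at n3; exact n3.2
        · rw [NE_append_left, NE_cons_right (B := Q₄) (C := [q])]
          exact ⟨n1, n4, n2.mono (by simp) (by simp)⟩
      refine ⟨r', _, _, R₀.reverse, claw_of hi hRr ?_ ?_ ?_ ?_ hRl, hRD r' (by simp), ?_, ?_, ?_⟩
      · exact hNE.mono (by simp) (by intro x; simp; tauto)
      · exact hNE.mono (by simp) (by intro x; simp; tauto)
      · rw [← hs]; cases Q₁ <;> simp
      · rw [← ht]; simp [getLast?_cons_append_cons, List.getLast?_cons_cons]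
      · intro v hv; exact hQD v (by simp at hv ⊢; tauto)
      · intro v hv; exact hQD v (by simp at hv ⊢; tauto)
      · intro v hv; exact hRD v (by simp at hv ⊢; tauto)
    · push Not at h2
      refine ⟨q, _, Q₂, r' :: R₀.reverse, claw_of hQi ⟨hq.symm, ?_, hRr⟩ ?_ ?_ hs ht ?_,
        hQD _ (by simp), ?_, ?_, ?_⟩
      · exact (hNE.mono (by simp) (by simp)).symm
      · rw [NE_cons_left]
        refine ⟨fun u hu v hv => ?_, hNE.mono (by simp) (by simp)⟩
        simp at hu; subst hu
        exact ⟨by rintro rfl; apply hrQ; simp [hv], hQ₁ v hv⟩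
      · rw [NE_cons_left]
        refine ⟨fun u hu v hv => ?_, hNE.mono (by simp) (by intro x; simp; tauto)⟩
        simp at hu; subst hu
        exact ⟨by rintro rfl; apply hrQ; simp [hv], h2 v hv⟩
      · rw [List.getLast?_cons_cons, hRl]
      · intro v hv; exact hQD v (by simp at hv ⊢; tauto)
      · intro v hv; exact hQD v (by simp at hv ⊢; tauto)
      · intro v hv; exact hRD v (by simp at hv ⊢; tauto)

/-- The case of four named branch vertices and six named interiors. A single `Nodup` hypothesis
encodes all the disjointness conditions. -/
theorem isSubdivision_of_six {a b c d : V} {L₀₁ L₀₂ L₀₃ L₁₂ L₁₃ L₂₃ : List V} {S : Set V}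
    (hnd : ([a, b, c, d] ++ (L₀₁ ++ (L₀₂ ++ (L₀₃ ++ (L₁₂ ++ (L₁₃ ++ L₂₃)))))).Nodup)
    (h₀₁ : (a :: L₀₁ ++ [b]).IsChain G.Adj) (h₀₂ : (a :: L₀₂ ++ [c]).IsChain G.Adj)
    (h₀₃ : (a :: L₀₃ ++ [d]).IsChain G.Adj) (h₁₂ : (b :: L₁₂ ++ [c]).IsChain G.Adj)
    (h₁₃ : (b :: L₁₃ ++ [d]).IsChain G.Adj) (h₂₃ : (c :: L₂₃ ++ [d]).IsChain G.Adj)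
    (hS : ∀ v, v ∈ S ↔ v ∈ [a, b, c, d] ++ (L₀₁ ++ (L₀₂ ++ (L₀₃ ++ (L₁₂ ++ (L₁₃ ++ L₂₃))))))
    (hE : ∀ u ∈ S, ∀ v ∈ S, G.Adj u v → Cons (a :: L₀₁ ++ [b]) u v ∨ Cons (a :: L₀₂ ++ [c]) u v ∨
      Cons (a :: L₀₃ ++ [d]) u v ∨ Cons (b :: L₁₂ ++ [c]) u v ∨ Cons (b :: L₁₃ ++ [d]) u v ∨
      Cons (c :: L₂₃ ++ [d]) u v) :
    IsSubdivision (⊤ : SimpleGraph (Fin 4)) (G.induce S) := by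
  obtain ⟨n1, n2, n3⟩ := List.nodup_append.1 hnd
  have hf : Function.Injective ![a, b, c, d] := by
    have := List.nodup_ofFn.1 (show (List.ofFn ![a, b, c, d]).Nodup by simpa [List.ofFn_succ] using n1)
    exact this
  have six : ∀ p : Fin 4 → Fin 4 → Prop, (∀ i j, i < j → p i j) ↔
      (p 0 1 ∧ p 0 2 ∧ p 0 3 ∧ p 1 2 ∧ p 1 3 ∧ p 2 3) := by
    intro p
    constructor
    · intro h; exact ⟨h _ _ (by decide), h _ _ (by decide), h _ _ (by decide), h _ _ (by decide),
        h _ _ (by decide), h _ _ (by decide)⟩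
    · rintro ⟨h1, h2, h3, h4, h5, h6⟩ i j hij
      fin_cases i <;> fin_cases j <;> first | assumption | (exfalso; revert hij; decide)
  refine isSubdivision_of_lists ![a, b, c, d]
    ![![[], L₀₁, L₀₂, L₀₃], ![[], [], L₁₂, L₁₃], ![[], [], [], L₂₃], ![[], [], [], []]]
    S hf ?_ ?_ ?_ ?_ ?_ ?_
  · rw [six]; exact ⟨h₀₁, h₀₂, h₀₃, h₁₂, h₁₃, h₂₃⟩
  · rw [six]
    simp only [List.nodup_append] at n2
    exact ⟨n2.1, n2.2.1.1, n2.2.1.2.1.1, n2.2.1.2.1.2.1.1, n2.2.1.2.1.2.1.2.1.1,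
      n2.2.1.2.1.2.1.2.1.2.1⟩
  · rw [six]
    have key : ∀ v ∈ L₀₁ ++ (L₀₂ ++ (L₀₃ ++ (L₁₂ ++ (L₁₃ ++ L₂₃)))), ∀ i, ![a, b, c, d] i ≠ v := by
      intro v hv i
      exact n3 _ (by fin_cases i <;> simp) v hv
    refine ⟨?_, ?_, ?_, ?_, ?_, ?_⟩ <;> intro i hi <;> refine key _ ?_ i rfl <;>
      simp only [List.mem_append]
    · exact Or.inl hi
    · exact Or.inr (Or.inl hi)
    · exact Or.inr (Or.inr (Or.inl hi))
    · exact Or.inr (Or.inr (Or.inr (Or.inl hi)))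
    · exact Or.inr (Or.inr (Or.inr (Or.inr (Or.inl hi))))
    · exact Or.inr (Or.inr (Or.inr (Or.inr (Or.inr hi))))
  · simp only [List.nodup_append, List.mem_append] at n2
    have key : ∀ i j, i < j → ∀ i' j', i' < j' → (i, j) ≠ (i', j') →
      ∀ v ∈ (![![[], L₀₁, L₀₂, L₀₃], ![[], [], L₁₂, L₁₃], ![[], [], [], L₂₃], ![[], [], [], []]] : Fin 4 → Fin 4 → List V) i j,
        v ∉ (![![[], L₀₁, L₀₂, L₀₃], ![[], [], L₁₂, L₁₃], ![[], [], [], L₂₃], ![[], [], [], []]] : Fin 4 → Fin 4 → List V) i' j' := by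
      obtain ⟨-, ⟨-, ⟨-, ⟨-, ⟨-, -, k5⟩, k4⟩, k3⟩, k2⟩, k1⟩ := n2
      rw [six]
      refine ⟨?_, ?_, ?_, ?_, ?_, ?_⟩ <;> rw [six] <;> refine ⟨?_, ?_, ?_, ?_, ?_, ?_⟩ <;>
        intro hne v hv hv' <;> simp at hne <;> simp at hv hv' <;>
        first
        | exact k1 v hv v (by tauto) rfl
        | exact k1 v hv' v (by tauto) rfl
        | exact k2 v hv v (by tauto) rfl
        | exact k2 v hv' v (by tauto) rfl
        | exact k3 v hv v (by tauto) rfl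
        | exact k3 v hv' v (by tauto) rfl
        | exact k4 v hv v (by tauto) rfl
        | exact k4 v hv' v (by tauto) rfl
        | exact k5 v hv v hv' rfl
        | exact k5 v hv' v hv rfl
    exact fun i j i' j' h h' => key i j h i' j' h'
  · intro v
    rw [hS]
    constructor
    · intro h
      simp only [List.mem_append, List.mem_cons, List.not_mem_nil, or_false] at h
      rcases h with (h | h | h | h) | h | h | h | h | h | h
      · exact Or.inl ⟨0, h⟩
      · exact Or.inl ⟨1, h⟩
      · exact Or.inl ⟨2, h⟩
      · exact Or.inl ⟨3, h⟩
      · exact Or.inr ⟨0, 1, by decide, h⟩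
      · exact Or.inr ⟨0, 2, by decide, h⟩
      · exact Or.inr ⟨0, 3, by decide, h⟩
      · exact Or.inr ⟨1, 2, by decide, h⟩
      · exact Or.inr ⟨1, 3, by decide, h⟩
      · exact Or.inr ⟨2, 3, by decide, h⟩
    · simp only [List.mem_append, List.mem_cons, List.not_mem_nil, or_false]
      rintro (⟨i, rfl⟩ | ⟨i, j, hij, h⟩)
      · fin_cases i <;> simp
      · suffices H : ∀ i j, i < j → v ∈ (![![[], L₀₁, L₀₂, L₀₃], ![[], [], L₁₂, L₁₃],
            ![[], [], [], L₂₃], ![[], [], [], []]] : Fin 4 → Fin 4 → List V) i j →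
            (v = a ∨ v = b ∨ v = c ∨ v = d) ∨
              v ∈ L₀₁ ∨ v ∈ L₀₂ ∨ v ∈ L₀₃ ∨ v ∈ L₁₂ ∨ v ∈ L₁₃ ∨ v ∈ L₂₃ from H i j hij h
        rw [six]
        simp
        tauto
  · intro u hu v hv e
    rcases hE u hu v hv e with h | h | h | h | h | h
    · exact ⟨0, 1, by decide, h⟩
    · exact ⟨0, 2, by decide, h⟩
    · exact ⟨0, 3, by decide, h⟩
    · exact ⟨1, 2, by decide, h⟩
    · exact ⟨1, 3, by decide, h⟩
    · exact ⟨2, 3, by decide, h⟩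

theorem claw_adj {d : V} {La Lb Lc : List V} {a b c u v : V} (h : Claw G d La Lb Lc a b c)
    (hu : u ∈ d :: (La ++ (Lb ++ Lc))) (hv : v ∈ d :: (La ++ (Lb ++ Lc))) (e : G.Adj u v) :
    Cons (d :: La) u v ∨ Cons (d :: Lb) u v ∨ Cons (d :: Lc) u v := by
  obtain ⟨h1, h2, h3, n1, n2, n3, -⟩ := h
  have : (u ∈ d :: La ∧ v ∈ d :: La) ∨ (u ∈ d :: Lb ∧ v ∈ d :: Lb) ∨
      (u ∈ d :: Lc ∧ v ∈ d :: Lc) := by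
    have m1 := fun h h' => (n1 u h v h').2 e
    have m2 := fun h h' => (n2 u h v h').2 e
    have m3 := fun h h' => (n3 u h v h').2 e
    have m4 := fun h h' => (n1 v h u h').2 e.symm
    have m5 := fun h h' => (n2 v h u h').2 e.symm
    have m6 := fun h h' => (n3 v h u h').2 e.symm
    simp only [List.mem_cons, List.mem_append] at hu hv ⊢
    grind
  rcases this with ⟨h, h'⟩ | ⟨h, h'⟩ | ⟨h, h'⟩
  · exact Or.inl (h1.cons_of_adj h h' e)
  · exact Or.inr (Or.inl (h2.cons_of_adj h h' e))
  · exact Or.inr (Or.inr (h3.cons_of_adj h h' e))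

theorem leg_chain {d a a' : V} {L : List V} (h : IndPath G (d :: L))
    (hl : (d :: L).getLast? = some a') (e : G.Adj a a') :
    (a :: L.reverse ++ [d]).IsChain G.Adj := by
  have : a :: L.reverse ++ [d] = (d :: L ++ [a]).reverse := by simp
  rw [this, List.isChain_reverse]
  have h1 : (d :: L ++ [a]).IsChain G.Adj := by
    rw [List.isChain_append]
    refine ⟨h.isChain, by simp, ?_⟩
    intro x hx y hy
    rw [hl] at hx
    simp at hx hy
    subst hx hy
    exact e.symm
  exact h1.imp fun _ _ h => h.symm

theorem leg_cons {d a a' : V} {L : List V} (hl : (d :: L).getLast? = some a') :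
    Cons (a :: L.reverse ++ [d]) a a' := by
  left
  have h2 : ∃ M, d :: L = M ++ [a'] := by
    refine ⟨(d :: L).dropLast, ?_⟩
    rw [List.getLast?_eq_some_getLast (by simp)] at hl
    simp only [Option.some.injEq] at hl
    rw [← hl, List.dropLast_append_getLast]
  obtain ⟨M, hM⟩ := h2
  have : a :: L.reverse ++ [d] = a :: (d :: L).reverse := by simp
  rw [this, hM]
  exact ⟨[], M.reverse, by simp⟩

/-- The branch vertices are a, b, c and the centre d of a claw in `D` joining a', b', c'. The three
arcs of the hole and the three legs, extended by the links, are the six paths; `hedge` excludes any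
further edge. Here a, b, c occur in this order along the hole. -/
theorem no_three_links_aux (hT : TriFree G) (hI : ISK4Free G) {a b c a' b' c' : V}
    {L₁ L₂ L₃ : List V} {D : Set V}
    (hC : HoleL G (a :: L₁ ++ b :: (L₂ ++ c :: L₃))) (hD : Conn G D)
    (hdis : ∀ v ∈ a :: L₁ ++ b :: (L₂ ++ c :: L₃), v ∉ D)
    (ha' : a' ∈ D) (hb' : b' ∈ D) (hc' : c' ∈ D)
    (ea : G.Adj a a') (eb : G.Adj b b') (ec : G.Adj c c')
    (hedge : ∀ u ∈ a :: L₁ ++ b :: (L₂ ++ c :: L₃), ∀ v ∈ D, G.Adj u v →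
      (u = a ∧ v = a') ∨ (u = b ∧ v = b') ∨ (u = c ∧ v = c')) : False := by
  obtain ⟨d, La, Lb, Lc, hcl, hdD, hLa, hLb, hLc⟩ := exists_claw hT hD ha' hb' hc'
  have hnd := hC.nodup
  have hD' : ∀ v ∈ d :: (La ++ (Lb ++ Lc)), v ∈ D := by
    intro v hv
    simp only [List.mem_cons, List.mem_append] at hv
    rcases hv with rfl | hv | hv | hv
    exacts [hdD, hLa v hv, hLb v hv, hLc v hv]
  have hcyc : ((a :: L₁ ++ b :: (L₂ ++ c :: L₃)) ++ [a]).IsChain G.Adj := by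
    obtain ⟨x, y, m, z, e, hm, h1, h2, h3, h4⟩ := hC
    obtain rfl := (List.cons.inj e).1
    rw [e]
    have : a :: y :: (m ++ [z]) ++ [a] = (a :: y :: m) ++ z :: [a] := by simp
    rw [this, List.isChain_split]
    refine ⟨?_, by simpa using h3⟩
    have : (a :: y :: m ++ [z]) = a :: y :: (m ++ [z]) := by simp
    rw [this, List.isChain_cons_cons]
    exact ⟨h2, h1.isChain⟩
  have e0 : (a :: L₁ ++ b :: (L₂ ++ c :: L₃)) ++ [a] = a :: L₁ ++ b :: (L₂ ++ c :: (L₃ ++ [a])) := by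
    simp
  -- The interiors for ab, ac, ad, bc, bd, cd, in this order. The third arc and the legs are
  -- reversed, since they are listed from c to a and from d outwards.
  refine hI {v | v ∈ [a, b, c, d] ++ (L₁ ++ (L₃.reverse ++ (La.reverse ++ (L₂ ++ (Lb.reverse ++ Lc.reverse)))))}
    (isSubdivision_of_six (G := G) ?_ ?_ ?_ ?_ ?_ ?_ ?_ (fun v => Iff.rfl) ?_)
  · have k1 : (a :: L₁ ++ b :: (L₂ ++ c :: L₃) ++ d :: (La ++ (Lb ++ Lc))).Nodup := by
      rw [List.nodup_append]
      refine ⟨hnd, ?_, ?_⟩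
      · obtain ⟨h1, h2, h3, n1, n2, n3, -⟩ := hcl
        have m1 := h1.nodup
        have m2 := h2.nodup
        have m3 := h3.nodup
        simp only [List.nodup_cons] at m1 m2 m3
        simp only [List.nodup_cons, List.nodup_append, List.mem_append, not_or]
        refine ⟨⟨m1.1, m2.1, m3.1⟩, m1.2, ⟨m2.2, m3.2, fun u hu v hv => (n3 u hu v hv).1⟩, ?_⟩
        rintro u hu v (hv | hv)
        · exact (n1 u hu v hv).1
        · exact (n2 u hu v hv).1
      · rintro u hu v hv rfl
        exact hdis u hu (hD' u hv)
    refine (List.Perm.nodup_iff ?_).1 k1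
    classical
    rw [List.perm_iff_count]
    intro x
    simp only [List.count_append, List.count_cons, List.count_reverse, List.count_nil]
    omega
  · rw [e0] at hcyc
    exact (List.isChain_split.1 hcyc).1
  · have : a :: L₃.reverse ++ [c] = (c :: (L₃ ++ [a])).reverse := by simp
    rw [this, List.isChain_reverse]
    rw [e0] at hcyc
    have := ((List.isChain_cons_split.1 (List.isChain_split.1 hcyc).2)).2
    exact this.imp fun _ _ h => h.symm
  · exact leg_chain hcl.1 hcl.2.2.2.2.2.2.1 ea
  · rw [e0] at hcyc
    exact (List.isChain_cons_split.1 (List.isChain_split.1 hcyc).2).1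
  · exact leg_chain hcl.2.1 hcl.2.2.2.2.2.2.2.1 eb
  · exact leg_chain hcl.2.2.1 hcl.2.2.2.2.2.2.2.2 ec
  · have hmem : ∀ w, w ∈ [a, b, c, d] ++ (L₁ ++ (L₃.reverse ++ (La.reverse ++ (L₂ ++ (Lb.reverse ++ Lc.reverse))))) →
        w ∈ a :: L₁ ++ b :: (L₂ ++ c :: L₃) ∨ w ∈ d :: (La ++ (Lb ++ Lc)) := by
      intro w; simp; tauto
    have hcross : ∀ u v, u ∈ a :: L₁ ++ b :: (L₂ ++ c :: L₃) → v ∈ d :: (La ++ (Lb ++ Lc)) → G.Adj u v →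
        Cons (a :: La.reverse ++ [d]) u v ∨ Cons (b :: Lb.reverse ++ [d]) u v ∨
          Cons (c :: Lc.reverse ++ [d]) u v := by
      intro u v hu hv e
      rcases hedge u hu v (hD' v hv) e with ⟨rfl, rfl⟩ | ⟨rfl, rfl⟩ | ⟨rfl, rfl⟩
      · exact Or.inl (leg_cons hcl.2.2.2.2.2.2.1)
      · exact Or.inr (Or.inl (leg_cons hcl.2.2.2.2.2.2.2.1))
      · exact Or.inr (Or.inr (leg_cons hcl.2.2.2.2.2.2.2.2))
    intro u hu v hv e
    rcases hmem u hu with hu | hu <;> rcases hmem v hv with hv | hv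
    · have : Cons (a :: L₁ ++ b :: (L₂ ++ c :: L₃) ++ [a]) u v :=
        HoleL.cons_of_adj (a := a) (l := L₁ ++ b :: (L₂ ++ c :: L₃)) hC hu hv e
      rw [e0] at this
      rcases cons_append_cons (X := a :: L₁) this with h | h
      · exact Or.inl h
      rcases cons_append_cons (X := b :: L₂) h with h | h
      · exact Or.inr (Or.inr (Or.inr (Or.inl h)))
      · right; left
        have := h.reverse
        simpa using this
    · have := hcross u v hu hv e; tauto
    · have := hcross v u hv hu e.symm
      rcases this with h | h | h
      · have := h.symm; tauto
      · have := h.symm; tauto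
      · have := h.symm; tauto
    · have key : ∀ (x : V) (L : List V), Cons (d :: L) u v → Cons (x :: L.reverse ++ [d]) u v := by
        intro x L h
        have := h.reverse
        exact this.mono ⟨[x], [], by simp⟩
      rcases claw_adj hcl hu hv e with h | h | h
      · have := key a _ h; tauto
      · have := key b _ h; tauto
      · have := key c _ h; tauto

/-- In a triangle-free graph without induced subdivision of `K₄`, a connected set of vertices
is not joined to a hole by exactly three edges with distinct ends in the hole. -/
theorem no_three_links (hT : TriFree G) (hI : ISK4Free G) {C : List V} {D : Set V}
    (hC : HoleL G C) (hD : Conn G D) (hdis : ∀ v ∈ C, v ∉ D) {a b c a' b' c' : V}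
    (ha : a ∈ C) (hb : b ∈ C) (hc : c ∈ C) (ha' : a' ∈ D) (hb' : b' ∈ D) (hc' : c' ∈ D)
    (hab : a ≠ b) (hac : a ≠ c) (hbc : b ≠ c)
    (ea : G.Adj a a') (eb : G.Adj b b') (ec : G.Adj c c')
    (hedge : ∀ u ∈ C, ∀ v ∈ D, G.Adj u v →
      (u = a ∧ v = a') ∨ (u = b ∧ v = b') ∨ (u = c ∧ v = c')) : False := by
  obtain ⟨s, t, rfl⟩ := List.append_of_mem ha
  have hr : (s ++ a :: t) ~r (a :: (t ++ s)) := by simpa using List.isRotated_append (l := s) (l' := a :: t)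
  have hC' := hC.rotated hr
  have hm : ∀ v, v ∈ a :: (t ++ s) ↔ v ∈ s ++ a :: t := fun v => hr.mem_iff.symm
  have hb1 : b ∈ t ++ s := by have := (hm b).2 hb; simpa [hab.symm] using this
  have hc1 : c ∈ t ++ s := by have := (hm c).2 hc; simpa [hac.symm] using this
  generalize t ++ s = C' at *
  obtain ⟨p, q, rfl⟩ := List.append_of_mem hb1
  rcases List.mem_append.1 hc1 with h | h
  · obtain ⟨p, r, rfl⟩ := List.append_of_mem h
    have e : a :: (p ++ c :: r ++ b :: q) = a :: p ++ c :: (r ++ b :: q) := by simp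
    rw [e] at hC' hm
    refine no_three_links_aux hT hI hC' hD (fun v hv => hdis v ((hm v).1 hv)) ha' hc' hb' ea ec eb ?_
    intro u hu v hv e
    have := hedge u ((hm u).1 hu) v hv e
    tauto
  · simp only [List.mem_cons, hbc.symm, false_or] at h
    obtain ⟨q, r, rfl⟩ := List.append_of_mem h
    have e : a :: (p ++ b :: (q ++ c :: r)) = a :: p ++ b :: (q ++ c :: r) := by simp
    rw [e] at hC' hm
    refine no_three_links_aux hT hI hC' hD (fun v hv => hdis v ((hm v).1 hv)) ha' hb' hc' ea eb ec ?_
    intro u hu v hv e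
    exact hedge u ((hm u).1 hu) v hv e

/-! ### Minimal pairs of a cycle and a connected set with three attachments -/

theorem adj_of_chain_concat {l : List V} {u : V} (hl : l ≠ []) (h : (l ++ [u]).IsChain G.Adj) :
    ∃ w ∈ l, G.Adj u w := by
  obtain ⟨B, c, rfl⟩ : ∃ B' c, l = B' ++ [c] := ⟨_, _, (List.dropLast_append_getLast hl).symm⟩
  have : (B ++ c :: [u]).IsChain G.Adj := by simpa using h
  have := (List.isChain_split.1 this).2
  exact ⟨c, by simp, by simpa using (List.isChain_pair.1 this).symm⟩

theorem adj_of_chain_cons {l : List V} {u : V} (hl : l ≠ []) (h : (u :: l).IsChain G.Adj) :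
    ∃ w ∈ l, G.Adj u w := by
  obtain ⟨c, B, rfl⟩ := List.exists_cons_of_ne_nil hl
  exact ⟨c, by simp, (List.isChain_cons_cons.1 h).1⟩

theorem chain_reverse {l : List V} (h : l.IsChain G.Adj) : l.reverse.IsChain G.Adj :=
  List.isChain_reverse.2 (h.imp fun _ _ h => h.symm)

/-- `l` lists the vertices of a (not necessarily induced) cycle of `G`, in cyclic order. -/
def CycL (G : SimpleGraph V) (l : List V) : Prop :=
  ∃ a m, l = a :: m ∧ 2 ≤ m.length ∧ (a :: m).Nodup ∧ (a :: m ++ [a]).IsChain G.Adj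

theorem cycL_glue {y y' : V} {A B : List V} (hAB : A ≠ [] ∨ B ≠ []) :
    CycL G (y :: A ++ y' :: B) ↔ (y :: A ++ y' :: B).Nodup ∧
      (y :: A ++ [y']).IsChain G.Adj ∧ (y' :: B ++ [y]).IsChain G.Adj := by
  have e : y :: A ++ y' :: B ++ [y] = y :: A ++ y' :: (B ++ [y]) := by simp
  constructor
  · rintro ⟨a, m, h, h1, h2, h3⟩
    obtain ⟨rfl, rfl⟩ := List.cons.inj h
    refine ⟨h2, ?_⟩
    have h3 : (y :: A ++ y' :: (B ++ [y])).IsChain G.Adj := by rw [← e]; exact h3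
    exact List.isChain_split.1 h3
  · rintro ⟨h1, h2⟩
    refine ⟨y, A ++ y' :: B, rfl, ?_, h1, ?_⟩
    · rcases hAB with h | h <;> have := List.length_pos_iff.2 h <;> simp <;> omega
    · have : (y :: A ++ y' :: (B ++ [y])).IsChain G.Adj := List.isChain_split.2 h2
      rw [← e] at this; exact this

theorem CycL.rotated {l l' : List V} (h : CycL G l) (hr : l ~r l') : CycL G l' := by
  obtain ⟨n, rfl⟩ := hr
  induction n generalizing l with
  | zero => simpa using h
  | succ n ih =>
    obtain ⟨a, m, rfl, h1, h2, h3⟩ := h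
    rw [List.rotate_cons_succ]
    apply ih
    obtain ⟨b, m, rfl⟩ := List.exists_cons_of_ne_nil (l := m) (by rintro rfl; simp at h1)
    refine ⟨b, m ++ [a], by simp, by simpa using h1, ?_, ?_⟩
    · have : (a :: b :: m) ~r (b :: (m ++ [a])) := ⟨1, by simp⟩
      exact this.nodup_iff.1 h2
    · have h3' : (a :: b :: (m ++ [a])).IsChain G.Adj := by simpa using h3
      rw [List.isChain_cons_cons] at h3'
      have : b :: (m ++ [a]) ++ [b] = (b :: m) ++ a :: [b] := by simp
      rw [this, List.isChain_split]
      exact ⟨by simpa using h3'.2, by simpa using h3'.1⟩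

theorem CycL.reverse {l : List V} (h : CycL G l) : CycL G l.reverse := by
  obtain ⟨a, m, rfl, h1, h2, h3⟩ := h
  have : CycL G (a :: m.reverse) := by
    refine ⟨a, m.reverse, rfl, by simpa using h1, by simpa using h2, ?_⟩
    have := chain_reverse h3
    simpa using this
  exact this.rotated ⟨1, by simp⟩

theorem CycL.nodup {l : List V} (h : CycL G l) : l.Nodup := by
  obtain ⟨a, m, rfl, h1, h2, h3⟩ := h; exact h2

theorem exists_chord_of_not_indPath {m : List V} (h : m.IsChain G.Adj) (hn : m.Nodup)
    (hi : ¬ IndPath G m) : ∃ s u A v t, m = s ++ u :: (A ++ v :: t) ∧ A ≠ [] ∧ G.Adj u v := by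
  induction m with
  | nil => simp at hi
  | cons a m ih =>
    cases m with
    | nil => simp at hi
    | cons b m =>
      rw [List.isChain_cons_cons] at h
      by_cases h2 : IndPath G (b :: m)
      · have : ¬ NE G [a] m := fun h3 => hi ⟨h.1, h3, h2⟩
        simp only [NE, List.mem_singleton, forall_eq, not_forall] at this
        obtain ⟨v, hv, h3⟩ := this
        have hav : a ≠ v := by
          rintro rfl
          simp [hv] at hn
        have h3 : G.Adj a v := by tauto
        obtain ⟨s, t, rfl⟩ := List.append_of_mem hv
        exact ⟨[], a, b :: s, v, t, by simp, by simp, h3⟩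
      · obtain ⟨s, u, A, v, t, e, h3, h4⟩ := ih h.2 (List.nodup_cons.1 hn).2 h2
        exact ⟨a :: s, u, A, v, t, by rw [e]; simp, h3, h4⟩

theorem CycL.hole_or_chord (hT : TriFree G) {l : List V} (h : CycL G l) :
    HoleL G l ∨ ∃ u A v B, l ~r (u :: A ++ v :: B) ∧ A ≠ [] ∧ B ≠ [] ∧ G.Adj u v := by
  obtain ⟨a, m, rfl, h1, h2, h3⟩ := h
  by_cases hm : IndPath G m
  · obtain ⟨b, m, rfl⟩ := List.exists_cons_of_ne_nil (l := m) (by rintro rfl; simp at h1)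
    have hm0 : m ≠ [] := by rintro rfl; simp at h1
    obtain ⟨B, c, rfl⟩ : ∃ B' c, m = B' ++ [c] := ⟨_, _, (List.dropLast_append_getLast hm0).symm⟩
    have hab : G.Adj a b := by
      have : (a :: b :: ((B ++ [c]) ++ [a])).IsChain G.Adj := h3
      exact (List.isChain_cons_cons.1 this).1
    have hca : G.Adj c a := by
      have : ((a :: b :: B) ++ c :: [a]).IsChain G.Adj := by simpa using h3
      simpa using (List.isChain_split.1 this).2
    by_cases hB : B = []
    · subst hB
      exact absurd hca.symm (hT _ _ _ hab (by simpa using hm))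
    by_cases hne : NE G [a] B
    · left; exact ⟨a, b, B, c, rfl, hB, hm, hab, hca, hne⟩
    · right
      simp only [NE, List.mem_singleton, forall_eq, not_forall] at hne
      obtain ⟨v, hv, h4⟩ := hne
      have hav : a ≠ v := by
        rintro rfl
        simp [hv] at h2
      have h4 : G.Adj a v := by tauto
      obtain ⟨s, t, rfl⟩ := List.append_of_mem hv
      exact ⟨a, b :: s, v, t ++ [c], by simpa using List.IsRotated.refl _, by simp, by simp, h4⟩
  · right
    obtain ⟨s, u, A, v, t, rfl, h4, h5⟩ := exists_chord_of_not_indPath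
      (h3.infix ⟨[a], [a], by simp⟩) (List.nodup_cons.1 h2).2 hm
    refine ⟨u, A, v, t ++ (a :: s), ?_, h4, by simp, h5⟩
    have := List.isRotated_append (l := a :: s) (l' := u :: (A ++ v :: t))
    simpa using this

/-- Up to rotation and reversal three points of a cyclic list have only one order. -/
theorem exists_order_three {l : List V} {a b c : V} (ha : a ∈ l) (hb : b ∈ l) (hc : c ∈ l)
    (hab : a ≠ b) (hac : a ≠ c) (hbc : b ≠ c) :
    ∃ X Y Z, l ~r (a :: X ++ b :: (Y ++ c :: Z)) ∨ l.reverse ~r (a :: X ++ b :: (Y ++ c :: Z)) := by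
  obtain ⟨s, t, rfl⟩ := List.append_of_mem ha
  have hr : (s ++ a :: t) ~r (a :: (t ++ s)) := by
    simpa using List.isRotated_append (l := s) (l' := a :: t)
  have hm : ∀ v, v ∈ a :: (t ++ s) ↔ v ∈ s ++ a :: t := fun v => hr.mem_iff.symm
  have hb1 : b ∈ t ++ s := by have := (hm b).2 hb; simpa [hab.symm] using this
  have hc1 : c ∈ t ++ s := by have := (hm c).2 hc; simpa [hac.symm] using this
  generalize t ++ s = C' at *
  obtain ⟨p, q, rfl⟩ := List.append_of_mem hb1
  rcases List.mem_append.1 hc1 with h | h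
  · obtain ⟨p, r, rfl⟩ := List.append_of_mem h
    refine ⟨q.reverse, r.reverse, p.reverse, Or.inr ?_⟩
    refine hr.reverse.trans ?_
    have := List.isRotated_append (l := q.reverse ++ b :: (r.reverse ++ c :: p.reverse)) (l' := [a])
    simpa using this
  · simp only [List.mem_cons, hbc.symm, false_or] at h
    obtain ⟨q, r, rfl⟩ := List.append_of_mem h
    exact ⟨p, q, r, Or.inl (by simpa using hr)⟩

/-- The vertex `a` has a neighbour in `D`. -/
def Att (G : SimpleGraph V) (D : Set V) (a : V) : Prop := ∃ v ∈ D, G.Adj a v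

/-- `C` is a cycle and `D` is a connected set disjoint from `C` that has at least three
neighbours in `C`. -/
def NSP (G : SimpleGraph V) (C : List V) (D : Set V) : Prop :=
  CycL G C ∧ Conn G D ∧ (∀ v ∈ C, v ∉ D) ∧
    ∃ a ∈ C, ∃ b ∈ C, ∃ c ∈ C, a ≠ b ∧ a ≠ c ∧ b ≠ c ∧ Att G D a ∧ Att G D b ∧ Att G D c

/-- A pair as in `NSP` with minimal union, and then with `D` smallest. -/
def MinNSP (G : SimpleGraph V) (C : List V) (D : Set V) : Prop :=
  NSP G C D ∧ ∀ C' D', NSP G C' D' → (∀ v, v ∈ C' ∨ v ∈ D' → v ∈ C ∨ v ∈ D) →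
    (∀ v, v ∈ C ∨ v ∈ D → v ∈ C' ∨ v ∈ D') ∧ D.ncard ≤ D'.ncard

theorem NSP.exists_min [Finite V] {C : List V} {D : Set V} (h : NSP G C D) :
    ∃ C D, MinNSP G C D := by
  classical
  let N := Nat.card V + 1
  -- One number encodes the lexicographic order on (|C ∪ D|, |D|), because `N` exceeds the size of
  -- every vertex set.
  let f : List V → Set V → ℕ := fun C D => ({v | v ∈ C} ∪ D).ncard * N + D.ncard
  have hQ : ∃ n, ∃ C D, NSP G C D ∧ f C D = n := ⟨_, C, D, h, rfl⟩
  obtain ⟨C, D, h1, h2⟩ := Nat.find_spec hQ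
  refine ⟨C, D, h1, ?_⟩
  intro C' D' h3 h4
  have h5 : f C D ≤ f C' D' := by rw [h2]; exact Nat.find_min' hQ ⟨C', D', h3, rfl⟩
  have hsub : ({v | v ∈ C'} ∪ D' : Set V) ⊆ {v | v ∈ C} ∪ D := h4
  have hD : D'.ncard < N := Nat.lt_succ_of_le (Set.ncard_le_card D')
  have heq : ({v | v ∈ C'} ∪ D' : Set V) = {v | v ∈ C} ∪ D := by
    by_contra hne
    have : ({v | v ∈ C'} ∪ D' : Set V).ncard < ({v | v ∈ C} ∪ D).ncard :=
      Set.ncard_lt_ncard (hsub.ssubset_of_ne hne)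
    have := Nat.mul_le_mul_right N (Nat.succ_le_of_lt this)
    simp only [f] at h5
    rw [Nat.succ_mul] at this
    omega
  refine ⟨fun v hv => ?_, ?_⟩
  · have : v ∈ ({v | v ∈ C'} ∪ D' : Set V) := by rw [heq]; exact hv
    exact this
  · simp only [f] at h5
    rw [heq] at h5
    omega

theorem MinNSP.of_perm {C C' : List V} {D : Set V} (h : MinNSP G C D)
    (hc : CycL G C') (hm : ∀ v, v ∈ C ↔ v ∈ C') : MinNSP G C' D := by
  obtain ⟨⟨h1, h2, h3, a, ha, b, hb, c, hc', h4⟩, h5⟩ := h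
  refine ⟨⟨hc, h2, fun v hv => h3 v ((hm v).2 hv), a, (hm a).1 ha, b, (hm b).1 hb, c,
    (hm c).1 hc', h4⟩, ?_⟩
  intro C'' D'' h6 h7
  have := h5 C'' D'' h6 (fun v hv => by rw [hm]; exact h7 v hv)
  exact ⟨fun v hv => this.1 v (by rw [hm]; exact hv), this.2⟩

theorem MinNSP.rotated {C C' : List V} {D : Set V} (h : MinNSP G C D)
    (hc : C ~r C' ∨ C.reverse ~r C') : MinNSP G C' D := by
  rcases hc with hc | hc
  · exact h.of_perm (h.1.1.rotated hc) (fun v => hc.mem_iff)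
  · exact h.of_perm (h.1.1.reverse.rotated hc) (fun v => by rw [← hc.mem_iff, List.mem_reverse])

/-- The usual way of using minimality: a rearranged pair inside C ∪ D must not lose a vertex. -/
theorem MinNSP.false_of_missing {C C' : List V} {D D' : Set V} (h : MinNSP G C D)
    (h' : NSP G C' D') (hs : ∀ v, v ∈ C' ∨ v ∈ D' → v ∈ C ∨ v ∈ D) {w : V} (hw : w ∈ C ∨ w ∈ D)
    (h1 : w ∉ C') (h2 : w ∉ D') : False :=
  ((h.2 C' D' h' hs).1 w hw).elim h1 h2

/-- Close the arc u A v by the chord, and move the part of B from β up to u into `D`. Then u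
replaces β as an attachment, and the vertices of B between v and β are lost, so there are none. By
symmetry B is just β, and u, v, β is a triangle. -/
theorem chord_false_aux {D : Set V} {u v α γ β : V} {A B : List V} (hT : TriFree G)
    (h : MinNSP G (u :: A ++ v :: B) D) (e : G.Adj u v) (hα : α ∈ A) (hγ : γ ∈ A) (hβ : β ∈ B)
    (hαγ : α ≠ γ) (aα : Att G D α) (aγ : Att G D γ) (aβ : Att G D β) : False := by
  have hA : A ≠ [] := List.ne_nil_of_mem hα
  obtain ⟨hn, c1, c2⟩ := (cycL_glue (Or.inl hA)).1 h.1.1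
  obtain ⟨T₁, T₂, rfl⟩ := List.append_of_mem hβ
  have hC' : CycL G (u :: A ++ [v]) := by
    refine (cycL_glue (B := []) (Or.inl hA)).2 ⟨?_, c1, by simpa using e.symm⟩
    exact hn.sublist (by simp)
  obtain ⟨w, hw, hw'⟩ := aβ
  have hdis := h.1.2.2.1
  have hT₁ : T₁ = [] := by
    by_contra hne
    obtain ⟨z, hz⟩ := List.exists_mem_of_ne_nil _ hne
    refine h.false_of_missing (C' := u :: A ++ [v]) (D' := D ∪ {x | x ∈ β :: T₂}) (w := z)
      ⟨hC', h.1.2.1.union (conn_of_isChain ?_) hw (b := β) (by simp) (Or.inr hw'.symm), ?_,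
        α, by simp [hα], γ, by simp [hγ], u, by simp, hαγ, ?_, ?_, ?_, ?_, ?_⟩ ?_ ?_ ?_ ?_
    · exact c2.infix ⟨v :: T₁, [u], by simp⟩
    · rintro x hx (hx' | hx')
      · exact hdis x (by simp at hx ⊢; tauto) hx'
      · simp at hn hx hx'; grind
    · rintro rfl; simp at hn; grind
    · rintro rfl; simp at hn; grind
    · obtain ⟨p, hp, hp'⟩ := aα; exact ⟨p, Or.inl hp, hp'⟩
    · obtain ⟨p, hp, hp'⟩ := aγ; exact ⟨p, Or.inl hp, hp'⟩
    · obtain ⟨p, hp, hp'⟩ := adj_of_chain_concat (l := β :: T₂) (u := u) (by simp)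
        (c2.infix ⟨v :: T₁, [], by simp⟩)
      exact ⟨p, Or.inr hp, hp'⟩
    · rintro x (hx | hx | hx)
      · left; simp at hx ⊢; tauto
      · exact Or.inr hx
      · left; simp at hx ⊢; tauto
    · left; simp [hz]
    · simp at hn ⊢; grind
    · rintro (hx | hx)
      · exact hdis z (by simp [hz]) hx
      · simp at hn hx; grind
  have hT₂ : T₂ = [] := by
    by_contra hne
    obtain ⟨z, hz⟩ := List.exists_mem_of_ne_nil _ hne
    refine h.false_of_missing (C' := u :: A ++ [v]) (D' := D ∪ {x | x ∈ T₁ ++ [β]}) (w := z)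
      ⟨hC', h.1.2.1.union (conn_of_isChain ?_) hw (b := β) (by simp) (Or.inr hw'.symm), ?_,
        α, by simp [hα], γ, by simp [hγ], v, by simp, hαγ, ?_, ?_, ?_, ?_, ?_⟩ ?_ ?_ ?_ ?_
    · exact c2.infix ⟨[v], T₂ ++ [u], by simp⟩
    · rintro x hx (hx' | hx')
      · exact hdis x (by simp at hx ⊢; tauto) hx'
      · simp at hn hx hx'; grind
    · rintro rfl; simp at hn; grind
    · rintro rfl; simp at hn; grind
    · obtain ⟨p, hp, hp'⟩ := aα; exact ⟨p, Or.inl hp, hp'⟩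
    · obtain ⟨p, hp, hp'⟩ := aγ; exact ⟨p, Or.inl hp, hp'⟩
    · obtain ⟨p, hp, hp'⟩ := adj_of_chain_cons (l := T₁ ++ [β]) (u := v) (by simp)
        (c2.infix ⟨[], T₂ ++ [u], by simp⟩)
      exact ⟨p, Or.inr hp, hp'⟩
    · rintro x (hx | hx | hx)
      · left; simp at hx ⊢; tauto
      · exact Or.inr hx
      · left; simp at hx ⊢; tauto
    · left; simp [hz]
    · simp at hn ⊢; grind
    · rintro (hx | hx)
      · exact hdis z (by simp [hz]) hx
      · simp at hn hx; grind
  subst hT₁ hT₂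
  simp at c2
  exact hT _ _ _ e c2.1 c2.2.symm

/-- Shortening by the chord as before forces α and β to be the neighbours of u on the cycle. Then u
alone is attached at α, β and v to a cycle that passes through `D`. The minimality of |D| makes `D`
a single vertex, and it forms a triangle with u and α. -/
theorem chord_false_aux' {D : Set V} {u v α β : V} {A B : List V} (hT : TriFree G)
    (hfin : D.Finite)
    (h : MinNSP G (u :: A ++ v :: B) D) (e : G.Adj u v) (hα : α ∈ A) (hβ : β ∈ B)
    (aα : Att G D α) (au : Att G D u) (aβ : Att G D β) : False := by
  have hA : A ≠ [] := List.ne_nil_of_mem hα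
  have hB : B ≠ [] := List.ne_nil_of_mem hβ
  obtain ⟨hn, c1, c2⟩ := (cycL_glue (Or.inl hA)).1 h.1.1
  obtain ⟨T₁, T₂, rfl⟩ := List.append_of_mem hβ
  obtain ⟨R₁, R₂, rfl⟩ := List.append_of_mem hα
  have hdis := h.1.2.2.1
  have hT₂ : T₂ = [] := by
    by_contra hne
    obtain ⟨z, hz⟩ := List.exists_mem_of_ne_nil _ hne
    obtain ⟨w, hw, hw'⟩ := aβ
    refine h.false_of_missing (C' := u :: (R₁ ++ α :: R₂) ++ [v]) (D' := D ∪ {x | x ∈ T₁ ++ [β]})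
      (w := z) ⟨?_, h.1.2.1.union (conn_of_isChain ?_) hw (b := β) (by simp) (Or.inr hw'.symm), ?_,
        α, by simp, u, by simp, v, by simp, ?_, ?_, ?_, ?_, ?_, ?_⟩ ?_ ?_ ?_ ?_
    · refine (cycL_glue (B := []) (Or.inl hA)).2 ⟨?_, c1, by simpa using e.symm⟩
      exact hn.sublist (by simp)
    · exact c2.infix ⟨[v], T₂ ++ [u], by simp⟩
    · rintro x hx (hx' | hx')
      · exact hdis x (by simp at hx ⊢; tauto) hx'
      · simp at hn hx hx'; grind
    · rintro rfl; simp at hn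
    · rintro rfl; simp at hn; grind
    · exact e.ne
    · obtain ⟨p, hp, hp'⟩ := aα; exact ⟨p, Or.inl hp, hp'⟩
    · obtain ⟨p, hp, hp'⟩ := au; exact ⟨p, Or.inl hp, hp'⟩
    · obtain ⟨p, hp, hp'⟩ := adj_of_chain_cons (l := T₁ ++ [β]) (u := v) (by simp)
        (c2.infix ⟨[], T₂ ++ [u], by simp⟩)
      exact ⟨p, Or.inr hp, hp'⟩
    · rintro x (hx | hx | hx)
      · left; simp at hx ⊢; tauto
      · exact Or.inr hx
      · left; simp at hx ⊢; tauto
    · left; simp [hz]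
    · simp at hn ⊢; grind
    · rintro (hx | hx)
      · exact hdis z (by simp [hz]) hx
      · simp at hn hx; grind
  have hR₁ : R₁ = [] := by
    by_contra hne
    obtain ⟨z, hz⟩ := List.exists_mem_of_ne_nil _ hne
    obtain ⟨w, hw, hw'⟩ := aα
    refine h.false_of_missing (C' := v :: (T₁ ++ β :: T₂) ++ [u]) (D' := D ∪ {x | x ∈ α :: R₂})
      (w := z) ⟨?_, h.1.2.1.union (conn_of_isChain ?_) hw (b := α) (by simp) (Or.inr hw'.symm), ?_,
        β, by simp, u, by simp, v, by simp, ?_, ?_, ?_, ?_, ?_, ?_⟩ ?_ ?_ ?_ ?_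
    · refine (cycL_glue (B := []) (Or.inl hB)).2 ⟨?_, c2, by simpa using e⟩
      have := (List.isRotated_append.nodup_iff).1 hn
      exact this.sublist (by simp)
    · exact c1.infix ⟨u :: R₁, [v], by simp⟩
    · rintro x hx (hx' | hx')
      · exact hdis x (by simp at hx ⊢; tauto) hx'
      · simp at hn hx hx'; grind
    · rintro rfl; simp at hn
    · rintro rfl; simp at hn; grind
    · exact e.ne
    · obtain ⟨p, hp, hp'⟩ := aβ; exact ⟨p, Or.inl hp, hp'⟩
    · obtain ⟨p, hp, hp'⟩ := au; exact ⟨p, Or.inl hp, hp'⟩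
    · obtain ⟨p, hp, hp'⟩ := adj_of_chain_concat (l := α :: R₂) (u := v) (by simp)
        (c1.infix ⟨u :: R₁, [], by simp⟩)
      exact ⟨p, Or.inr hp, hp'⟩
    · rintro x (hx | hx | hx)
      · left; simp at hx ⊢; tauto
      · exact Or.inr hx
      · left; simp at hx ⊢; tauto
    · left; simp [hz]
    · simp at hn ⊢; grind
    · rintro (hx | hx)
      · exact hdis z (by simp [hz]) hx
      · simp at hn hx; grind
  subst hT₂ hR₁
  have euα : G.Adj u α := by simp at c1; exact c1.1
  have euβ : G.Adj u β := by
    have := c2.infix (l₁ := [β, u]) ⟨v :: T₁, [], by simp⟩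
    simpa using (List.isChain_pair.1 this).symm
  obtain ⟨pα, hpα, eα⟩ := aα
  obtain ⟨pβ, hpβ, eβ⟩ := aβ
  obtain ⟨Q, hQ, hQi, hQD, ⟨s, rfl, hs⟩, ⟨t, rfl, ht⟩, -, -⟩ :=
    exists_indPath (X := {pβ}) (Y := {pα}) hpβ rfl rfl (h.1.2.1 _ hpβ _ hpα)
  -- The cycle goes from α to β by way of v, avoiding u, and returns through a path Q of `D`.
  have hN : NSP G (α :: (R₂ ++ v :: T₁) ++ β :: Q) {u} := by
    refine ⟨(cycL_glue (Or.inr hQ)).2 ⟨?_, ?_, ?_⟩, conn_singleton, ?_, α, by simp, β, by simp,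
      v, by simp, ?_, ?_, ?_, ⟨u, rfl, euα.symm⟩, ⟨u, rfl, euβ.symm⟩, ⟨u, rfl, e.symm⟩⟩
    · have h1 : (α :: (R₂ ++ v :: T₁) ++ [β]).Nodup := by
        simp at hn ⊢; grind
      have h2 : ∀ x ∈ α :: (R₂ ++ v :: T₁) ++ [β], ∀ y ∈ Q, x ≠ y := by
        rintro x hx y hy rfl
        exact hdis x (by simp at hx ⊢; tauto) (hQD x hy)
      have := List.nodup_append.2 ⟨h1, hQi.nodup, h2⟩
      simpa using this
    · have k1 : (α :: R₂ ++ v :: (T₁ ++ [β])).IsChain G.Adj := by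
        rw [List.isChain_split]
        exact ⟨c1.infix ⟨[u], [], by simp⟩, c2.infix ⟨[], [u], by simp⟩⟩
      simpa using k1
    · rw [List.cons_append, List.isChain_cons, List.isChain_append]
      refine ⟨?_, hQi.isChain, by simp, ?_⟩
      · intro y hy
        obtain ⟨q, Q, rfl⟩ := List.exists_cons_of_ne_nil hQ
        simp at hs hy; subst hs hy; exact eβ
      · intro x hx y hy
        rw [ht] at hx
        simp at hx hy
        subst hx hy
        exact eα.symm
    · rintro x hx rfl
      simp only [List.mem_append, List.mem_cons] at hx
      rcases hx with hx | hx | hx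
      · simp at hn; grind
      · simp at hn; grind
      · exact hdis x (by simp) (hQD x hx)
    · rintro rfl; simp at hn
    · rintro rfl; simp at hn
    · rintro rfl; simp at hn; grind
  have h1 := (h.2 _ _ hN ?_).2
  · rw [Set.ncard_singleton] at h1
    obtain ⟨w, hw, ew⟩ := au
    have : t = w := (Set.ncard_le_one hfin).1 h1 _ hpα _ hw
    subst this
    exact hT _ _ _ euα eα ew
  · rintro x (hx | rfl)
    · simp only [List.mem_append, List.mem_cons] at hx
      rcases hx with hx | hx | hx
      · left; simp; tauto
      · left; simp; tauto
      · right; exact hQD x hx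
    · left; simp

/-- Each side of a chord contains an attachment, or the chord would give a smaller cycle with all
the attachments. The place of a third attachment, inside a side or at an end of the chord, decides
which of the two preceding arguments applies. -/
theorem chord_false [Finite V] {C : List V} {D : Set V} {u v : V} {A B : List V} (hT : TriFree G)
    (h : MinNSP G C D) (hr : C ~r (u :: A ++ v :: B)) (hA : A ≠ []) (hB : B ≠ [])
    (e : G.Adj u v) : False := by
  have h := h.rotated (Or.inl hr)
  have hr' : (u :: A ++ v :: B) ~r (v :: B ++ u :: A) := List.isRotated_append
  have h' := h.rotated (Or.inl hr')
  have key : ∀ {u v : V} {A B : List V}, MinNSP G (u :: A ++ v :: B) D → G.Adj u v → A ≠ [] →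
      B ≠ [] → ∃ x ∈ B, Att G D x := by
    intro u v A B h e hA hB
    by_contra hcon
    push Not at hcon
    obtain ⟨x, hx⟩ := List.exists_mem_of_ne_nil _ hB
    obtain ⟨hn, c1, c2⟩ := (cycL_glue (Or.inl hA)).1 h.1.1
    obtain ⟨h1, h2, h3, a, ha, b, hb, c, hc, hab, hac, hbc, aa, ab, ac⟩ := h.1
    have hm : ∀ z ∈ u :: A ++ v :: B, Att G D z → z ∈ u :: A ++ [v] := by
      intro z hz az
      by_contra hz'
      exact hcon z (by simp at hz hz' ⊢; tauto) az
    refine h.false_of_missing (C' := u :: A ++ [v]) (D' := D) (w := x) ⟨?_, h2, ?_, a, hm a ha aa,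
      b, hm b hb ab, c, hm c hc ac, hab, hac, hbc, aa, ab, ac⟩ ?_ ?_ ?_ ?_
    · refine (cycL_glue (B := []) (Or.inl hA)).2 ⟨?_, c1, by simpa using e.symm⟩
      exact hn.sublist (by simp)
    · intro z hz; exact h3 z (by simp at hz ⊢; tauto)
    · rintro z (hz | hz)
      · left; simp at hz ⊢; tauto
      · exact Or.inr hz
    · left; simp [hx]
    · simp at hn ⊢; grind
    · exact h3 x (by simp [hx])
  obtain ⟨β, hβ, aβ⟩ := key h e hA hB
  obtain ⟨α, hα, aα⟩ := key h' e.symm hB hA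
  obtain ⟨h1, h2, h3, a, ha, b, hb, c, hc, hab, hac, hbc, aa, ab, ac⟩ := h.1
  have hγ : ∃ γ ∈ u :: A ++ v :: B, γ ≠ α ∧ γ ≠ β ∧ Att G D γ := by
    by_cases ha' : a ≠ α ∧ a ≠ β
    · exact ⟨a, ha, ha'.1, ha'.2, aa⟩
    by_cases hb' : b ≠ α ∧ b ≠ β
    · exact ⟨b, hb, hb'.1, hb'.2, ab⟩
    refine ⟨c, hc, ?_, ?_, ac⟩ <;> rintro rfl <;> grind
  obtain ⟨γ, hγ, hγα, hγβ, aγ⟩ := hγ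
  have hγ : γ = u ∨ γ ∈ A ∨ γ = v ∨ γ ∈ B := by simp at hγ; tauto
  rcases hγ with rfl | hγ | rfl | hγ
  · exact chord_false_aux' hT D.toFinite h e hα hβ aα aγ aβ
  · exact chord_false_aux hT h e hα hγ hβ hγα.symm aα aγ aβ
  · exact chord_false_aux' hT D.toFinite h' e.symm hβ hα aβ aγ aα
  · exact chord_false_aux hT h' e.symm hβ hγ hα hγβ.symm aβ aγ aα

/-- `G` contains `K_{3,3}` (as a subgraph). -/
def HasK33 (G : SimpleGraph V) : Prop :=
  ∃ A B : Set V, 3 ≤ A.ncard ∧ 3 ≤ B.ncard ∧ ∀ a ∈ A, ∀ b ∈ B, G.Adj a b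

theorem ncard_triple {a b c : V} (hab : a ≠ b) (hac : a ≠ c) (hbc : b ≠ c) :
    ({a, b, c} : Set V).ncard = 3 := by
  classical
  rw [Set.ncard_eq_toFinset_card' ({a, b, c} : Set V)]
  simp [hab, hac, hbc]

/-- A vertex of `D` whose removal keeps `D` connected is needed for one of the attachments, since
fewer than three remain without it. -/
theorem MinNSP.leaf {C : List V} {D : Set V} (h : MinNSP G C D) {p a b c : V} (hp : p ∈ D)
    (hc : Conn G (D \ {p})) (ha : a ∈ C) (hb : b ∈ C) (hc' : c ∈ C) (hab : a ≠ b) (hac : a ≠ c)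
    (hbc : b ≠ c) (aa : Att G (D \ {p}) a) (ab : Att G (D \ {p}) b) (ac : Att G (D \ {p}) c) :
    False :=
  h.false_of_missing (C' := C) (D' := D \ {p}) (w := p)
    ⟨h.1.1, hc, fun v hv hv' => h.1.2.2.1 v hv hv'.1, a, ha, b, hb, c, hc', hab, hac, hbc, aa, ab,
      ac⟩ (fun v hv => hv.imp id fun h => h.1) (Or.inr hp) (fun h' => h.1.2.2.1 p h' hp) (by simp)

/-- In a minimal pair whose second member is a path with at least two vertices, an inner
attachment vertex has a unique neighbour on the path. -/
theorem MinNSP.unique_nbr [Finite V] {C : List V} {p₁ p₂ α β γ p p' : V} {M : List V}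
    (h : MinNSP G C {v | v ∈ p₁ :: M ++ [p₂]}) (hP : IndPath G (p₁ :: M ++ [p₂]))
    (hα : α ∈ C) (hβ : β ∈ C) (hγ : γ ∈ C) (hαβ : α ≠ β) (hαγ : α ≠ γ) (hβγ : β ≠ γ)
    (eβ : G.Adj β p₁) (eγ : G.Adj γ p₂) (hp : p ∈ p₁ :: M ++ [p₂]) (hp' : p' ∈ p₁ :: M ++ [p₂])
    (e : G.Adj α p) (e' : G.Adj α p') : p = p' := by
  by_contra hpp
  obtain ⟨X, Y, Z, hr⟩ := exists_order_three hα hβ hγ hαβ hαγ hβγ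
  have h := h.rotated hr
  clear hr hα hβ hγ
  have hn := h.1.1.nodup
  have hdis := h.1.2.2.1
  obtain ⟨-, c1, c2⟩ := (cycL_glue (by simp)).1 h.1.1
  have c3 : (β :: Y ++ [γ]).IsChain G.Adj := c2.infix ⟨[], Z ++ [α], by simp⟩
  have c4 : (γ :: (Z ++ [α])).IsChain G.Adj := c2.infix ⟨β :: Y, [], by simp⟩
  have hPd : ∀ v ∈ p₁ :: M ++ [p₂], v ∉ α :: X ++ β :: (Y ++ γ :: Z) :=
    fun v hv hv' => hdis v hv' hv
  -- The cycle through P and the arc from β to γ that avoids α. With two neighbours on P, the vertex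
  -- α is attached twice to it. The third attachment is β if α and β are adjacent, and then {α} is
  -- too small a second member. Otherwise it is γ, reached from α along Z, and the vertices of X are
  -- lost.
  have hC : CycL G (β :: Y ++ γ :: (p₁ :: M ++ [p₂]).reverse) := by
    refine (cycL_glue (by simp)).2 ⟨?_, c3, ?_⟩
    · have : β :: Y ++ γ :: (p₁ :: M ++ [p₂]).reverse =
        (β :: Y ++ [γ]) ++ (p₁ :: M ++ [p₂]).reverse := by simp
      rw [this, List.nodup_append]
      refine ⟨hn.sublist ?_, List.nodup_reverse.2 hP.nodup, ?_⟩
      · have : α :: X ++ β :: (Y ++ γ :: Z) = (α :: X) ++ (β :: Y ++ [γ]) ++ Z := by simp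
        rw [this]
        exact (List.sublist_append_right _ _).trans (List.sublist_append_left _ _)
      · rintro a ha b hb rfl
        exact hPd a (List.mem_reverse.1 hb) (by simp at ha ⊢; tauto)
    · have k := (chain_reverse hP.isChain)
      have : γ :: (p₁ :: M ++ [p₂]).reverse ++ [β] = (γ :: p₂ :: M.reverse) ++ p₁ :: [β] := by simp
      rw [this, List.isChain_split]
      refine ⟨?_, by simpa using eβ.symm⟩
      simp only [List.reverse_append, List.reverse_cons, List.reverse_nil, List.nil_append,
        List.cons_append] at k ⊢
      rw [List.isChain_cons_cons]
      exact ⟨eγ, k⟩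
  have mP : ∀ v ∈ p₁ :: M ++ [p₂], v ∈ β :: Y ++ γ :: (p₁ :: M ++ [p₂]).reverse := by
    intro v hv; simp only [List.mem_append, List.mem_cons, List.mem_reverse] at hv ⊢; tauto
  have ne : ∀ v ∈ p₁ :: M ++ [p₂], ∀ w ∈ α :: X ++ β :: (Y ++ γ :: Z), w ≠ v := by
    rintro v hv w hw rfl; exact hPd _ hv hw
  have hnn := hn
  simp only [List.cons_append, List.nodup_cons, List.mem_append, List.mem_cons, not_or,
    List.nodup_append] at hnn
  by_cases hX : X = []
  · subst hX
    have eαβ : G.Adj α β := by simpa using c1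
    have hN : NSP G (β :: Y ++ γ :: (p₁ :: M ++ [p₂]).reverse) {α} := by
      refine ⟨hC, conn_singleton, ?_, β, by simp, p, mP p hp, p', mP p' hp', ne p hp _ (by simp),
        ne p' hp' _ (by simp), hpp, ⟨α, rfl, eαβ.symm⟩, ⟨α, rfl, e.symm⟩, ⟨α, rfl, e'.symm⟩⟩
      rintro v hv rfl
      simp only [List.cons_append, List.mem_append, List.mem_cons, List.mem_reverse] at hv
      rcases hv with hv | hv | hv | hv
      · exact hαβ hv
      · exact hnn.1.2.2.1 hv
      · exact hαγ hv
      · exact hPd v (by simpa using hv) (by simp)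
    have h1 := (h.2 _ _ hN ?_).2
    · rw [Set.ncard_singleton] at h1
      have := (Set.ncard_le_one (Set.toFinite _)).1 h1 p hp p' hp'
      exact hpp this
    · rintro v (hv | rfl)
      · simp only [List.cons_append, List.mem_append, List.mem_cons, List.mem_reverse] at hv
        rcases hv with hv | hv | hv | hv
        · left; simp [hv]
        · left; simp [hv]
        · left; simp [hv]
        · right; simpa using hv
      · left; simp
  · obtain ⟨z, hz⟩ := List.exists_mem_of_ne_nil _ hX
    obtain ⟨w, hw, ew⟩ := adj_of_chain_cons (by simp) c4
    refine h.false_of_missing (C' := β :: Y ++ γ :: (p₁ :: M ++ [p₂]).reverse)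
      (D' := {v | v ∈ Z ++ [α]}) (w := z) ⟨hC, conn_of_isChain c4.tail, ?_, γ, by simp, p, mP p hp,
        p', mP p' hp', ne p hp _ (by simp), ne p' hp' _ (by simp), hpp, ⟨w, hw, ew⟩,
        ⟨α, by simp, e.symm⟩, ⟨α, by simp, e'.symm⟩⟩ ?_ ?_ ?_ ?_
    · intro v hv hv'
      simp only [List.cons_append, List.mem_append, List.mem_cons, List.mem_reverse] at hv
      have hv' : v ∈ Z ∨ v = α := by simpa using hv'
      have hvC : v ∈ α :: X ++ β :: (Y ++ γ :: Z) := by simp; tauto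
      have : v ∉ p₁ :: M ++ [p₂] := fun h' => hPd v h' hvC
      simp only [List.cons_append, List.mem_append, List.mem_cons] at this
      grind
    · rintro v (hv | hv)
      · simp only [List.cons_append, List.mem_append, List.mem_cons, List.mem_reverse] at hv
        rcases hv with hv | hv | hv | hv
        · left; simp [hv]
        · left; simp [hv]
        · left; simp [hv]
        · right; simpa using hv
      · left
        have hv : v ∈ Z ∨ v = α := by simpa using hv
        simp; tauto
    · left; simp [hz]
    · intro hv
      simp only [List.cons_append, List.mem_append, List.mem_cons, List.mem_reverse] at hv
      have : z ∉ p₁ :: M ++ [p₂] := fun h' => hPd z h' (by simp [hz])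
      simp only [List.cons_append, List.mem_append, List.mem_cons] at this
      grind
    · intro hv
      have hv : z ∈ Z ∨ z = α := by simpa using hv
      grind

/-- The cycle γ Z δ p₂ is attached to the rest of the path together with W α and β Y, all connected
through p₁; the attachments are p₂, δ and γ. Nothing of X is used, so X is empty, and α, β, p₁ is a
triangle. -/
theorem MinNSP.noncrossing {p₁ p₂ α β γ δ : V} {M X Y Z W : List V} (hT : TriFree G)
    (h : MinNSP G (α :: X ++ β :: (Y ++ γ :: (Z ++ δ :: W))) {v | v ∈ p₁ :: M ++ [p₂]})
    (hP : IndPath G (p₁ :: M ++ [p₂])) (eα : G.Adj α p₁) (eβ : G.Adj β p₁) (eγ : G.Adj γ p₂)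
    (eδ : G.Adj δ p₂) : False := by
  have hn := h.1.1.nodup
  have hdis := h.1.2.2.1
  obtain ⟨-, c1, c2⟩ := (cycL_glue (by simp)).1 h.1.1
  have hX : X = [] := by
    by_contra hne
    obtain ⟨z, hz⟩ := List.exists_mem_of_ne_nil _ hne
    have hp₂ : p₂ ∉ α :: X ++ β :: (Y ++ γ :: (Z ++ δ :: W)) := fun h' => hdis _ h' (by simp)
    have hD : Conn G ({v | v ∈ p₁ :: M} ∪ {v | v ∈ W ++ [α]} ∪ {v | v ∈ β :: Y}) := by
      refine Conn.union (Conn.union (conn_of_isChain ?_) (conn_of_isChain ?_)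
        (a := p₁) (b := α) ?_ ?_ (Or.inr eα.symm)) (conn_of_isChain ?_) (a := p₁) (b := β) ?_ ?_
        (Or.inr eβ.symm)
      · exact hP.isChain.infix ⟨[], [p₂], by simp⟩
      · exact c2.infix ⟨β :: (Y ++ γ :: (Z ++ [δ])), [], by simp⟩
      · simp
      · simp
      · exact c2.infix ⟨[], γ :: (Z ++ δ :: W) ++ [α], by simp⟩
      · simp
      · simp
    have hnP := hP.nodup
    have hmem : ∀ v, v ∈ ({v | v ∈ p₁ :: M} ∪ {v | v ∈ W ++ [α]} ∪ {v | v ∈ β :: Y} : Set V) ↔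
        (v = p₁ ∨ v ∈ M) ∨ (v ∈ W ∨ v = α) ∨ v = β ∨ v ∈ Y := by
      intro v
      simp only [Set.mem_union, Set.mem_ofPred_eq, List.mem_cons, List.mem_append,
        List.not_mem_nil, or_false]
      tauto
    have hP' : ∀ v, (v = p₁ ∨ v ∈ M ∨ v = p₂) →
        v ∉ α :: X ++ β :: (Y ++ γ :: (Z ++ δ :: W)) := by
      intro v hv h'; exact hdis v h' (by simp; tauto)
    have hn' := hn
    simp only [List.cons_append, List.nodup_cons, List.mem_append, List.mem_cons, not_or,
      List.nodup_append] at hn'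
    simp only [List.cons_append, List.nodup_cons, List.mem_append, List.mem_cons, not_or,
      List.nodup_append, List.not_mem_nil, not_false_eq_true, and_true] at hnP
    refine h.false_of_missing (C' := γ :: Z ++ δ :: [p₂])
      (D' := {v | v ∈ p₁ :: M} ∪ {v | v ∈ W ++ [α]} ∪ {v | v ∈ β :: Y}) (w := z)
      ⟨(cycL_glue (by simp)).2 ⟨?_, ?_, ?_⟩, hD, ?_, p₂, by simp, δ, by simp, γ, by simp,
        ?_, ?_, ?_, ?_, ?_, ?_⟩ ?_ ?_ ?_ ?_
    · have k1 : (γ :: Z ++ [δ] ++ [p₂]).Nodup := by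
        rw [List.nodup_append]
        refine ⟨hn.sublist ?_, by simp, ?_⟩
        · have : α :: X ++ β :: (Y ++ γ :: (Z ++ δ :: W)) =
            (α :: X ++ β :: Y) ++ (γ :: Z ++ [δ]) ++ W := by simp
          rw [this]
          exact (List.sublist_append_right _ _).trans (List.sublist_append_left _ _)
        · rintro a ha b hb rfl
          simp at hb; subst hb
          exact hp₂ (by simp at ha ⊢; tauto)
      simpa using k1
    · exact c2.infix ⟨β :: Y, W ++ [α], by simp⟩
    · simpa using ⟨eδ, eγ.symm⟩
    · intro v hv
      rw [hmem]
      have hv : v = γ ∨ v ∈ Z ∨ v = δ ∨ v = p₂ := by simpa using hv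
      rcases hv with hv | hv | hv | hv
      · have := hP' v; simp only [List.cons_append, List.mem_append, List.mem_cons] at this; grind
      · have := hP' v; simp only [List.cons_append, List.mem_append, List.mem_cons] at this; grind
      · have := hP' v; simp only [List.cons_append, List.mem_append, List.mem_cons] at this; grind
      · have := hP' v; simp only [List.cons_append, List.mem_append, List.mem_cons] at this; grind
    · rintro rfl; exact hp₂ (by simp)
    · rintro rfl; exact hp₂ (by simp)
    · grind
    · obtain ⟨w, hw, ew⟩ := adj_of_chain_concat (l := p₁ :: M) (u := p₂) (by simp) hP.isChain
      exact ⟨w, (hmem w).2 (Or.inl (by simpa using hw)), ew⟩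
    · obtain ⟨w, hw, ew⟩ := adj_of_chain_cons (l := W ++ [α]) (u := δ) (by simp)
        (c2.infix ⟨β :: (Y ++ γ :: Z), [], by simp⟩)
      exact ⟨w, (hmem w).2 (Or.inr (Or.inl (by simpa using hw))), ew⟩
    · obtain ⟨w, hw, ew⟩ := adj_of_chain_concat (l := β :: Y) (u := γ) (by simp)
        (c2.infix ⟨[], Z ++ δ :: W ++ [α], by simp⟩)
      exact ⟨w, (hmem w).2 (Or.inr (Or.inr (by simpa using hw))), ew⟩
    · rintro v (hv | hv)
      · have hv : v = γ ∨ v ∈ Z ∨ v = δ ∨ v = p₂ := by simpa using hv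
        rcases hv with hv | hv | hv | hv
        · left; simp [hv]
        · left; simp [hv]
        · left; simp [hv]
        · right; simp [hv]
      · rw [hmem] at hv
        rcases hv with (hv | hv) | (hv | hv) | hv | hv
        · right; simp [hv]
        · right; simp [hv]
        · left; simp [hv]
        · left; simp [hv]
        · left; simp [hv]
        · left; simp [hv]
    · left; simp [hz]
    · intro hv
      have hv : z = γ ∨ z ∈ Z ∨ z = δ ∨ z = p₂ := by simpa using hv
      have := hP' z; simp only [List.cons_append, List.mem_append, List.mem_cons] at this; grind
    · rw [hmem]
      have := hP' z; simp only [List.cons_append, List.mem_append, List.mem_cons] at this; grind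
  subst hX
  have eαβ : G.Adj α β := by simpa using c1
  exact hT _ _ _ eαβ eβ eα

/-- Here the neighbours of p₁ and of p₂ alternate. The cycle β Z δ W α p₁ is attached at p₁, δ and β
to the remaining path together with γ Y, and X is not used. Rotations and reversal of the path carry
the conclusion to the other arcs. -/
theorem MinNSP.crossing {p₁ p₂ α β γ δ : V} {M X Y Z W : List V}
    (h : MinNSP G (α :: X ++ γ :: (Y ++ β :: (Z ++ δ :: W))) {v | v ∈ p₁ :: M ++ [p₂]})
    (hP : IndPath G (p₁ :: M ++ [p₂])) (eα : G.Adj α p₁) (eβ : G.Adj β p₁) (eγ : G.Adj γ p₂)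
    (eδ : G.Adj δ p₂) : X = [] := by
  have hn := h.1.1.nodup
  have hdis := h.1.2.2.1
  obtain ⟨-, c1, c2⟩ := (cycL_glue (by simp)).1 h.1.1
  by_contra hne
  obtain ⟨z, hz⟩ := List.exists_mem_of_ne_nil _ hne
  have hp₁ : p₁ ∉ α :: X ++ γ :: (Y ++ β :: (Z ++ δ :: W)) := fun h' => hdis _ h' (by simp)
  have hD : Conn G ({v | v ∈ M ++ [p₂]} ∪ {v | v ∈ γ :: Y}) := by
    refine Conn.union (conn_of_isChain ?_) (conn_of_isChain ?_)
      (a := p₂) (b := γ) ?_ ?_ (Or.inr eγ.symm)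
    · exact hP.isChain.infix ⟨[p₁], [], by simp⟩
    · exact c2.infix ⟨[], β :: (Z ++ δ :: W) ++ [α], by simp⟩
    · simp
    · simp
  have hnP := hP.nodup
  have hmem : ∀ v, v ∈ ({v | v ∈ M ++ [p₂]} ∪ {v | v ∈ γ :: Y} : Set V) ↔
      (v ∈ M ∨ v = p₂) ∨ v = γ ∨ v ∈ Y := by
    intro v
    simp only [Set.mem_union, Set.mem_ofPred_eq, List.mem_cons, List.mem_append,
      List.not_mem_nil, or_false]
  have hP' : ∀ v, (v = p₁ ∨ v ∈ M ∨ v = p₂) →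
      v ∉ α :: X ++ γ :: (Y ++ β :: (Z ++ δ :: W)) := by
    intro v hv h'; exact hdis v h' (by simp; tauto)
  have hn' := hn
  simp only [List.cons_append, List.nodup_cons, List.mem_append, List.mem_cons, not_or,
    List.nodup_append] at hn'
  simp only [List.cons_append, List.nodup_cons, List.mem_append, List.mem_cons, not_or,
    List.nodup_append, List.not_mem_nil, not_false_eq_true, and_true] at hnP
  refine h.false_of_missing (C' := β :: Z ++ δ :: (W ++ α :: [p₁]))
    (D' := {v | v ∈ M ++ [p₂]} ∪ {v | v ∈ γ :: Y}) (w := z)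
    ⟨(cycL_glue (by simp)).2 ⟨?_, ?_, ?_⟩, hD, ?_, p₁, by simp, δ, by simp, β, by simp,
      ?_, ?_, ?_, ?_, ?_, ?_⟩ ?_ ?_ ?_ ?_
  · have k0 : (β :: (Z ++ δ :: W) ++ (α :: X ++ γ :: Y)).Nodup := by
      have hr : ((α :: X ++ γ :: Y) ++ β :: (Z ++ δ :: W)) ~r
        (β :: (Z ++ δ :: W) ++ (α :: X ++ γ :: Y)) := List.isRotated_append
      exact hr.nodup_iff.1 (by simpa using hn)
    have k1 : (β :: (Z ++ δ :: W) ++ [α] ++ [p₁]).Nodup := by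
      rw [List.nodup_append]
      refine ⟨k0.sublist (by simp), by simp, ?_⟩
      rintro a ha b hb rfl
      simp at hb; subst hb
      exact hp₁ (by simp at ha ⊢; tauto)
    simpa using k1
  · exact c2.infix ⟨γ :: Y, W ++ [α], by simp⟩
  · have : δ :: (W ++ α :: [p₁]) ++ [β] = (δ :: W) ++ α :: [p₁, β] := by simp
    rw [this, List.isChain_split]
    refine ⟨c2.infix ⟨γ :: (Y ++ β :: Z), [], by simp⟩, ?_⟩
    simpa using ⟨eα, eβ.symm⟩
  · intro v hv
    rw [hmem]
    have hv : v = β ∨ v ∈ Z ∨ v = δ ∨ v ∈ W ∨ v = α ∨ v = p₁ := by simpa using hv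
    have := hP' v
    simp only [List.cons_append, List.mem_append, List.mem_cons] at this
    rcases hv with hv | hv | hv | hv | hv | hv <;> grind
  · rintro rfl; exact hp₁ (by simp)
  · rintro rfl; exact hp₁ (by simp)
  · grind
  · obtain ⟨w, hw, ew⟩ := adj_of_chain_cons (l := M ++ [p₂]) (u := p₁) (by simp) hP.isChain
    exact ⟨w, (hmem w).2 (Or.inl (by simpa using hw)), ew⟩
  · exact ⟨p₂, (hmem _).2 (by simp), eδ⟩
  · obtain ⟨w, hw, ew⟩ := adj_of_chain_concat (l := γ :: Y) (u := β) (by simp)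
      (c2.infix ⟨[], Z ++ δ :: W ++ [α], by simp⟩)
    exact ⟨w, (hmem w).2 (Or.inr (by simpa using hw)), ew⟩
  · rintro v (hv | hv)
    · have hv : v = β ∨ v ∈ Z ∨ v = δ ∨ v ∈ W ∨ v = α ∨ v = p₁ := by simpa using hv
      rcases hv with hv | hv | hv | hv | hv | hv
      · left; simp [hv]
      · left; simp [hv]
      · left; simp [hv]
      · left; simp [hv]
      · left; simp [hv]
      · right; simp [hv]
    · rw [hmem] at hv
      rcases hv with (hv | hv) | hv | hv
      · right; simp [hv]
      · right; simp [hv]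
      · left; simp [hv]
      · left; simp [hv]
  · left; simp [hz]
  · intro hv
    have hv : z = β ∨ z ∈ Z ∨ z = δ ∨ z ∈ W ∨ z = α ∨ z = p₁ := by simpa using hv
    have := hP' z; simp only [List.cons_append, List.mem_append, List.mem_cons] at this; grind
  · rw [hmem]
    have := hP' z; simp only [List.cons_append, List.mem_append, List.mem_cons] at this; grind

/-- All four arcs are empty, so α γ β δ is a 4-cycle. Inner vertices of the path would be lost in
the pair of the cycle p₁ α γ β and the edge δ p₂. Hence p₁ and p₂ are adjacent, and {α, β, p₂}, {γ,
δ, p₁} are the sides of K₃,₃. -/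
theorem MinNSP.hasK33 {p₁ p₂ α β γ δ : V} {M X Y Z W : List V}
    (h : MinNSP G (α :: X ++ γ :: (Y ++ β :: (Z ++ δ :: W))) {v | v ∈ p₁ :: M ++ [p₂]})
    (hP : IndPath G (p₁ :: M ++ [p₂])) (eα : G.Adj α p₁) (eβ : G.Adj β p₁) (eγ : G.Adj γ p₂)
    (eδ : G.Adj δ p₂) : HasK33 G := by
  have hX := h.crossing hP eα eβ eγ eδ
  subst hX
  have hP' : IndPath G (p₂ :: M.reverse ++ [p₁]) := by simpa using hP.reverse
  have hset : {v | v ∈ p₁ :: M ++ [p₂]} = {v | v ∈ p₂ :: M.reverse ++ [p₁]} := by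
    ext v; simp; tauto
  have hY : Y = [] := by
    have hr : (α :: [] ++ γ :: (Y ++ β :: (Z ++ δ :: W))) ~r
        (γ :: Y ++ β :: (Z ++ δ :: (W ++ α :: []))) := by
      simpa using List.isRotated_append (l := [α]) (l' := γ :: (Y ++ β :: (Z ++ δ :: W)))
    have h' := h.rotated (Or.inl hr)
    rw [hset] at h'
    exact h'.crossing hP' eγ eδ eβ eα
  subst hY
  have hZ : Z = [] := by
    have hr : (α :: [] ++ γ :: ([] ++ β :: (Z ++ δ :: W))) ~r
        (β :: Z ++ δ :: (W ++ α :: ([] ++ γ :: []))) := by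
      simpa using List.isRotated_append (l := [α, γ]) (l' := β :: (Z ++ δ :: W))
    exact (h.rotated (Or.inl hr)).crossing hP eβ eα eδ eγ
  subst hZ
  have hW : W = [] := by
    have hr : (α :: [] ++ γ :: ([] ++ β :: ([] ++ δ :: W))) ~r
        (δ :: W ++ α :: ([] ++ γ :: ([] ++ β :: []))) := by
      simpa using List.isRotated_append (l := [α, γ, β]) (l' := δ :: W)
    have h' := h.rotated (Or.inl hr)
    rw [hset] at h'
    exact h'.crossing hP' eδ eγ eα eβ
  subst hW
  have hn := h.1.1.nodup
  have hdis := h.1.2.2.1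
  obtain ⟨-, c1, c2⟩ := (cycL_glue (by simp)).1 h.1.1
  have e1 : G.Adj α γ := by simpa using c1
  have e2 : G.Adj γ β ∧ G.Adj β δ ∧ G.Adj δ α := by simpa using c2
  obtain ⟨e2, e3, e4⟩ := e2
  simp only [List.nil_append, List.cons_append] at hn hdis h
  have hp₁ : p₁ ∉ [α, γ, β, δ] := fun h' => hdis _ h' (by simp)
  have hp₂ : p₂ ∉ [α, γ, β, δ] := fun h' => hdis _ h' (by simp)
  have hnP := hP.nodup
  have hp : p₁ ≠ p₂ := by rintro rfl; simp at hnP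
  have hn' := hn
  simp only [List.nodup_cons, List.mem_cons, not_or, List.not_mem_nil, not_false_eq_true,
    and_true, List.nodup_nil] at hn' hp₁ hp₂
  have hM : M = [] := by
    by_contra hne
    obtain ⟨z, hz⟩ := List.exists_mem_of_ne_nil _ hne
    have hz' : z ∉ [α, γ, β, δ] := fun h' => hdis _ h' (by simp [hz])
    simp only [List.mem_cons, not_or, List.not_mem_nil, not_false_eq_true, and_true] at hz'
    refine h.false_of_missing (C' := p₁ :: [α] ++ γ :: [β])
      (D' := {v | v ∈ [δ, p₂]}) (w := z)
      ⟨(cycL_glue (by simp)).2 ⟨?_, ?_, ?_⟩, conn_of_isChain (by simpa using eδ), ?_, α, by simp,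
        β, by simp, γ, by simp, ?_, ?_, ?_, ⟨δ, by simp, e4.symm⟩, ⟨δ, by simp, e3⟩,
        ⟨p₂, by simp, eγ⟩⟩ ?_ ?_ ?_ ?_
    · simp; grind
    · simpa using ⟨eα.symm, e1⟩
    · simpa using ⟨e2, eβ⟩
    · intro v hv hv'
      simp at hv hv'; grind
    · grind
    · grind
    · grind
    · rintro v (hv | hv)
      · simp at hv
        rcases hv with hv | hv | hv | hv
        · right; simp [hv]
        · left; simp [hv]
        · left; simp [hv]
        · left; simp [hv]
      · simp at hv
        rcases hv with hv | hv
        · left; simp [hv]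
        · right; simp [hv]
    · right; simp [hz]
    · simp only [List.cons_append, List.nodup_cons, List.nodup_append, List.mem_append,
        List.mem_cons] at hnP
      simp; grind
    · simp only [List.cons_append, List.nodup_cons, List.nodup_append, List.mem_append,
        List.mem_cons] at hnP
      simp; grind
  subst hM
  have e5 : G.Adj p₁ p₂ := by simpa using hP
  refine ⟨{α, β, p₂}, {γ, δ, p₁}, ?_, ?_, ?_⟩
  · rw [ncard_triple] <;> grind
  · rw [ncard_triple] <;> grind
  · rintro a (rfl | rfl | rfl) b (rfl | rfl | rfl)
    exacts [e1, e4.symm, eα, e2.symm, e3, eβ, eγ.symm, eδ.symm, e5.symm]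

theorem MinNSP.four {C : List V} {p₁ p₂ α β γ δ : V} {M : List V} (hT : TriFree G)
    (h : MinNSP G C {v | v ∈ p₁ :: M ++ [p₂]}) (hP : IndPath G (p₁ :: M ++ [p₂]))
    (hα : α ∈ C) (hβ : β ∈ C) (hγ : γ ∈ C) (hδ : δ ∈ C) (hαβ : α ≠ β) (hαγ : α ≠ γ)
    (hαδ : α ≠ δ) (hβγ : β ≠ γ) (hβδ : β ≠ δ) (hγδ : γ ≠ δ)
    (eα : G.Adj α p₁) (eβ : G.Adj β p₁) (eγ : G.Adj γ p₂) (eδ : G.Adj δ p₂) : HasK33 G := by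
  obtain ⟨X, Y, Z, hr⟩ := exists_order_three hα hβ hγ hαβ hαγ hβγ
  have h := h.rotated hr
  have hδ : δ ∈ α :: X ++ β :: (Y ++ γ :: Z) := by
    rcases hr with hr | hr
    · exact hr.mem_iff.1 hδ
    · exact hr.mem_iff.1 (List.mem_reverse.2 hδ)
  have hδ : δ ∈ X ∨ δ ∈ Y ∨ δ ∈ Z := by
    simp at hδ; grind
  rcases hδ with hδ | hδ | hδ
  · obtain ⟨X₁, X₂, rfl⟩ := List.append_of_mem hδ
    have e : α :: (X₁ ++ δ :: X₂) ++ β :: (Y ++ γ :: Z) =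
      α :: X₁ ++ δ :: (X₂ ++ β :: (Y ++ γ :: Z)) := by simp
    rw [e] at h
    exact h.hasK33 hP eα eβ eδ eγ
  · obtain ⟨Y₁, Y₂, rfl⟩ := List.append_of_mem hδ
    have e : α :: X ++ β :: (Y₁ ++ δ :: Y₂ ++ γ :: Z) =
      α :: X ++ β :: (Y₁ ++ δ :: (Y₂ ++ γ :: Z)) := by simp
    rw [e] at h
    exact (h.noncrossing hT hP eα eβ eδ eγ).elim
  · obtain ⟨Z₁, Z₂, rfl⟩ := List.append_of_mem hδ
    exact (h.noncrossing hT hP eα eβ eγ eδ).elim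

/-- By `MinNSP.leaf` each end of the path has a private attachment: β sees only p₁ and γ sees only
p₂. Every other attachment has a unique neighbour on the path. With one further attachment there are
exactly three links. With two, their neighbours are p₁ and p₂, which leads to K₃,₃. -/
theorem MinNSP.path_case [Finite V] (hT : TriFree G) (hI : ISK4Free G) {C : List V}
    {p₁ p₂ : V} {M : List V} (hC : HoleL G C)
    (h : MinNSP G C {v | v ∈ p₁ :: M ++ [p₂]}) (hP : IndPath G (p₁ :: M ++ [p₂])) : HasK33 G := by
  have hnP := hP.nodup
  have hp : p₁ ≠ p₂ := by rintro rfl; simp at hnP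
  have s1 : ({v | v ∈ p₁ :: M ++ [p₂]} \ {p₁} : Set V) = {v | v ∈ M ++ [p₂]} := by
    ext v
    have : p₁ ∉ M ++ [p₂] := (List.nodup_cons.1 hnP).1
    simp only [Set.mem_sdiff, Set.mem_ofPred_eq, Set.mem_singleton_iff, List.cons_append,
      List.mem_cons]
    constructor
    · rintro ⟨h | h, h'⟩
      · exact absurd h h'
      · exact h
    · intro hv'; exact ⟨Or.inr hv', by rintro rfl; exact this hv'⟩
  have s2 : ({v | v ∈ p₁ :: M ++ [p₂]} \ {p₂} : Set V) = {v | v ∈ p₁ :: M} := by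
    ext v
    have : p₂ ∉ p₁ :: M := by
      have := (List.nodup_append.1 hnP).2.2
      intro h'; exact this _ h' _ (by simp) rfl
    simp only [Set.mem_sdiff, Set.mem_ofPred_eq, Set.mem_singleton_iff, List.mem_append,
      List.mem_singleton]
    constructor
    · rintro ⟨h | h, h'⟩
      · exact h
      · exact absurd h h'
    · intro hv'; exact ⟨Or.inl hv', by rintro rfl; exact this hv'⟩
  have leaf₁ : ∀ a b c, a ∈ C → b ∈ C → c ∈ C → a ≠ b → a ≠ c → b ≠ c →
      (∃ v ∈ M ++ [p₂], G.Adj a v) → (∃ v ∈ M ++ [p₂], G.Adj b v) →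
      (∃ v ∈ M ++ [p₂], G.Adj c v) → False := by
    intro a b c ha hb hc hab hac hbc aa ab ac
    refine h.leaf (p := p₁) (by simp) ?_ ha hb hc hab hac hbc ?_ ?_ ?_ <;> rw [s1]
    · exact conn_of_isChain (hP.isChain.infix ⟨[p₁], [], by simp⟩)
    · exact aa
    · exact ab
    · exact ac
  have leaf₂ : ∀ a b c, a ∈ C → b ∈ C → c ∈ C → a ≠ b → a ≠ c → b ≠ c →
      (∃ v ∈ p₁ :: M, G.Adj a v) → (∃ v ∈ p₁ :: M, G.Adj b v) →
      (∃ v ∈ p₁ :: M, G.Adj c v) → False := by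
    intro a b c ha hb hc hab hac hbc aa ab ac
    refine h.leaf (p := p₂) (by simp) ?_ ha hb hc hab hac hbc ?_ ?_ ?_ <;> rw [s2]
    · exact conn_of_isChain (hP.isChain.infix ⟨[], [p₂], by simp⟩)
    · exact aa
    · exact ab
    · exact ac
  obtain ⟨-, hconn, hdis, a, ha, b, hb, c, hc, hab, hac, hbc, aa, ab, ac⟩ := h.1
  have split₁ : ∀ x, Att G {v | v ∈ p₁ :: M ++ [p₂]} x → G.Adj x p₁ ∨ ∃ v ∈ M ++ [p₂], G.Adj x v := by
    rintro x ⟨v, hv, e⟩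
    have hv : v = p₁ ∨ v ∈ M ++ [p₂] := by simpa using hv
    rcases hv with rfl | hv
    · exact Or.inl e
    · exact Or.inr ⟨v, hv, e⟩
  have split₂ : ∀ x, Att G {v | v ∈ p₁ :: M ++ [p₂]} x → G.Adj x p₂ ∨ ∃ v ∈ p₁ :: M, G.Adj x v := by
    rintro x ⟨v, hv, e⟩
    have hv : v = p₂ ∨ v ∈ p₁ :: M := by simp at hv ⊢; tauto
    rcases hv with rfl | hv
    · exact Or.inl e
    · exact Or.inr ⟨v, hv, e⟩
  have hβ : ∃ β ∈ C, G.Adj β p₁ ∧ ¬ ∃ v ∈ M ++ [p₂], G.Adj β v := by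
    by_contra hcon
    push Not at hcon
    have key : ∀ x ∈ C, Att G {v | v ∈ p₁ :: M ++ [p₂]} x → ∃ v ∈ M ++ [p₂], G.Adj x v := by
      intro x hx ax
      rcases split₁ x ax with e | e
      · exact hcon x hx e
      · exact e
    exact leaf₁ a b c ha hb hc hab hac hbc (key a ha aa) (key b hb ab) (key c hc ac)
  have hγ : ∃ γ ∈ C, G.Adj γ p₂ ∧ ¬ ∃ v ∈ p₁ :: M, G.Adj γ v := by
    by_contra hcon
    push Not at hcon
    have key : ∀ x ∈ C, Att G {v | v ∈ p₁ :: M ++ [p₂]} x → ∃ v ∈ p₁ :: M, G.Adj x v := by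
      intro x hx ax
      rcases split₂ x ax with e | e
      · exact hcon x hx e
      · exact e
    exact leaf₂ a b c ha hb hc hab hac hbc (key a ha aa) (key b hb ab) (key c hc ac)
  obtain ⟨β, hβ, eβ, nβ⟩ := hβ
  obtain ⟨γ, hγ, eγ, nγ⟩ := hγ
  have hβγ : β ≠ γ := by rintro rfl; exact nβ ⟨p₂, by simp, eγ⟩
  have hα : ∃ α ∈ C, α ≠ β ∧ α ≠ γ ∧ Att G {v | v ∈ p₁ :: M ++ [p₂]} α := by
    by_cases ha' : a ≠ β ∧ a ≠ γ
    · exact ⟨a, ha, ha'.1, ha'.2, aa⟩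
    by_cases hb' : b ≠ β ∧ b ≠ γ
    · exact ⟨b, hb, hb'.1, hb'.2, ab⟩
    refine ⟨c, hc, ?_, ?_, ac⟩ <;> rintro rfl <;> grind
  obtain ⟨α, hα, hαβ, hαγ, pα, hpα, eα⟩ := hα
  have uα : ∀ x ∈ C, x ≠ β → x ≠ γ → ∀ p ∈ p₁ :: M ++ [p₂], ∀ p' ∈ p₁ :: M ++ [p₂],
      G.Adj x p → G.Adj x p' → p = p' := fun x hx hxβ hxγ p hp p' hp' e e' =>
    h.unique_nbr hP hx hβ hγ hxβ hxγ hβγ eβ eγ hp hp' e e'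
  have uβ : ∀ p ∈ p₁ :: M ++ [p₂], G.Adj β p → p = p₁ := by
    intro p hp e
    rcases List.mem_cons.1 hp with hp | hp
    · exact hp
    · exact absurd ⟨p, hp, e⟩ nβ
  have uγ : ∀ p ∈ p₁ :: M ++ [p₂], G.Adj γ p → p = p₂ := by
    intro p hp e
    by_contra hne
    exact nγ ⟨p, by simp at hp ⊢; tauto, e⟩
  by_cases hδ : ∃ δ ∈ C, δ ≠ α ∧ δ ≠ β ∧ δ ≠ γ ∧ Att G {v | v ∈ p₁ :: M ++ [p₂]} δ
  · obtain ⟨δ, hδ, hδα, hδβ, hδγ, pδ, hpδ, eδ⟩ := hδ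
    have mem1 : ∀ p ∈ p₁ :: M ++ [p₂], p ≠ p₁ → p ∈ M ++ [p₂] := by
      intro p hp hne; exact (List.mem_cons.1 hp).resolve_left hne
    have mem2 : ∀ p ∈ p₁ :: M ++ [p₂], p ≠ p₂ → p ∈ p₁ :: M := by
      intro p hp hne; simp at hp ⊢; tauto
    -- Otherwise α, δ and γ would remain attached after the deletion of p₁.
    have c1 : pα = p₁ ∨ pδ = p₁ := by
      by_contra hcon
      push Not at hcon
      exact leaf₁ α δ γ hα hδ hγ hδα.symm hαγ hδγ ⟨pα, mem1 _ hpα hcon.1, eα⟩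
        ⟨pδ, mem1 _ hpδ hcon.2, eδ⟩ ⟨p₂, by simp, eγ⟩
    have c2 : pα = p₂ ∨ pδ = p₂ := by
      by_contra hcon
      push Not at hcon
      exact leaf₂ α δ β hα hδ hβ hδα.symm hαβ hδβ ⟨pα, mem2 _ hpα hcon.1, eα⟩
        ⟨pδ, mem2 _ hpδ hcon.2, eδ⟩ ⟨p₁, by simp, eβ⟩
    rcases c1 with rfl | rfl
    · rcases c2 with hh | rfl
      · exact absurd hh hp
      · exact h.four hT hP hα hβ hγ hδ hαβ hαγ hδα.symm hβγ hδβ.symm hδγ.symm eα eβ eγ eδ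
    · rcases c2 with rfl | hh
      · exact h.four hT hP hδ hβ hγ hα hδβ hδγ hδα hβγ hαβ.symm hαγ.symm eδ eβ eγ eα
      · exact absurd hh hp
  · push Not at hδ
    refine (no_three_links hT hI hC hconn hdis hα hβ hγ hpα (a' := pα) (b' := p₁) (c' := p₂)
      (by simp) (by simp) hαβ hαγ hβγ eα eβ eγ ?_).elim
    intro u hu v hv e
    by_cases huα : u = α
    · subst huα; exact Or.inl ⟨rfl, uα u hu hαβ hαγ _ hv _ hpα e eα⟩
    by_cases huβ : u = β
    · subst huβ; exact Or.inr (Or.inl ⟨rfl, uβ _ hv e⟩)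
    by_cases huγ : u = γ
    · subst huγ; exact Or.inr (Or.inr ⟨rfl, uγ _ hv e⟩)
    exact absurd ⟨v, hv, e⟩ (hδ u hu huα huβ huγ)

/-- Adjacency by position, for the comparison with `cycleGraph`; the second alternative is the
closing edge. -/
theorem HoleL.cons_of_lt {l : List V} (h : HoleL G l) (i j : ℕ) (hi : i < l.length)
    (hj : j < l.length) (hij : i < j) :
    G.Adj l[i] l[j] ↔ j = i + 1 ∨ (i = 0 ∧ j + 1 = l.length) := by
  obtain ⟨a, b, m, c, rfl, hm, h1, h2, h3, h4⟩ := h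
  have hI : ∀ (l : List V), IndPath G l → ∀ (i j : ℕ) (hi : i < l.length) (hj : j < l.length),
      i < j → (G.Adj l[i] l[j] ↔ j = i + 1) := by
    intro l
    induction l with
    | nil => intro _ i j hi; simp at hi
    | cons a l ih =>
      intro h i j hi hj hij
      obtain ⟨j, rfl⟩ : ∃ k, j = k + 1 := ⟨j - 1, by omega⟩
      cases l with
      | nil => simp at hj
      | cons b l =>
        cases i with
        | zero =>
          cases j with
          | zero => simpa using h.1
          | succ j =>
            simp only [List.getElem_cons_zero, List.getElem_cons_succ]
            constructor
            · intro e
              exact absurd e (h.2.1 a (by simp) _ (List.getElem_mem _)).2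
            · intro e; omega
        | succ i =>
          have := ih h.2.2 i j (by simpa using hi) (by simpa using hj) (by omega)
          simp only [List.getElem_cons_succ] at this ⊢
          rw [this]; omega
  have hlen : (a :: b :: (m ++ [c])).length = m.length + 3 := by simp
  obtain ⟨j, rfl⟩ : ∃ k, j = k + 1 := ⟨j - 1, by omega⟩
  cases i with
  | zero =>
    simp only [List.getElem_cons_zero, List.getElem_cons_succ]
    cases j with
    | zero => simpa using h2
    | succ j =>
      simp only [List.getElem_cons_succ]
      rw [hlen] at hj ⊢
      by_cases hjm : j < m.length
      · rw [List.getElem_append_left hjm]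
        constructor
        · intro e; exact absurd e (h4 a (by simp) _ (List.getElem_mem _)).2
        · intro e; omega
      · rw [List.getElem_append_right (by omega)]
        simp only [List.getElem_singleton]
        constructor
        · intro _; exact Or.inr ⟨by trivial, by omega⟩
        · intro _; exact h3.symm
  | succ i =>
    simp only [List.getElem_cons_succ]
    rw [hI _ h1 i j (by simpa using hi) (by simpa using hj) (by omega)]
    omega

theorem HoleL.four_le {l : List V} (h : HoleL G l) : 4 ≤ l.length := by
  obtain ⟨a, b, m, c, rfl, hm, h1, h2, h3, h4⟩ := h
  have := List.length_pos_iff.2 hm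
  simp; omega

theorem HoleL.isHole {l : List V} (h : HoleL G l) : IsHole G {v | v ∈ l} := by
  obtain ⟨n, hn⟩ : ∃ n, l.length = n + 4 := ⟨l.length - 4, by have := h.four_le; omega⟩
  refine ⟨n + 4, by omega, ⟨SimpleGraph.Iso.symm ?_⟩⟩
  have hnd := h.nodup
  let f : Fin (n + 4) → {v | v ∈ l} := fun i => ⟨l[i.1]'(by omega), List.getElem_mem _⟩
  have hf : Function.Bijective f := by
    constructor
    · intro i j hij
      have := congrArg Subtype.val hij
      exact Fin.ext ((List.Nodup.getElem_inj_iff hnd).1 this)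
    · rintro ⟨v, hv⟩
      obtain ⟨i, hi, rfl⟩ := List.mem_iff_getElem.1 hv
      exact ⟨⟨i, by omega⟩, rfl⟩
  refine ⟨Equiv.ofBijective f hf, ?_⟩
  intro i j
  have key : ∀ i j : Fin (n + 4), i < j → (G.Adj (f i).1 (f j).1 ↔
      (SimpleGraph.cycleGraph (n + 4)).Adj i j) := by
    intro i j hij
    have h1 := h.cons_of_lt i.1 j.1 (by omega) (by omega) hij
    rw [SimpleGraph.cycleGraph_adj']
    have e : G.Adj (f i).1 (f j).1 ↔ G.Adj (l[i.1]'(by omega)) (l[j.1]'(by omega)) := Iff.rfl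
    rw [e, h1, Fin.sub_def, Fin.sub_def]
    have hi := i.2
    have hj := j.2
    have hij' : i.1 < j.1 := hij
    simp only
    -- Subtraction in `Fin` is modulo n + 4: the difference j - i is the honest one, and i - j wraps
    -- around.
    have e1 : (n + 4 - i.1 + j.1) % (n + 4) = j.1 - i.1 := by
      have : n + 4 - i.1 + j.1 = (j.1 - i.1) + (n + 4) := by omega
      rw [this, Nat.add_mod_right, Nat.mod_eq_of_lt (by omega)]
    have e2 : (n + 4 - j.1 + i.1) % (n + 4) = n + 4 - j.1 + i.1 := Nat.mod_eq_of_lt (by omega)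
    rw [e1, e2, hn]
    omega
  change G.Adj (f i).1 (f j).1 ↔ _
  rcases lt_trichotomy i j with hij | rfl | hij
  · exact key i j hij
  · simp
  · rw [SimpleGraph.adj_comm, key j i hij, SimpleGraph.adj_comm]

theorem exists_three_of_ncard {S : Set V} (h : 3 ≤ S.ncard) :
    ∃ a ∈ S, ∃ b ∈ S, ∃ c ∈ S, a ≠ b ∧ a ≠ c ∧ b ≠ c := by
  have hf : S.Finite := Set.finite_of_ncard_pos (by omega)
  have := (Set.two_lt_ncard_iff hf).1 h
  obtain ⟨a, b, c, ha, hb, hc, h1, h2, h3⟩ := this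
  exact ⟨a, ha, b, hb, c, hc, h1, h2, h3⟩

theorem three_le_ncard [Finite V] {S : Set V} {a b c : V} (ha : a ∈ S) (hb : b ∈ S) (hc : c ∈ S)
    (hab : a ≠ b) (hac : a ≠ c) (hbc : b ≠ c) : 3 ≤ S.ncard :=
  (Set.two_lt_ncard_iff (Set.toFinite _)).2 ⟨a, b, c, ha, hb, hc, hab, hac, hbc⟩

theorem claw_conn {d : V} {La Lb Lc : List V} (h1 : (d :: La).IsChain G.Adj)
    (h2 : (d :: Lb).IsChain G.Adj) (h3 : (d :: Lc).IsChain G.Adj) :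
    Conn G {v | v ∈ d :: (La ++ (Lb ++ Lc))} := by
  have : {v | v ∈ d :: (La ++ (Lb ++ Lc))} = {v | v ∈ d :: La} ∪ {v | v ∈ d :: Lb} ∪
      {v | v ∈ d :: Lc} := by ext v; simp; tauto
  rw [this]
  exact ((conn_of_isChain h1).union (conn_of_isChain h2) (a := d) (b := d) (by simp) (by simp)
    (Or.inl rfl)).union (conn_of_isChain h3) (a := d) (b := d) (by simp) (by simp) (Or.inl rfl)

theorem Claw.nodup {d a b c : V} {La Lb Lc : List V} (h : Claw G d La Lb Lc a b c) :
    (d :: (La ++ (Lb ++ Lc))).Nodup := by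
  obtain ⟨h1, h2, h3, n1, n2, n3, -⟩ := h
  have m1 := h1.nodup
  have m2 := h2.nodup
  have m3 := h3.nodup
  simp only [List.nodup_cons] at m1 m2 m3
  simp only [List.nodup_cons, List.nodup_append, List.mem_append, not_or]
  refine ⟨⟨m1.1, m2.1, m3.1⟩, m1.2, ⟨m2.2, m3.2, fun u hu v hv => (n3 u hu v hv).1⟩, ?_⟩
  rintro u hu v (hv | hv)
  · exact (n1 u hu v hv).1
  · exact (n2 u hu v hv).1

theorem eq_concat_of_getLast? {d a : V} {L : List V} (hL : L ≠ [])
    (h : (d :: L).getLast? = some a) : ∃ L₀, L = L₀ ++ [a] := by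
  obtain ⟨L₀, c, rfl⟩ : ∃ B' c, L = B' ++ [c] := ⟨_, _, (List.dropLast_append_getLast hL).symm⟩
  have := getLast?_append_cons (l := d :: L₀) (m := []) (v := c)
  rw [List.cons_append] at this
  rw [this] at h
  simp at h
  exact ⟨L₀, by rw [h]⟩

theorem MinNSP.eq_of_att {C : List V} {D : Set V} (h : MinNSP G C D) {p b c u : V} (hp : p ∈ D)
    (hc : Conn G (D \ {p})) (hb : b ∈ C) (hc' : c ∈ C) (hbc : b ≠ c) (hu : u ∈ C)
    (ab : Att G (D \ {p}) b) (ac : Att G (D \ {p}) c) (au : Att G (D \ {p}) u) :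
    u = b ∨ u = c := by
  by_contra hcon
  push Not at hcon
  exact h.leaf hp hc hu hb hc' hcon.1 hcon.2 hbc au ab ac

/-- Deleting the end of one leg keeps the claw connected, so only the attachments of the other two
legs can see what remains. Intersecting these restrictions for the three legs leaves exactly the
three chosen links. -/
theorem MinNSP.legs_false (hT : TriFree G) (hI : ISK4Free G) {C : List V} {d a b c a' b' c' : V}
    {La Lb Lc : List V} (hC : HoleL G C)
    (h : MinNSP G C {v | v ∈ d :: (La ++ (Lb ++ Lc))}) (hcl : Claw G d La Lb Lc a' b' c')
    (ha : a ∈ C) (hb : b ∈ C) (hc : c ∈ C) (hab : a ≠ b) (hac : a ≠ c) (hbc : b ≠ c)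
    (ea : G.Adj a a') (eb : G.Adj b b') (ec : G.Adj c c')
    (na : La ≠ []) (nb : Lb ≠ []) (nc : Lc ≠ []) : False := by
  have hnd := hcl.nodup
  have hcl' := hcl
  obtain ⟨h1, h2, h3, n1, n2, n3, l1, l2, l3⟩ := hcl
  obtain ⟨La, rfl⟩ := eq_concat_of_getLast? na l1
  obtain ⟨Lb, rfl⟩ := eq_concat_of_getLast? nb l2
  obtain ⟨Lc, rfl⟩ := eq_concat_of_getLast? nc l3
  have sa : ({v | v ∈ d :: (La ++ [a'] ++ (Lb ++ [b'] ++ (Lc ++ [c'])))} \ {a'} : Set V) =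
      {v | v ∈ d :: (La ++ (Lb ++ [b'] ++ (Lc ++ [c'])))} := by
    ext v; simp at hnd ⊢; grind
  have sb : ({v | v ∈ d :: (La ++ [a'] ++ (Lb ++ [b'] ++ (Lc ++ [c'])))} \ {b'} : Set V) =
      {v | v ∈ d :: (La ++ [a'] ++ (Lb ++ (Lc ++ [c'])))} := by
    ext v; simp at hnd ⊢; grind
  have sc : ({v | v ∈ d :: (La ++ [a'] ++ (Lb ++ [b'] ++ (Lc ++ [c'])))} \ {c'} : Set V) =
      {v | v ∈ d :: (La ++ [a'] ++ (Lb ++ [b'] ++ Lc))} := by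
    ext v; simp at hnd ⊢; grind
  have i1 : (d :: La).IsChain G.Adj := h1.isChain.infix ⟨[], [a'], by simp⟩
  have i2 : (d :: Lb).IsChain G.Adj := h2.isChain.infix ⟨[], [b'], by simp⟩
  have i3 : (d :: Lc).IsChain G.Adj := h3.isChain.infix ⟨[], [c'], by simp⟩
  have hab' : a' ≠ b' := (n1 a' (by simp) b' (by simp)).1
  have hac' : a' ≠ c' := (n2 a' (by simp) c' (by simp)).1
  have hbc' : b' ≠ c' := (n3 b' (by simp) c' (by simp)).1
  have ma : a' ∈ {v | v ∈ d :: (La ++ [a'] ++ (Lb ++ [b'] ++ (Lc ++ [c'])))} := by simp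
  have mb : b' ∈ {v | v ∈ d :: (La ++ [a'] ++ (Lb ++ [b'] ++ (Lc ++ [c'])))} := by simp
  have mc : c' ∈ {v | v ∈ d :: (La ++ [a'] ++ (Lb ++ [b'] ++ (Lc ++ [c'])))} := by simp
  refine no_three_links hT hI hC h.1.2.1 h.1.2.2.1 ha hb hc ma mb mc hab hac hbc ea eb ec ?_
  intro u hu v hv e
  have ka : v ≠ a' → u = b ∨ u = c := fun hne =>
    h.eq_of_att ma (by rw [sa]; exact claw_conn i1 h2.isChain h3.isChain) hb hc hbc hu
      ⟨b', ⟨mb, hab'.symm⟩, eb⟩ ⟨c', ⟨mc, hac'.symm⟩, ec⟩ ⟨v, ⟨hv, hne⟩, e⟩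
  have kb : v ≠ b' → u = a ∨ u = c := fun hne =>
    h.eq_of_att mb (by rw [sb]; exact claw_conn h1.isChain i2 h3.isChain) ha hc hac hu
      ⟨a', ⟨ma, hab'⟩, ea⟩ ⟨c', ⟨mc, hbc'.symm⟩, ec⟩ ⟨v, ⟨hv, hne⟩, e⟩
  have kc : v ≠ c' → u = a ∨ u = b := fun hne =>
    h.eq_of_att mc (by rw [sc]; exact claw_conn h1.isChain h2.isChain i3) ha hb hab hu
      ⟨a', ⟨ma, hac'⟩, ea⟩ ⟨b', ⟨mb, hbc'⟩, eb⟩ ⟨v, ⟨hv, hne⟩, e⟩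
  grind

theorem HoleL.isWheel [Finite V] {C : List V} {x a b c : V} (h : HoleL G C) (hx : x ∉ C)
    (ha : a ∈ C) (hb : b ∈ C) (hc : c ∈ C) (hab : a ≠ b) (hac : a ≠ c) (hbc : b ≠ c)
    (ea : G.Adj x a) (eb : G.Adj x b) (ec : G.Adj x c) : IsWheel G {v | v ∈ C} x :=
  ⟨h.isHole, hx, three_le_ncard (a := a) (b := b) (c := c) ⟨ha, ea⟩ ⟨hb, eb⟩ ⟨hc, ec⟩ hab hac hbc⟩

theorem MinNSP.hasK33_of_indPath [Finite V] (hT : TriFree G) (hI : ISK4Free G)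
    (hW : ∀ H x, ¬ IsWheel G H x) {C P : List V} (hC : HoleL G C)
    (h : MinNSP G C {v | v ∈ P}) (hP : IndPath G P) : HasK33 G := by
  obtain ⟨-, -, hdis, a, ha, b, hb, c, hc, hab, hac, hbc, ⟨a', ha', ea⟩, ⟨b', hb', eb⟩,
    ⟨c', hc', ec⟩⟩ := h.1
  cases P with
  | nil => simp at ha'
  | cons p₁ P =>
    by_cases hP0 : P = []
    · subst hP0
      simp only [Set.mem_ofPred_eq, List.mem_singleton] at ha' hb' hc'
      subst ha' hb' hc'
      exact (hW _ _ (hC.isWheel (fun h' => hdis _ h' (by simp)) ha hb hc hab hac hbc ea.symm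
        eb.symm ec.symm)).elim
    · obtain ⟨M, p₂, rfl⟩ : ∃ B' c, P = B' ++ [c] :=
        ⟨_, _, (List.dropLast_append_getLast hP0).symm⟩
      exact h.path_case hT hI hC hP

theorem indPath_of_legs {d : V} {L M : List V} (h : IndPath G (d :: L)) (h' : IndPath G (d :: M))
    (n : NE G L M) : IndPath G (L.reverse ++ d :: M) :=
  indPath_append_cons.2 ⟨by simpa using h.reverse, h', by simpa using n⟩

/-- The cycle has no chord, and minimality makes `D` equal to a claw inside it that joins the
neighbours of three attachments. A claw with an empty leg is an induced path. -/
theorem MinNSP.hasK33_of_no_wheel [Finite V] (hT : TriFree G) (hI : ISK4Free G)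
    (hW : ∀ H x, ¬ IsWheel G H x) {C : List V} {D : Set V} (h : MinNSP G C D) : HasK33 G := by
  have hC : HoleL G C := by
    rcases h.1.1.hole_or_chord hT with hC | ⟨u, A, v, B, hr, hA, hB, e⟩
    · exact hC
    · exact (chord_false hT h hr hA hB e).elim
  obtain ⟨hcy, hconn, hdis, a, ha, b, hb, c, hc, hab, hac, hbc, ⟨a', ha', ea⟩, ⟨b', hb', eb⟩,
    ⟨c', hc', ec⟩⟩ := h.1
  obtain ⟨d, La, Lb, Lc, hcl, hd, hLa, hLb, hLc⟩ := exists_claw hT hconn ha' hb' hc'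
  have hsub : {v | v ∈ d :: (La ++ (Lb ++ Lc))} ⊆ D := by
    intro v hv
    simp only [Set.mem_ofPred_eq, List.mem_cons, List.mem_append] at hv
    rcases hv with rfl | hv | hv | hv
    exacts [hd, hLa v hv, hLb v hv, hLc v hv]
  have hcl' := hcl
  obtain ⟨h1, h2, h3, n1, n2, n3, l1, l2, l3⟩ := hcl
  have hmem : ∀ {L : List V} {w : V}, (d :: L).getLast? = some w → L ⊆ La ++ (Lb ++ Lc) →
      w ∈ d :: (La ++ (Lb ++ Lc)) := by
    intro L w hw hL
    rcases List.mem_cons.1 (List.mem_of_mem_getLast? hw) with hw | hw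
    · exact hw ▸ List.mem_cons_self
    · exact List.mem_cons_of_mem _ (hL hw)
  have hnsp : NSP G C {v | v ∈ d :: (La ++ (Lb ++ Lc))} :=
    ⟨hcy, claw_conn h1.isChain h2.isChain h3.isChain, fun v hv hv' => hdis v hv (hsub hv'),
      a, ha, b, hb, c, hc, hab, hac, hbc, ⟨a', hmem l1 (by simp), ea⟩,
      ⟨b', hmem l2 (by simp), eb⟩, ⟨c', hmem l3 (by simp), ec⟩⟩
  have hD : D = {v | v ∈ d :: (La ++ (Lb ++ Lc))} := by
    refine Set.Subset.antisymm ?_ hsub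
    intro v hv
    rcases (h.2 C _ hnsp (fun v hv => hv.imp id fun hv => hsub hv)).1 v (Or.inr hv) with hv' | hv'
    · exact absurd hv (hdis v hv')
    · exact hv'
  subst hD
  have fin : ∀ P : List V, IndPath G P → (∀ v, v ∈ d :: (La ++ (Lb ++ Lc)) ↔ v ∈ P) → HasK33 G := by
    intro P hP hm
    have : {v | v ∈ d :: (La ++ (Lb ++ Lc))} = {v | v ∈ P} := Set.ext hm
    rw [this] at h
    exact h.hasK33_of_indPath hT hI hW hC hP
  by_cases na : La = []
  · exact fin _ (indPath_of_legs h2 h3 n3) (fun v => by subst na; simp; tauto)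
  by_cases nb : Lb = []
  · exact fin _ (indPath_of_legs h1 h3 n2) (fun v => by subst nb; simp; tauto)
  by_cases nc : Lc = []
  · exact fin _ (indPath_of_legs h1 h2 n1) (fun v => by subst nc; simp; tauto)
  exact (h.legs_false hT hI hC hcl' ha hb hc hab hac hbc ea eb ec na nb nc).elim

theorem Walk.exists_interior {α : Type*} {K : SimpleGraph α} {u v : α} (p : K.Walk u v)
    (hp : p.IsPath) (huv : u ≠ v) :
    ∃ L : List α, p.support = u :: L ++ [v] ∧ (u :: L ++ [v]).IsChain K.Adj ∧
      (u :: L ++ [v]).Nodup := by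
  have h1 : p.support = u :: p.support.tail := p.cons_tail_support.symm
  have hl : p.support.getLast? = some v := by
    rw [List.getLast?_eq_some_getLast (by simp), p.getLast_support]
  have hc := p.isChain_adj_support
  have hn := hp.support_nodup
  have hne : p.support ≠ [] := by simp
  generalize p.support = S at *
  obtain ⟨m, rfl⟩ : ∃ m, S = u :: m := ⟨_, h1⟩
  have hm : m ≠ [] := by
    rintro rfl
    simp at hl
    exact huv hl
  obtain ⟨L, w, rfl⟩ : ∃ B' c, m = B' ++ [c] := ⟨_, _, (List.dropLast_append_getLast hm).symm⟩
  obtain rfl : w = v := by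
    have := getLast?_cons_append_cons (u := u) (l := L) (m := []) (v := w)
    rw [this] at hl; simpa using hl
  exact ⟨L, rfl, hc, hn⟩

theorem nsp_of_lists {a b c d : V} {L₀₁ L₁₂ L₂₀ L₀ L₁ L₂ : List V}
    (c01 : (a :: L₀₁ ++ [b]).IsChain G.Adj) (c12 : (b :: L₁₂ ++ [c]).IsChain G.Adj)
    (c20 : (c :: L₂₀ ++ [a]).IsChain G.Adj) (c0 : (d :: L₀ ++ [a]).IsChain G.Adj)
    (c1 : (d :: L₁ ++ [b]).IsChain G.Adj) (c2 : (d :: L₂ ++ [c]).IsChain G.Adj)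
    (hn : (a :: L₀₁ ++ b :: (L₁₂ ++ c :: L₂₀)).Nodup)
    (hdis : ∀ v ∈ a :: L₀₁ ++ b :: (L₁₂ ++ c :: L₂₀), v ∉ d :: (L₀ ++ (L₁ ++ L₂))) :
    ∃ C D, NSP G C D := by
  have att : ∀ {u : V} {L : List V}, (d :: L ++ [u]).IsChain G.Adj → L ⊆ L₀ ++ (L₁ ++ L₂) →
      Att G {v | v ∈ d :: (L₀ ++ (L₁ ++ L₂))} u := by
    intro u L h hL
    obtain ⟨v, hv, e⟩ := adj_of_chain_concat (by simp) h
    exact ⟨v, List.cons_subset_cons d hL hv, e⟩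
  have ch : ∀ {u : V} {L : List V}, (d :: L ++ [u]).IsChain G.Adj → (d :: L).IsChain G.Adj :=
    fun h => h.infix ⟨[], [_], by simp; rfl⟩
  refine ⟨_, _, (cycL_glue (by simp)).2 ⟨hn, c01, ?_⟩, claw_conn (ch c0) (ch c1) (ch c2), hdis,
    a, by simp, b, by simp, c, by simp, ?_, ?_, ?_, att c0 (by simp), att c1 (by simp),
    att c2 (by simp)⟩
  · have : b :: (L₁₂ ++ c :: L₂₀) ++ [a] = b :: L₁₂ ++ c :: (L₂₀ ++ [a]) := by simp
    rw [this]
    exact List.isChain_split.2 ⟨c12, c20⟩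
  · rintro rfl; simp at hn
  · rintro rfl; simp at hn
  · rintro rfl
    have := (List.nodup_append.1 hn).2.1
    simp at this

theorem nodup_of_three {a b c : V} {L₀₁ L₁₂ L₂₀ : List V} (n01 : (a :: L₀₁ ++ [b]).Nodup)
    (n12 : (b :: L₁₂ ++ [c]).Nodup) (n20 : (c :: L₂₀ ++ [a]).Nodup) (hc : c ∉ L₀₁) (ha : a ∉ L₁₂)
    (hb : b ∉ L₂₀) (d1 : ∀ v ∈ L₀₁, v ∉ L₁₂) (d2 : ∀ v ∈ L₀₁, v ∉ L₂₀)
    (d3 : ∀ v ∈ L₁₂, v ∉ L₂₀) : (a :: L₀₁ ++ b :: (L₁₂ ++ c :: L₂₀)).Nodup := by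
  simp only [List.cons_append, List.nodup_cons, List.mem_append, List.mem_cons, not_or,
    List.nodup_append, List.not_mem_nil, or_false] at n01 n12 n20 ⊢
  grind

/-- In a subdivision of K₄ the paths among three branch vertices form the cycle, and the fourth
branch vertex with its paths, without their far ends, is the connected set. -/
theorem exists_nsp (h : ¬ SeriesParallel G) : ∃ C D, NSP G C D := by
  simp only [SeriesParallel, not_forall, not_not] at h
  obtain ⟨K, f, P, hf, hpath, hrev, hbr, hdisj, -, -⟩ := h
  let g : Fin 4 → V := fun i => (f i).1
  have hg : ∀ i j, g i = g j → i = j := fun i j h => hf (Subtype.ext h)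
  have hL : ∀ i j (hij : (⊤ : SimpleGraph (Fin 4)).Adj i j), ∃ L : List V,
      (∀ v ∈ L, ∃ w ∈ (P i j hij).support, w.1 = v) ∧ (g i :: L ++ [g j]).IsChain G.Adj ∧
      (g i :: L ++ [g j]).Nodup ∧ ∀ k, g k ∉ L := by
    intro i j hij
    obtain ⟨L, h1, h2, h3⟩ := Walk.exists_interior (P i j hij) (hpath i j hij) (hf.ne hij.ne)
    have e : g i :: L.map Subtype.val ++ [g j] = (f i :: L ++ [f j]).map Subtype.val := by
      simp [g]
    have h4 : (g i :: L.map Subtype.val ++ [g j]).Nodup := by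
      rw [e]; exact h3.map Subtype.val_injective
    refine ⟨L.map Subtype.val, ?_, ?_, h4, ?_⟩
    · intro v hv
      obtain ⟨w, hw, rfl⟩ := List.mem_map.1 hv
      exact ⟨w, by rw [h1]; simp [hw], rfl⟩
    · rw [e, List.isChain_map]
      exact h2.imp fun a b hab => K.adj_sub hab
    · intro k hk
      obtain ⟨w, hw, hwk⟩ := List.mem_map.1 hk
      obtain rfl : w = f k := Subtype.ext hwk
      rcases hbr i j hij k (by rw [h1]; simp [hw]) with rfl | rfl
      · simp at h3; exact h3.1.1 hw
      · have := (List.nodup_append.1 h3).2.2 (f k) (by simp [hw]) (f k) (by simp); exact this rfl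
  choose L l1 l2 l3 l4 using hL
  have adj : ∀ {i j : Fin 4}, i ≠ j → (⊤ : SimpleGraph (Fin 4)).Adj i j := fun h => h
  have dj : ∀ i j hij i' j' hij', s(i, j) ≠ s(i', j') → ∀ v ∈ L i j hij, v ∉ L i' j' hij' := by
    intro i j hij i' j' hij' hne v hv hv'
    obtain ⟨w, hw, rfl⟩ := l1 i j hij v hv
    obtain ⟨w', hw', e⟩ := l1 i' j' hij' _ hv'
    obtain rfl : w' = w := Subtype.ext e
    obtain ⟨k, rfl⟩ := hdisj i j hij i' j' hij' hne w' hw hw'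
    exact l4 i j hij k hv
  have e01 : (⊤ : SimpleGraph (Fin 4)).Adj 0 1 := adj (by decide)
  have e12 : (⊤ : SimpleGraph (Fin 4)).Adj 1 2 := adj (by decide)
  have e20 : (⊤ : SimpleGraph (Fin 4)).Adj 2 0 := adj (by decide)
  have e30 : (⊤ : SimpleGraph (Fin 4)).Adj 3 0 := adj (by decide)
  have e31 : (⊤ : SimpleGraph (Fin 4)).Adj 3 1 := adj (by decide)
  have e32 : (⊤ : SimpleGraph (Fin 4)).Adj 3 2 := adj (by decide)
  have hne : ∀ i j, i ≠ j → g i ≠ g j := fun i j hij h => hij (hg i j h)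
  have key : ∀ i j e, i ≠ 3 → j ≠ 3 → ∀ v ∈ L i j e,
      v ∉ g 3 :: (L 3 0 e30 ++ (L 3 1 e31 ++ L 3 2 e32)) := by
    intro i j e hi hj v hv hv'
    have hs : ∀ k, s(i, j) ≠ s(3, k) := by intro k h; rw [Sym2.eq_iff] at h; tauto
    simp only [List.mem_cons, List.mem_append] at hv'
    rcases hv' with rfl | hv' | hv' | hv'
    · exact l4 i j e 3 hv
    · exact dj i j e 3 0 e30 (hs 0) v hv hv'
    · exact dj i j e 3 1 e31 (hs 1) v hv hv'
    · exact dj i j e 3 2 e32 (hs 2) v hv hv'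
  have key' : ∀ i, i ≠ 3 → g i ∉ g 3 :: (L 3 0 e30 ++ (L 3 1 e31 ++ L 3 2 e32)) := by
    intro i hi
    simp only [List.mem_cons, List.mem_append, not_or]
    exact ⟨hne i 3 hi, l4 3 0 e30 i, l4 3 1 e31 i, l4 3 2 e32 i⟩
  refine nsp_of_lists (l2 0 1 e01) (l2 1 2 e12) (l2 2 0 e20) (l2 3 0 e30) (l2 3 1 e31)
    (l2 3 2 e32) (nodup_of_three (l3 0 1 e01) (l3 1 2 e12) (l3 2 0 e20) (l4 0 1 e01 2)
    (l4 1 2 e12 0) (l4 2 0 e20 1) (dj 0 1 e01 1 2 e12 (by decide)) (dj 0 1 e01 2 0 e20 (by decide))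
    (dj 1 2 e12 2 0 e20 (by decide))) ?_
  intro v hv
  simp only [List.cons_append, List.mem_append, List.mem_cons] at hv
  rcases hv with rfl | hv | rfl | hv | rfl | hv
  · exact key' 0 (by decide)
  · exact key 0 1 e01 (by decide) (by decide) v hv
  · exact key' 1 (by decide)
  · exact key 1 2 e12 (by decide) (by decide) v hv
  · exact key' 2 (by decide)
  · exact key 2 0 e20 (by decide) (by decide) v hv

theorem seriesParallel_or_hasK33 [Finite V] (hT : TriFree G) (hI : ISK4Free G)
    (hW : ∀ H x, ¬ IsWheel G H x) : SeriesParallel G ∨ HasK33 G := by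
  by_cases h : SeriesParallel G
  · exact Or.inl h
  · obtain ⟨C, D, h⟩ := exists_nsp h
    obtain ⟨C, D, h⟩ := h.exists_min
    exact Or.inr (h.hasK33_of_no_wheel hT hI hW)

/-! ### Maximal complete bipartite subgraphs and clique cutsets -/

/-- `A` and `B` are the sides of a complete bipartite subgraph that is maximal among those with
at least three vertices on each side. -/
def MaxBip (G : SimpleGraph V) (A B : Set V) : Prop :=
  3 ≤ A.ncard ∧ 3 ≤ B.ncard ∧ (∀ a ∈ A, ∀ b ∈ B, G.Adj a b) ∧
    (∀ v, v ∉ B → ∃ a ∈ A, ¬ G.Adj a v) ∧ (∀ v, v ∉ A → ∃ b ∈ B, ¬ G.Adj b v)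

theorem MaxBip.symm {A B : Set V} (h : MaxBip G A B) : MaxBip G B A :=
  ⟨h.2.1, h.1, fun b hb a ha => (h.2.2.1 a ha b hb).symm, h.2.2.2.2, h.2.2.2.1⟩

theorem HasK33.exists_maxBip [Finite V] (h : HasK33 G) : ∃ A B : Set V, MaxBip G A B := by
  classical
  -- Maximising |A| + |B| is expressed as minimising its deficit from 2|V|.
  have hQ : ∃ n, ∃ A B : Set V, (3 ≤ A.ncard ∧ 3 ≤ B.ncard ∧ ∀ a ∈ A, ∀ b ∈ B, G.Adj a b) ∧
      n + (A.ncard + B.ncard) = Nat.card V + Nat.card V := by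
    obtain ⟨A, B, h⟩ := h
    have h1 := Set.ncard_le_card A
    have h2 := Set.ncard_le_card B
    exact ⟨Nat.card V + Nat.card V - (A.ncard + B.ncard), A, B, h, by omega⟩
  obtain ⟨A, B, ⟨h1, h2, h3⟩, h4⟩ := Nat.find_spec hQ
  have hmax : ∀ A' B' : Set V, (3 ≤ A'.ncard ∧ 3 ≤ B'.ncard ∧ ∀ a ∈ A', ∀ b ∈ B', G.Adj a b) →
      A'.ncard + B'.ncard ≤ A.ncard + B.ncard := by
    intro A' B' h'
    have h1 := Set.ncard_le_card A'
    have h2 := Set.ncard_le_card B'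
    have := Nat.find_min' hQ (m := Nat.card V + Nat.card V - (A'.ncard + B'.ncard))
      ⟨A', B', h', by omega⟩
    omega
  refine ⟨A, B, h1, h2, h3, ?_, ?_⟩
  · intro v hv
    by_contra hcon
    push Not at hcon
    have hc := Set.ncard_insert_of_notMem hv
    have := hmax A (insert v B) ⟨h1, by omega, by
      rintro a ha b (rfl | hb)
      · exact hcon a ha
      · exact h3 a ha b hb⟩
    omega
  · intro v hv
    by_contra hcon
    push Not at hcon
    have hc := Set.ncard_insert_of_notMem hv
    have := hmax (insert v A) B ⟨by omega, h2, by
      rintro a (rfl | ha) b hb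
      · exact (hcon b hb).symm
      · exact h3 a ha b hb⟩
    omega

theorem MaxBip.indep (hT : TriFree G) {A B : Set V} (h : MaxBip G A B) {a a' : V} (ha : a ∈ A)
    (ha' : a' ∈ A) : ¬ G.Adj a a' := by
  obtain ⟨b, hb⟩ : B.Nonempty := by
    rw [Set.nonempty_iff_ne_empty]
    rintro rfl
    have := h.2.1
    simp at this
  intro e
  exact hT _ _ _ e (h.2.2.1 a' ha' b hb) (h.2.2.1 a ha b hb)

theorem MaxBip.disj {A B : Set V} (h : MaxBip G A B) {v : V} (ha : v ∈ A) (hb : v ∈ B) : False :=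
  (h.2.2.1 v ha v hb).ne rfl

/-- There is a path of `n` vertices outside `A ∪ B` that links two vertices of `A`. -/
def Ear (G : SimpleGraph V) (A B : Set V) (n : ℕ) : Prop :=
  ∃ P : List V, P ≠ [] ∧ P.length = n ∧ (∀ v ∈ P, v ∉ A ∧ v ∉ B) ∧
    ∃ a₁ ∈ A, ∃ a₂ ∈ A, a₁ ≠ a₂ ∧ (a₁ :: P ++ [a₂]).IsChain G.Adj

theorem exists_subchain {M : List V} {p p' b b' : V} (hM : M.IsChain G.Adj) (hp : p ∈ M)
    (hp' : p' ∈ M) (e : G.Adj b p) (e' : G.Adj b' p') :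
    ∃ M' : List V, M' ≠ [] ∧ M'.length ≤ M.length ∧ M' ⊆ M ∧ (b :: M' ++ [b']).IsChain G.Adj := by
  obtain ⟨S, T, rfl⟩ := List.append_of_mem hp
  have key : ∀ {X : List V} {p p' b b' : V}, G.Adj b p → G.Adj b' p' →
      (p :: X ++ [p']).IsChain G.Adj → (b :: (p :: X ++ [p']) ++ [b']).IsChain G.Adj := by
    intro X p p' b b' e e' h
    have : b :: (p :: X ++ [p']) ++ [b'] = b :: p :: (X ++ p' :: [b']) := by simp
    rw [this, List.isChain_cons_cons]
    refine ⟨e, ?_⟩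
    rw [← List.cons_append, List.isChain_split]
    exact ⟨h, by simpa using e'.symm⟩
  rcases List.mem_append.1 hp' with h | h
  · obtain ⟨S, X, rfl⟩ := List.append_of_mem h
    refine ⟨p :: X.reverse ++ [p'], by simp, by simp; omega, by intro x; simp; tauto,
      key e e' ?_⟩
    have := chain_reverse (hM.infix ⟨S, T, by simp⟩ : (p' :: X ++ [p]).IsChain G.Adj)
    simpa using this
  · rcases List.mem_cons.1 h with rfl | h
    · exact ⟨[p'], by simp, by simp; omega, by simp, by simp [e, e'.symm]⟩
    · obtain ⟨X, T, rfl⟩ := List.append_of_mem h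
      exact ⟨p :: X ++ [p'], by simp, by simp; omega, by intro x; simp; tauto,
        key e e' (hM.infix ⟨S, T, by simp⟩)⟩

theorem isChain_snoc_left {P : List V} {a b : V}
    (h : (a :: P ++ [b]).IsChain G.Adj) : (a :: P).IsChain G.Adj ∧ (P ++ [b]).IsChain G.Adj :=
  ⟨h.infix ⟨[], [b], by simp⟩, h.infix ⟨[a], [], by simp⟩⟩

/-- Take a shortest ear P, among the ears of both sides, from a₁ to a₂. There are a₃ in `A` and b₁,
b₂ in `B` with no neighbour on P. The 4-cycle b₁ a₁ b₂ a₃ and the connected set P ∪ {a₂} are then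
joined by exactly three edges: one from a₁ into P, and those from b₁ and b₂ to a₂. -/
theorem MaxBip.no_ear_aux [Finite V] (hT : TriFree G) (hI : ISK4Free G) {A B : Set V}
    (h : MaxBip G A B) {n : ℕ} (hE : Ear G A B n) (hmin : ∀ m < n, ¬ Ear G A B m ∧ ¬ Ear G B A m) :
    False := by
  obtain ⟨P₀, hP₀, rfl, hout₀, a₁, h₁, a₂, h₂, h12, hch⟩ := hE
  obtain ⟨q, hq, eq⟩ := adj_of_chain_cons hP₀ (isChain_snoc_left hch).1
  obtain ⟨q', hq', eq'⟩ := adj_of_chain_concat hP₀ (isChain_snoc_left hch).2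
  have hc₀ : P₀.IsChain G.Adj := hch.infix ⟨[a₁], [a₂], by simp⟩
  obtain ⟨P, hP, hPi, hPs, ⟨s, hs, hs'⟩, ⟨t, ht, ht'⟩, hX, hY⟩ :=
    exists_indPath (D := {v | v ∈ P₀}) (X := {v | G.Adj a₁ v}) (Y := {v | G.Adj a₂ v}) hq eq eq'
      (conn_of_isChain hc₀ q hq q' hq')
  have hs : G.Adj a₁ s := hs
  have ht : G.Adj a₂ t := ht
  have hlen : P.length ≤ P₀.length := (hPi.nodup.subperm hPs).length_le
  have hout : ∀ v ∈ P, v ∉ A ∧ v ∉ B := fun v hv => hout₀ v (hPs v hv)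
  have ha₁ : ∀ v ∈ P, G.Adj a₁ v → v = s := by
    intro v hv e
    cases P with
    | nil => simp at hv
    | cons p P =>
      simp at hs'
      subst hs'
      rcases List.mem_cons.1 hv with hv | hv
      · exact hv
      · exact absurd e (hX v hv)
  have hsP : s ∈ P := List.mem_of_mem_head? hs'
  have htP : t ∈ P := List.mem_of_mem_getLast? ht'
  have ha₂A : ∀ v ∈ P, v ≠ a₂ := fun v hv e => (hout v hv).1 (e ▸ h₂)
  -- For a one-vertex ear this is the maximality of the bipartite subgraph. For a longer ear, a
  -- neighbour on P of any third vertex of `A` would give a shorter ear.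
  have ha₃ : ∃ a₃ ∈ A, a₃ ≠ a₁ ∧ a₃ ≠ a₂ ∧ ∀ v ∈ P, ¬ G.Adj a₃ v := by
    by_cases hn : P₀.length = 1
    · obtain ⟨v, rfl⟩ : ∃ v, P = [v] := by
        rw [← List.length_eq_one_iff]
        have := List.length_pos_iff.2 hP
        omega
      simp at hs' ht'
      subst hs' ht'
      obtain ⟨a₃, h₃, e⟩ := h.2.2.2.1 v (hout v (by simp)).2
      refine ⟨a₃, h₃, ?_, ?_, by simpa using e⟩
      · rintro rfl; exact e hs
      · rintro rfl; exact e ht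
    · obtain ⟨a₃, h₃, n1, n2⟩ : ∃ a₃ ∈ A, a₃ ≠ a₁ ∧ a₃ ≠ a₂ := by
        obtain ⟨a, ha, b, hb, c, hc, hab, hac, hbc⟩ := exists_three_of_ncard h.1
        by_cases ha' : a ≠ a₁ ∧ a ≠ a₂
        · exact ⟨a, ha, ha'⟩
        by_cases hb' : b ≠ a₁ ∧ b ≠ a₂
        · exact ⟨b, hb, hb'⟩
        · exact ⟨c, hc, by grind, by grind⟩
      refine ⟨a₃, h₃, n1, n2, ?_⟩
      intro v hv e
      have hpos := List.length_pos_iff.2 hP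
      obtain ⟨p, P', rfl⟩ := List.exists_cons_of_ne_nil hP
      simp at hs'
      subst hs'
      rcases List.mem_cons.1 hv with rfl | hv'
      · refine (hmin 1 (by omega)).1 ⟨[v], by simp, rfl, by simpa using hout v (by simp), a₃, h₃,
          a₁, h₁, n1, ?_⟩
        simpa using ⟨e, hs.symm⟩
      · obtain ⟨M, m1, m2, m3, m4⟩ := exists_subchain (hPi.isChain.infix ⟨[p], [], by simp⟩)
          (b := a₃) (b' := a₂) (M := P') (p' := t) hv' (by
            rcases List.mem_cons.1 htP with rfl | h'
            · exfalso
              have : P' ≠ [] := List.ne_nil_of_mem hv'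
              have := hY t (by cases P' <;> simp_all)
              exact this ht
            · exact h') e ht
        exact (hmin M.length (by simp at hlen; omega)).1 ⟨M, m1, rfl,
          fun v hv => hout v (List.mem_cons_of_mem _ (m3 hv)), a₃, h₃, a₂, h₂, n2, m4⟩
  obtain ⟨a₃, h₃, n1, n2, hu₃⟩ := ha₃
  -- Two attached vertices of `B` would give an ear of the other side. It avoids the first vertex of
  -- P, which is adjacent to a₁ and so to no vertex of `B`, and is therefore shorter.
  have hone : ∀ b ∈ B, ∀ b' ∈ B, b ≠ b' → (∃ v ∈ P, G.Adj b v) → (∃ v ∈ P, G.Adj b' v) → False := by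
    rintro b hb b' hb' hne ⟨v, hv, e⟩ ⟨v', hv', e'⟩
    obtain ⟨p, P', rfl⟩ := List.exists_cons_of_ne_nil hP
    simp at hs'
    subst hs'
    have hp : ∀ b ∈ B, ¬ G.Adj b p := fun b hb e => hT _ _ _ hs e.symm (h.2.2.1 a₁ h₁ b hb)
    obtain ⟨M, m1, m2, m3, m4⟩ := exists_subchain (hPi.isChain.infix ⟨[p], [], by simp⟩)
      (M := P') ((List.mem_cons.1 hv).resolve_left (by rintro rfl; exact hp b hb e))
      ((List.mem_cons.1 hv').resolve_left (by rintro rfl; exact hp b' hb' e')) e e'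
    exact (hmin M.length (by simp at hlen; omega)).2 ⟨M, m1, rfl,
      fun v hv => (hout v (List.mem_cons_of_mem _ (m3 hv))).symm, b, hb, b', hb', hne, m4⟩
  obtain ⟨b₁, hb₁, b₂, hb₂, hb12, u₁, u₂⟩ : ∃ b₁ ∈ B, ∃ b₂ ∈ B, b₁ ≠ b₂ ∧
      (¬ ∃ v ∈ P, G.Adj b₁ v) ∧ (¬ ∃ v ∈ P, G.Adj b₂ v) := by
    obtain ⟨a, ha, b, hb, c, hc, hab, hac, hbc⟩ := exists_three_of_ncard h.2.1
    by_cases ka : ∃ v ∈ P, G.Adj a v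
    · exact ⟨b, hb, c, hc, hbc, fun k => hone a ha b hb hab ka k,
        fun k => hone a ha c hc hac ka k⟩
    by_cases kb : ∃ v ∈ P, G.Adj b v
    · exact ⟨a, ha, c, hc, hac, ka, fun k => hone b hb c hc hbc kb k⟩
    · exact ⟨a, ha, b, hb, hab, ka, kb⟩
  have AB := h.2.2.1
  have hind := fun {a a'} (ha : a ∈ A) (ha' : a' ∈ A) => h.indep hT ha ha'
  have hindB := fun {a a'} (ha : a ∈ B) (ha' : a' ∈ B) => h.symm.indep hT ha ha'
  have hhole : HoleL G (b₁ :: [a₁] ++ b₂ :: [a₃]) := by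
    rw [holeL_glue (by simp) (by simp)]
    have e1 := AB a₁ h₁ b₁ hb₁
    have e2 := AB a₁ h₁ b₂ hb₂
    have e3 := AB a₃ h₃ b₂ hb₂
    have e4 := AB a₃ h₃ b₁ hb₁
    refine ⟨⟨e1.symm, ?_, by simpa using e2⟩, ⟨e3.symm, ?_, by simpa using e4⟩, ?_⟩
    · simpa [NE] using ⟨hb12, hindB hb₁ hb₂⟩
    · simpa [NE] using ⟨hb12.symm, hindB hb₂ hb₁⟩
    · simpa [NE] using ⟨n1.symm, hind h₁ h₃⟩
  have hD : Conn G {v | v ∈ P ++ [a₂]} := by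
    have : {v | v ∈ P ++ [a₂]} = {v | v ∈ P} ∪ {a₂} := by ext v; simp; tauto
    rw [this]
    exact (conn_of_isChain hPi.isChain).union conn_singleton (a := t) (b := a₂) htP rfl
      (Or.inr (ht.symm))
  refine no_three_links hT hI hhole hD ?_ (a := a₁) (b := b₁) (c := b₂) (a' := s) (b' := a₂)
    (c' := a₂) (by simp) (by simp) (by simp) (by simp [hsP]) (by simp) (by simp)
    (AB a₁ h₁ b₁ hb₁).ne (AB a₁ h₁ b₂ hb₂).ne hb12 hs (AB a₂ h₂ b₁ hb₁).symm
    (AB a₂ h₂ b₂ hb₂).symm ?_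
  · have k : ∀ v ∈ P ++ [a₂], v ≠ a₁ ∧ v ≠ a₃ ∧ v ∉ B := by
      intro v hv
      rcases List.mem_append.1 hv with hv | hv
      · exact ⟨fun e => (hout v hv).1 (e ▸ h₁), fun e => (hout v hv).1 (e ▸ h₃), (hout v hv).2⟩
      · obtain rfl : v = a₂ := by simpa using hv
        exact ⟨h12.symm, n2.symm, fun hb => h.disj h₂ hb⟩
    intro v hv hv'
    have := k v hv'
    simp at hv
    rcases hv with rfl | rfl | rfl | rfl
    exacts [this.2.2 hb₁, this.1 rfl, this.2.2 hb₂, this.2.1 rfl]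
  · intro u hu v hv e
    have hv : v ∈ P ∨ v = a₂ := by simpa using hv
    simp at hu
    rcases hv with hv | rfl
    · rcases hu with rfl | rfl | rfl | rfl
      · exact absurd ⟨v, hv, e⟩ u₁
      · exact Or.inl ⟨rfl, ha₁ v hv e⟩
      · exact absurd ⟨v, hv, e⟩ u₂
      · exact absurd e (hu₃ v hv)
    · rcases hu with rfl | rfl | rfl | rfl
      · exact Or.inr (Or.inl ⟨rfl, rfl⟩)
      · exact absurd e (hind h₁ h₂)
      · exact Or.inr (Or.inr ⟨rfl, rfl⟩)
      · exact absurd e (hind h₃ h₂)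

theorem MaxBip.no_ear [Finite V] (hT : TriFree G) (hI : ISK4Free G) {A B : Set V}
    (h : MaxBip G A B) (n : ℕ) : ¬ Ear G A B n ∧ ¬ Ear G B A n := by
  induction n using Nat.strong_induction_on with
  | _ n ih =>
    exact ⟨fun hE => h.no_ear_aux hT hI hE ih,
      fun hE => h.symm.no_ear_aux hT hI hE fun m hm => (ih m hm).symm⟩

theorem MaxBip.isCompleteBipartite [Finite V] (hT : TriFree G) {A B : Set V} (h : MaxBip G A B)
    (hu : ∀ v, v ∈ A ∨ v ∈ B) : IsCompleteBipartite G := by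
  classical
  have hB : ∀ v, v ∉ A ↔ v ∈ B := fun v =>
    ⟨fun h' => (hu v).resolve_left h', fun hb ha => h.disj ha hb⟩
  obtain ⟨a, ha, -⟩ := exists_three_of_ncard h.1
  obtain ⟨b, hb, -⟩ := exists_three_of_ncard h.2.1
  obtain ⟨m, ⟨eA⟩⟩ := Finite.exists_equiv_fin A
  obtain ⟨n, ⟨eB⟩⟩ := Finite.exists_equiv_fin (Aᶜ : Set V)
  refine ⟨m, n, (eA ⟨a, ha⟩).pos, (eB ⟨b, (hB b).2 hb⟩).pos, ⟨SimpleGraph.Iso.symm ?_⟩⟩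
  refine ⟨(Equiv.sumCongr eA.symm eB.symm).trans (Equiv.Set.sumCompl A), ?_⟩
  rintro (i | i) (j | j)
  · simpa using h.indep hT (eA.symm i).2 (eA.symm j).2
  · simpa using h.2.2.1 _ (eA.symm i).2 _ ((hB _).1 (eB.symm j).2)
  · simpa using (h.2.2.1 _ (eA.symm j).2 _ ((hB _).1 (eB.symm i).2)).symm
  · simpa using h.symm.indep hT ((hB _).1 (eB.symm i).2) ((hB _).1 (eB.symm j).2)

theorem not_preconnected_of_closed {S D : Set V} {u v : V} (hu : u ∈ S) (hv : v ∈ S)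
    (huD : u ∈ D) (hvD : v ∉ D) (h : ∀ x ∈ D, ∀ y ∈ S, G.Adj x y → y ∈ D) :
    ¬ (G.induce S).Preconnected := by
  intro hp
  obtain ⟨w⟩ := hp ⟨u, hu⟩ ⟨v, hv⟩
  have key : ∀ {a b : S} (w : (G.induce S).Walk a b), a.1 ∈ D → b.1 ∈ D := by
    intro a b w
    induction w with
    | nil => exact id
    | cons e w ih => exact fun ha => ih (h _ ha _ (Subtype.property _) e)
  exact hvD (key w huD)

/-- Let D be a component outside A ∪ B. Two attachments of D on the same side would yield an ear, so
there is at most one on each side, and two attachments on different sides are adjacent. They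
separate D from a vertex of `A` that is not attached. -/
theorem HasK33.bipartite_or_cutset [Finite V] (hT : TriFree G) (hI : ISK4Free G) (h : HasK33 G) :
    IsCompleteBipartite G ∨ HasCliqueCutsetLE G 2 := by
  classical
  obtain ⟨A, B, h⟩ := h.exists_maxBip
  by_cases hu : ∀ v, v ∈ A ∨ v ∈ B
  · exact Or.inl (h.isCompleteBipartite hT hu)
  right
  push Not at hu
  obtain ⟨v₀, hA₀, hB₀⟩ := hu
  let E : Set V := {v | v ∉ A ∧ v ∉ B}
  let D : Set V := {v | Relation.ReflTransGen (fun u v => u ∈ E ∧ v ∈ E ∧ G.Adj u v) v₀ v}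
  have hDE : D ⊆ E := by
    intro v hv
    rcases Relation.ReflTransGen.cases_tail hv with h | ⟨w, -, hw⟩
    · exact h ▸ ⟨hA₀, hB₀⟩
    · exact hw.2.1
  have hear : ∀ {A B : Set V}, (∀ n, ¬ Ear G A B n) → (∀ v ∈ E, v ∉ A ∧ v ∉ B) →
      ∀ a ∈ A, ∀ a' ∈ A, Att G D a → Att G D a' → a = a' := by
    rintro A B hn hE a ha a' ha' ⟨d, hd, e⟩ ⟨d', hd', e'⟩
    by_contra hne
    have hl := (linked_symm hd).trans hd'
    obtain ⟨L, h1, h2, h3, h4⟩ := exists_chain_of_linked (hDE hd) hl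
    obtain ⟨M, m1, -, m3, m4⟩ := exists_subchain h1 (List.mem_of_mem_head? h3)
      (List.mem_of_mem_getLast? h4) e e'
    exact hn _ ⟨M, m1, rfl, fun v hv => hE v (h2 v (m3 hv)), a, ha, a', ha', hne, m4⟩
  have hAA := hear (A := A) (B := B) (fun n => (h.no_ear hT hI n).1) (fun v hv => hv)
  have hBB := hear (A := B) (B := A) (fun n => (h.no_ear hT hI n).2) (fun v hv => ⟨hv.2, hv.1⟩)
  let N : Set V := {v | (v ∈ A ∨ v ∈ B) ∧ Att G D v}
  have hN : ∃ C : Finset V, (C : Set V) = N := ⟨(Set.toFinite N).toFinset, by simp⟩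
  obtain ⟨C, hC⟩ := hN
  refine ⟨C, ?_, ?_, ?_⟩
  · rw [hC]
    rintro u ⟨hu | hu, au⟩ v ⟨hv | hv, av⟩ huv
    · exact absurd (hAA u hu v hv au av) huv
    · exact h.2.2.1 u hu v hv
    · exact (h.2.2.1 v hv u hu).symm
    · exact absurd (hBB u hu v hv au av) huv
  · by_contra hcon
    have : 3 ≤ N.ncard := by rw [← hC, Set.ncard_coe_finset]; omega
    obtain ⟨a, ⟨ha, aa⟩, b, ⟨hb, ab⟩, c, ⟨hc, ac⟩, hab, hac, hbc⟩ := exists_three_of_ncard this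
    rcases ha with ha | ha <;> rcases hb with hb | hb <;> rcases hc with hc | hc
    · exact hab (hAA a ha b hb aa ab)
    · exact hab (hAA a ha b hb aa ab)
    · exact hac (hAA a ha c hc aa ac)
    · exact hbc (hBB b hb c hc ab ac)
    · exact hbc (hAA b hb c hc ab ac)
    · exact hac (hBB a ha c hc aa ac)
    · exact hab (hBB a ha b hb aa ab)
    · exact hab (hBB a ha b hb aa ab)
  · rw [hC]
    obtain ⟨a, ha, hNa⟩ : ∃ a ∈ A, ¬ Att G D a := by
      obtain ⟨a, ha, b, hb, c, hc, hab, hac, hbc⟩ := exists_three_of_ncard h.1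
      by_cases ka : Att G D a
      · exact ⟨b, hb, fun kb => hab (hAA a ha b hb ka kb)⟩
      · exact ⟨a, ha, ka⟩
    refine not_preconnected_of_closed (D := D) (u := v₀) (v := a) ?_ ?_ .refl
      (fun h' => (hDE h').1 ha) ?_
    · rintro ⟨h' | h', -⟩
      exacts [hA₀ h', hB₀ h']
    · rintro ⟨-, h'⟩; exact hNa h'
    · intro x hx y hy e
      by_cases hyE : y ∈ E
      · exact Relation.ReflTransGen.tail hx ⟨hDE hx, hyE, e⟩
      · exact absurd ⟨by simp only [E, Set.mem_ofPred_eq] at hyE; tauto, x, hx, e.symm⟩ hy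

/-! ### Wheels: spokes, sectors and arms -/

open Classical in
/-- The number of neighbours of `x` in the list `l`. -/
noncomputable def cnt (G : SimpleGraph V) (x : V) (l : List V) : ℕ :=
  l.countP (fun v => decide (G.Adj x v))

@[simp] theorem cnt_append {x : V} {l m : List V} : cnt G x (l ++ m) = cnt G x l + cnt G x m :=
  List.countP_append

theorem cnt_cons {x a : V} {l : List V} : cnt G x (a :: l) = cnt G x [a] + cnt G x l :=
  cnt_append (l := [a])

theorem cnt_singleton_of_adj {x a : V} (h : G.Adj x a) : cnt G x [a] = 1 := by simp [cnt, h]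

theorem cnt_singleton_of_not_adj {x a : V} (h : ¬ G.Adj x a) : cnt G x [a] = 0 := by simp [cnt, h]

theorem cnt_singleton_le {x a : V} : cnt G x [a] ≤ 1 := List.countP_le_length

@[simp] theorem cnt_reverse {x : V} {l : List V} : cnt G x l.reverse = cnt G x l :=
  (List.reverse_perm l).countP_eq _

theorem cnt_eq_zero {x : V} {l : List V} : cnt G x l = 0 ↔ ∀ v ∈ l, ¬ G.Adj x v := by
  simp [cnt]

theorem cnt_pos {x : V} {l : List V} : 0 < cnt G x l ↔ ∃ v ∈ l, G.Adj x v := by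
  simp [cnt, List.countP_pos_iff]

/-- `l'` is obtained from the cyclic list `l` by rotation and possibly reversal. -/
def Rot (l l' : List V) : Prop := l ~r l' ∨ l.reverse ~r l'

theorem Rot.refl (l : List V) : Rot l l := Or.inl (List.IsRotated.refl l)

theorem Rot.rotated {l l' l'' : List V} (h : Rot l l') (h' : l' ~r l'') : Rot l l'' :=
  h.imp (fun h => h.trans h') (fun h => h.trans h')

theorem Rot.reverse {l l' : List V} (h : Rot l l') : Rot l l'.reverse := by
  rcases h with h | h
  · exact Or.inr h.reverse
  · exact Or.inl (by simpa using h.reverse)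

theorem Rot.swap {l A B : List V} (h : Rot l (A ++ B)) : Rot l (B ++ A) :=
  h.rotated List.isRotated_append

theorem Rot.reflect {l A B : List V} {y y' : V} (h : Rot l (y :: A ++ y' :: B)) :
    Rot l (y' :: A.reverse ++ y :: B.reverse) := by
  have h1 := h.reverse
  have e : (y :: A ++ y' :: B).reverse = B.reverse ++ (y' :: A.reverse ++ [y]) := by simp
  rw [e] at h1
  simpa using h1.swap

theorem Rot.mem_iff {l l' : List V} (h : Rot l l') {v : V} : v ∈ l ↔ v ∈ l' := by
  rcases h with h | h
  · exact h.mem_iff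
  · rw [← h.mem_iff, List.mem_reverse]

theorem Rot.cnt_eq {l l' : List V} (h : Rot l l') {x : V} : cnt G x l = cnt G x l' := by
  rcases h with h | h
  · exact h.perm.countP_eq _
  · rw [← cnt_reverse]; exact h.perm.countP_eq _

theorem Rot.length_eq {l l' : List V} (h : Rot l l') : l.length = l'.length := by
  rcases h with h | h
  · exact h.perm.length_eq
  · rw [← List.length_reverse]; exact h.perm.length_eq

theorem Rot.holeL {l l' : List V} (h : Rot l l') (hl : HoleL G l) : HoleL G l' := by
  rcases h with h | h
  · exact hl.rotated h
  · exact hl.reverse.rotated h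

/-- The vertex `v` has at least three neighbours in `S`. -/
def Three (G : SimpleGraph V) (v : V) (S : List V) : Prop :=
  ∃ a ∈ S, ∃ b ∈ S, ∃ c ∈ S, a ≠ b ∧ a ≠ c ∧ b ≠ c ∧ G.Adj v a ∧ G.Adj v b ∧ G.Adj v c

theorem Three.mono {v : V} {S T : List V} (h : Three G v S) (hS : S ⊆ T) : Three G v T := by
  obtain ⟨a, ha, b, hb, c, hc, h⟩ := h
  exact ⟨a, hS ha, b, hS hb, c, hS hc, h⟩

/-- Any two of three elements of `S`, each equal to `p` or `q`, coincide. -/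
theorem Three.false_of_two {v p q : V} {S : List V} (h : Three G v S)
    (hS : ∀ a ∈ S, G.Adj v a → a = p ∨ a = q) : False := by
  obtain ⟨a, ha, b, hb, c, hc, h1, h2, h3, e1, e2, e3⟩ := h
  have := hS a ha e1
  have := hS b hb e2
  have := hS c hc e3
  grind

/-- No vertex outside the closed neighbourhood of `x` has three neighbours in `S`. -/
def Good (G : SimpleGraph V) (x : V) (S : List V) : Prop :=
  ∀ v, v ≠ x → ¬ G.Adj x v → ¬ Three G v S

theorem Good.mono {x : V} {S T : List V} (h : Good G x T) (hS : S ⊆ T) : Good G x S :=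
  fun v hv hv' h3 => h v hv hv' (h3.mono hS)

/-- `c :: K ++ [d]` is a sector of the wheel formed by the hole `l` and the vertex `x`. -/
def Sec (G : SimpleGraph V) (x : V) (l : List V) (c : V) (K : List V) (d : V) : Prop :=
  G.Adj x c ∧ G.Adj x d ∧ (∀ v ∈ K, ¬ G.Adj x v) ∧ ∃ Q, Rot l (c :: K ++ d :: Q)

theorem Sec.of_infix {x c d : V} {l l' K : List V} (hr : Rot l l') (hi : c :: K ++ [d] <:+: l')
    (hc : G.Adj x c) (hd : G.Adj x d) (hK : ∀ v ∈ K, ¬ G.Adj x v) : Sec G x l c K d := by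
  obtain ⟨s, t, rfl⟩ := hi
  refine ⟨hc, hd, hK, t ++ s, ?_⟩
  have : Rot l (s ++ (c :: K ++ [d] ++ t)) := by simpa using hr
  simpa using this.swap

/-- A hole that splits into a path `E` all of whose sectors are good and a path `P` without
neighbours of `x`. -/
structure AG (G : SimpleGraph V) (x : V) (E P : List V) : Prop where
  hole : HoleL G (E ++ P)
  notMem : x ∉ E ++ P
  free : ∀ v ∈ P, ¬ G.Adj x v
  three : 3 ≤ cnt G x E
  good : ∀ c K d, c :: K ++ [d] <:+: E → G.Adj x c → G.Adj x d → (∀ v ∈ K, ¬ G.Adj x v) →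
    Good G x (c :: K ++ [d])

/-- Used when a path leaves the hole at another vertex than planned, but one with the same
neighbours on the path. -/
theorem indPath_replace_last {X : List V} {w w' : V} (h : IndPath G (X ++ [w]))
    (hw : ∀ p ∈ X, (G.Adj p w' ↔ G.Adj p w) ∧ p ≠ w') : IndPath G (X ++ [w']) := by
  induction X with
  | nil => simp
  | cons a X ih =>
    cases X with
    | nil => simpa using (hw a (by simp)).1.2 (by simpa using h)
    | cons b X =>
      refine ⟨h.1, ?_, ih h.2.2 fun p hp => hw p (List.mem_cons_of_mem _ hp)⟩
      have h1 := h.2.1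
      rw [List.append_eq, NE_append_right] at h1 ⊢
      refine ⟨h1.1, ?_⟩
      have h2 := h1.2 a (by simp) w (by simp)
      have h3 := hw a (by simp)
      simp only [NE, List.mem_singleton, forall_eq]
      exact ⟨h3.2, fun e => h2.2 (h3.1.1 e)⟩

theorem indPath_replace_head {X : List V} {w w' : V} (h : IndPath G (w :: X))
    (hw : ∀ p ∈ X, (G.Adj w' p ↔ G.Adj w p) ∧ p ≠ w') : IndPath G (w' :: X) := by
  have h1 : IndPath G (X.reverse ++ [w]) := by simpa using h.reverse
  have h2 := indPath_replace_last (w' := w') h1 (fun p hp => by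
    have := hw p (by simpa using hp)
    exact ⟨by rw [SimpleGraph.adj_comm, this.1, SimpleGraph.adj_comm], this.2⟩)
  simpa using h2.reverse

/-- Stopping at the first vertex of `R` that sees `C` leaves a path with exactly one edge to `C`. -/
theorem exists_arm {C R : List V} (hex : ∃ w ∈ R, ∃ c ∈ C, G.Adj c w)
    (huniq : ∀ w ∈ R, ∀ c ∈ C, ∀ c' ∈ C, G.Adj c w → G.Adj c' w → c = c') :
    ∃ R₀ u T e, R = R₀ ++ u :: T ∧ e ∈ C ∧ G.Adj e u ∧
      ∀ w ∈ R₀ ++ [u], ∀ c ∈ C, G.Adj c w → c = e ∧ w = u := by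
  obtain ⟨R₀, u, T, rfl, ⟨e, he, eu⟩, hR⟩ := exists_first (p := fun w => ∃ c ∈ C, G.Adj c w) hex
  refine ⟨R₀, u, T, e, rfl, he, eu, ?_⟩
  intro w hw c hc ew
  rcases List.mem_append.1 hw with hw | hw
  · exact absurd ⟨c, hc, ew⟩ (hR w hw)
  · obtain rfl : w = u := by simpa using hw
    exact ⟨huniq w (by simp) c hc e he ew eu, rfl⟩

/-- The centre x provides two links to the hole and the truncated arm the third. -/
theorem one_arm (hT : TriFree G) (hI : ISK4Free G) {C R : List V} {x s₁ s₂ : V}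
    (hC : HoleL G C) (hx : x ∉ C) (h₁ : s₁ ∈ C) (h₂ : s₂ ∈ C) (h12 : s₁ ≠ s₂) (e₁ : G.Adj x s₁)
    (e₂ : G.Adj x s₂) (hs : ∀ s ∈ C, G.Adj x s → s = s₁ ∨ s = s₂)
    (hR : (x :: R).IsChain G.Adj) (hdis : ∀ w ∈ R, w ∉ C) (hex : ∃ w ∈ R, ∃ c ∈ C, G.Adj c w)
    (huniq : ∀ w ∈ R, ∀ c ∈ C, ∀ c' ∈ C, G.Adj c w → G.Adj c' w → c = c')
    (hne : ∀ w ∈ R, ∀ c ∈ C, G.Adj c w → c ≠ s₁ ∧ c ≠ s₂) : False := by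
  obtain ⟨R₀, u, T, e, rfl, he, eu, hu⟩ := exists_arm hex huniq
  have hD : Conn G {v | v ∈ x :: (R₀ ++ [u])} := conn_of_isChain (hR.infix ⟨[], T, by simp⟩)
  have hes := hne u (by simp) e he eu
  refine no_three_links hT hI hC hD ?_ h₁ h₂ he (a' := x) (b' := x) (c' := u) (by simp) (by simp)
    (by simp) h12 hes.1.symm hes.2.symm e₁.symm e₂.symm eu ?_
  · intro v hv hv'
    rcases List.mem_cons.1 hv' with rfl | hv'
    · exact hx hv
    · exact hdis v (by simp at hv' ⊢; tauto) hv
  · intro c hc v hv ev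
    rcases List.mem_cons.1 hv with rfl | hv
    · rcases hs c hc ev.symm with rfl | rfl
      · exact Or.inl ⟨rfl, rfl⟩
      · exact Or.inr (Or.inl ⟨rfl, rfl⟩)
    · exact Or.inr (Or.inr (hu v hv c hc ev))

/-- The spoke s and two arms ending at different vertices of `C` would be three links. So the
truncated arms end at a common vertex of `C`. -/
theorem two_arms (hT : TriFree G) (hI : ISK4Free G) {C R R' : List V} {x s : V}
    (hC : HoleL G C) (hx : x ∉ C) (h₁ : s ∈ C) (e₁ : G.Adj x s)
    (hs : ∀ t ∈ C, G.Adj x t → t = s)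
    (hR : (x :: R).IsChain G.Adj) (hdis : ∀ w ∈ R, w ∉ C) (hex : ∃ w ∈ R, ∃ c ∈ C, G.Adj c w)
    (huniq : ∀ w ∈ R, ∀ c ∈ C, ∀ c' ∈ C, G.Adj c w → G.Adj c' w → c = c')
    (hne : ∀ w ∈ R, ∀ c ∈ C, G.Adj c w → c ≠ s)
    (hR' : (x :: R').IsChain G.Adj) (hdis' : ∀ w ∈ R', w ∉ C)
    (hex' : ∃ w ∈ R', ∃ c ∈ C, G.Adj c w)
    (huniq' : ∀ w ∈ R', ∀ c ∈ C, ∀ c' ∈ C, G.Adj c w → G.Adj c' w → c = c')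
    (hne' : ∀ w ∈ R', ∀ c ∈ C, G.Adj c w → c ≠ s) :
    ∃ e ∈ C, (∃ u ∈ R, G.Adj e u) ∧ ∃ u ∈ R', G.Adj e u := by
  obtain ⟨R₀, u, T, e, rfl, he, eu, hu⟩ := exists_arm hex huniq
  obtain ⟨R₀', u', T', e', rfl, he', eu', hu'⟩ := exists_arm hex' huniq'
  by_cases hee : e = e'
  · subst hee
    exact ⟨e, he, ⟨u, by simp, eu⟩, u', by simp, eu'⟩
  have hD : Conn G ({v | v ∈ x :: (R₀ ++ [u])} ∪ {v | v ∈ x :: (R₀' ++ [u'])}) :=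
    (conn_of_isChain (hR.infix ⟨[], T, by simp⟩)).union
      (conn_of_isChain (hR'.infix ⟨[], T', by simp⟩)) (a := x) (b := x) (by simp) (by simp)
      (Or.inl rfl)
  have hes := hne u (by simp) e he eu
  have hes' := hne' u' (by simp) e' he' eu'
  refine (no_three_links hT hI hC hD ?_ h₁ he he' (a' := x) (b' := u) (c' := u') (by simp) (by simp)
    (by simp) hes.symm hes'.symm hee e₁.symm eu eu' ?_).elim
  · rintro v hv (hv' | hv') <;> rcases List.mem_cons.1 hv' with rfl | hv'
    · exact hx hv
    · exact hdis v (by simp at hv' ⊢; tauto) hv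
    · exact hx hv
    · exact hdis' v (by simp at hv' ⊢; tauto) hv
  · rintro c hc v (hv | hv) ev <;> rcases List.mem_cons.1 hv with rfl | hv
    · exact Or.inl ⟨hs c hc ev.symm, rfl⟩
    · exact Or.inr (Or.inl (hu v hv c hc ev))
    · exact Or.inl ⟨hs c hc ev.symm, rfl⟩
    · exact Or.inr (Or.inr (hu' v hv c hc ev))

/-- The standing assumptions on the wheel formed by `l` and `x`, where `W` restricts the vertices
of the paths that are considered. -/
structure Ctx (G : SimpleGraph V) (x : V) (W : Set V) (l : List V) : Prop where
  hole : HoleL G l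
  notMem : x ∉ l
  four : 4 ≤ cnt G x l
  min : ∀ E P, AG G x E P → cnt G x l ≤ cnt G x E
  good : ∀ c K d, Sec G x l c K d → ¬ Good G x (c :: K ++ [d]) →
    ∃ v, W = {v} ∧ Three G v (c :: K ++ [d])
  uniq : ∀ c K d c' K' d', Sec G x l c K d → Sec G x l c' K' d' → ¬ Good G x (c :: K ++ [d]) →
    ¬ Good G x (c' :: K' ++ [d']) → c :: K ++ [d] ⊆ c' :: K' ++ [d']

/-- `P` is a path outside the wheel that links the vertices `y` and `y'` of the hole, where both
arcs `A` and `B` between `y` and `y'` have a neighbour of `x` in their interior. -/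
structure Bad (G : SimpleGraph V) (x : V) (W : Set V) (l : List V) (y : V) (A : List V) (y' : V)
    (B P : List V) : Prop where
  rot : Rot l (y :: A ++ y' :: B)
  spokeA : ∃ v ∈ A, G.Adj x v
  spokeB : ∃ v ∈ B, G.Adj x v
  ne : P ≠ []
  out : ∀ v ∈ P, v ∈ W ∧ v ∉ l ∧ v ≠ x ∧ ¬ G.Adj x v
  chain : (y :: P ++ [y']).IsChain G.Adj

theorem Bad.reflect {x y y' : V} {W : Set V} {l A B P : List V} (h : Bad G x W l y A y' B P) :
    Bad G x W l y' A.reverse y B.reverse P.reverse where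
  rot := h.rot.reflect
  spokeA := by simpa using h.spokeA
  spokeB := by simpa using h.spokeB
  ne := by simpa using h.ne
  out := by simpa using h.out
  chain := by simpa using chain_reverse h.chain

/-- A shortest path as in `Bad`, with the arc `A` as short as possible. -/
structure MinBad (G : SimpleGraph V) (x : V) (W : Set V) (l : List V) (y : V) (A : List V) (y' : V)
    (B P : List V) : Prop where
  bad : Bad G x W l y A y' B P
  lenP : ∀ u X w Y Q, Bad G x W l u X w Y Q → P.length ≤ Q.length
  lenA : ∀ u X w Y Q, Bad G x W l u X w Y Q → Q.length ≤ P.length → A.length ≤ X.length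
  ind : IndPath G (y :: P ++ [y'])

theorem MinBad.reflect {x y y' : V} {W : Set V} {l A B P : List V}
    (h : MinBad G x W l y A y' B P) : MinBad G x W l y' A.reverse y B.reverse P.reverse where
  bad := h.bad.reflect
  lenP := by simpa using h.lenP
  lenA := by simpa using h.lenA
  ind := by simpa using h.ind.reverse

theorem HoleL.indPath_left {X Y : List V} (h : HoleL G (X ++ Y)) (hY : Y ≠ []) :
    IndPath G X := by
  have h := h.swap
  obtain ⟨a, Y, rfl⟩ := List.exists_cons_of_ne_nil hY
  obtain ⟨b, c, m, d, e, -, h1, -⟩ := h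
  obtain ⟨-, e⟩ := List.cons.inj e
  rw [← e] at h1
  exact h1.right

theorem Bad.nonempty {x y y' : V} {W : Set V} {l A B P : List V} (h : Bad G x W l y A y' B P) :
    A ≠ [] ∧ B ≠ [] := by
  obtain ⟨a, ha, -⟩ := h.spokeA
  obtain ⟨b, hb, -⟩ := h.spokeB
  exact ⟨List.ne_nil_of_mem ha, List.ne_nil_of_mem hb⟩

theorem Bad.glue {x y y' : V} {W : Set V} {l A B P : List V} (h : Bad G x W l y A y' B P)
    (hl : HoleL G l) :
    IndPath G (y :: A ++ [y']) ∧ IndPath G (y' :: B ++ [y]) ∧ NE G A B :=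
  (holeL_glue h.nonempty.1 h.nonempty.2).1 (h.rot.holeL hl)

theorem NE_of_indPath_cons {a : V} {X Y : List V} (h : IndPath G (a :: (X ++ Y))) (hX : X ≠ []) :
    NE G [a] Y := by
  obtain ⟨b, X, rfl⟩ := List.exists_cons_of_ne_nil hX
  exact h.2.1.mono (by simp) (by simp)

theorem indPath_of_ends {y y' s t : V} {L : List V} (h : IndPath G L)
    (hs : L.head? = some s) (ht : L.getLast? = some t) (es : G.Adj y s) (et : G.Adj y' t)
    (n1 : ∀ v ∈ L.tail, ¬ G.Adj y v) (n2 : ∀ v ∈ L.dropLast, ¬ G.Adj y' v) (hy : y ∉ L)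
    (hy' : y' ∉ L) (hne : NE G [y] [y']) : IndPath G (y :: L ++ [y']) := by
  have hL : L ≠ [] := by rintro rfl; simp at hs
  have h1 : IndPath G (L ++ [y']) := by
    obtain ⟨M, c, rfl⟩ : ∃ B' c, L = B' ++ [c] := ⟨_, _, (List.dropLast_append_getLast hL).symm⟩
    obtain rfl : c = t := by simpa using ht
    have : M ++ [c] ++ [y'] = M ++ c :: [y'] := by simp
    rw [this, indPath_append_cons]
    refine ⟨h, by simpa using et.symm, ?_⟩
    intro u hu v hv
    obtain rfl : v = y' := by simpa using hv
    exact ⟨by rintro rfl; simp [hu] at hy', fun e => n2 u (by simpa using hu) e.symm⟩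
  obtain ⟨p, M, rfl⟩ := List.exists_cons_of_ne_nil hL
  obtain rfl : p = s := by simpa using hs
  refine ⟨es, ?_, h1⟩
  rw [List.append_eq, NE_append_right]
  refine ⟨?_, hne⟩
  intro u hu v hv
  obtain rfl : u = y := by simpa using hu
  exact ⟨by rintro rfl; simp [hv] at hy, n1 v hv⟩

theorem Bad.exists_minBad {x y y' : V} {W : Set V} {l A B P : List V}
    (h : Bad G x W l y A y' B P) (hl : HoleL G l) :
    ∃ y A y' B P, MinBad G x W l y A y' B P := by
  classical
  have h1 : ∃ n y A y' B P, Bad G x W l y A y' B P ∧ P.length = n := ⟨_, y, A, y', B, P, h, rfl⟩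
  have h2 : ∃ m y A y' B P, Bad G x W l y A y' B P ∧ P.length = Nat.find h1 ∧ A.length = m := by
    obtain ⟨y, A, y', B, P, h, e⟩ := Nat.find_spec h1
    exact ⟨_, y, A, y', B, P, h, e, rfl⟩
  obtain ⟨y, A, y', B, P, h, e, e'⟩ := Nat.find_spec h2
  have k1 : ∀ u X w Y Q, Bad G x W l u X w Y Q → P.length ≤ Q.length := fun u X w Y Q hq => by
    rw [e]; exact Nat.find_min' h1 ⟨u, X, w, Y, Q, hq, rfl⟩
  have k2 : ∀ u X w Y Q, Bad G x W l u X w Y Q → Q.length ≤ P.length → A.length ≤ X.length := by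
    intro u X w Y Q hq hle
    rw [e']
    exact Nat.find_min' h2 ⟨u, X, w, Y, Q, hq, (le_antisymm hle (k1 _ _ _ _ _ hq)).trans e, rfl⟩
  have hch := h.chain
  obtain ⟨q, hq, eq⟩ := adj_of_chain_cons (u := y) h.ne (hch.infix ⟨[], [y'], by simp⟩)
  obtain ⟨q', hq', eq'⟩ := adj_of_chain_concat (u := y') h.ne (hch.infix ⟨[y], [], by simp⟩)
  obtain ⟨L, hL, hLi, hLP, ⟨s, es, hs⟩, ⟨t, et, ht⟩, hX, hY⟩ :=
    exists_indPath (D := {v | v ∈ P}) (X := {v | G.Adj y v}) (Y := {v | G.Adj y' v}) hq eq eq'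
      (conn_of_isChain (hch.infix ⟨[y], [y'], by simp⟩) q hq q' hq')
  have hlen : L.length ≤ P.length := (hLi.nodup.subperm hLP).length_le
  have hout : ∀ v ∈ L, v ∉ y :: A ++ y' :: B := fun v hv => by
    rw [← h.rot.mem_iff]; exact (h.out v (hLP v hv)).2.1
  have hyy : NE G [y] [y'] := NE_of_indPath_cons (h.glue hl).1 h.nonempty.1
  have hi := indPath_of_ends hLi hs ht es et hX hY (fun hm => hout y hm (by simp))
    (fun hm => hout y' hm (by simp)) hyy
  exact ⟨y, A, y', B, L, ⟨h.rot, h.spokeA, h.spokeB, hL, fun v hv => h.out v (hLP v hv),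
    hi.isChain⟩, fun u X w Y Q hQ => hlen.trans (k1 u X w Y Q hQ),
    fun u X w Y Q hQ hle => k2 u X w Y Q hQ (hle.trans hlen), hi⟩

/-- Two hole vertices with spokes inside both arcs between them, both attached to the chain M, make
M a competitor of P. -/
theorem MinBad.length_le {x y y' u w p q : V} {W : Set V} {l A B P X Y M : List V}
    (h : MinBad G x W l y A y' B P) (hr : Rot l (u :: X ++ w :: Y)) (hX : ∃ v ∈ X, G.Adj x v)
    (hY : ∃ v ∈ Y, G.Adj x v) (hM : M ⊆ P) (hc : M.IsChain G.Adj) (hp : p ∈ M) (hq : q ∈ M)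
    (ep : G.Adj u p) (eq : G.Adj w q) : P.length ≤ M.length := by
  obtain ⟨Q, h1, h2, h3, h4⟩ := exists_subchain hc hp hq ep eq
  exact (h.lenP u X w Y Q ⟨hr, hX, hY, h1, fun v hv => h.bad.out v (hM (h3 hv)), h4⟩).trans h2

/-- If there were a spoke between y and an attached vertex z of `A`, the pair y, z with an initial
part of P would be a bad path with a shorter arc; similarly for z and y'. As `A` contains a spoke, z
is the only one. -/
theorem MinBad.att {x y y' z p : V} {W : Set V} {l A₀ A₁ B P : List V}
    (h : MinBad G x W l y (A₀ ++ z :: A₁) y' B P) (hp : p ∈ P) (e : G.Adj z p) :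
    (∀ v ∈ A₀, ¬ G.Adj x v) ∧ (∀ v ∈ A₁, ¬ G.Adj x v) := by
  obtain ⟨P₀, P₁, rfl⟩ := List.append_of_mem hp
  obtain ⟨b, hb, eb⟩ := h.bad.spokeB
  have hch := h.bad.chain
  constructor
  · intro v hv ev
    have := h.lenA y A₀ z (A₁ ++ y' :: B) (P₀ ++ [p])
      ⟨by simpa using h.bad.rot, ⟨v, hv, ev⟩, ⟨b, by simp [hb], eb⟩, by simp,
        fun v hv => h.bad.out v (by simp at hv ⊢; tauto), by
          have h1 : (y :: P₀ ++ [p]).IsChain G.Adj := hch.infix ⟨[], P₁ ++ [y'], by simp⟩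
          have h2 : y :: (P₀ ++ [p]) ++ [z] = (y :: P₀) ++ p :: [z] := by simp
          rw [h2, List.isChain_split]
          exact ⟨h1, by simpa using e.symm⟩⟩ (by simp)
    simp at this
  · intro v hv ev
    have := h.lenA z A₁ y' (B ++ y :: A₀) (p :: P₁)
      ⟨by
        have h1 : Rot l ((y :: A₀) ++ (z :: A₁ ++ y' :: B)) := by simpa using h.bad.rot
        simpa using h1.swap, ⟨v, hv, ev⟩, ⟨b, by simp [hb], eb⟩, by simp,
        fun v hv => h.bad.out v (List.mem_append_right _ hv), by
          have h1 : (p :: P₁ ++ [y']).IsChain G.Adj := hch.infix ⟨y :: P₀, [], by simp⟩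
          exact List.isChain_cons_cons.2 ⟨e, h1⟩⟩ (by simp)
    simp at this; omega

/-- The pair y, u is still separated by spokes, in `A` on one side and in `T` on the other. So the
path from y to u cannot be shorter than P, and p is the last vertex of P. -/
theorem MinBad.attR {x y y' u p : V} {W : Set V} {l A R T P : List V}
    (h : MinBad G x W l y A y' (R ++ T) P) (hT : ∃ v ∈ T, G.Adj x v) (hu : u ∈ R) (hp : p ∈ P)
    (e : G.Adj u p) : G.Adj y' p := by
  obtain ⟨U₀, U₁, rfl⟩ := List.append_of_mem hu
  obtain ⟨P₀, P₁, rfl⟩ := List.append_of_mem hp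
  obtain ⟨a, ha, ea⟩ := h.bad.spokeA
  obtain ⟨t, ht, et⟩ := hT
  have hch := h.bad.chain
  have hch' : (y :: (P₀ ++ [p])).IsChain G.Adj := hch.infix ⟨[], P₁ ++ [y'], by simp⟩
  obtain ⟨q, hq, eq⟩ := adj_of_chain_cons (by simp) hch'
  have := h.length_le (u := y) (X := A ++ y' :: U₀) (w := u) (Y := U₁ ++ T) (M := P₀ ++ [p])
    (by simpa using h.bad.rot) ⟨a, by simp [ha], ea⟩ ⟨t, by simp [ht], et⟩
    (by intro v; simp; tauto) hch'.tail hq (by simp) eq e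
  have : P₁ = [] := by
    simp only [List.length_append, List.length_cons, List.length_nil] at this
    exact List.length_eq_zero_iff.1 (by omega)
  subst this
  have h3 : ([p, y']).IsChain G.Adj := hch.infix ⟨y :: P₀, [], by simp⟩
  simpa [SimpleGraph.adj_comm] using h3

theorem MinBad.attL {x y y' u p : V} {W : Set V} {l A L T P : List V}
    (h : MinBad G x W l y A y' (T ++ L) P) (hT : ∃ v ∈ T, G.Adj x v) (hu : u ∈ L) (hp : p ∈ P)
    (e : G.Adj u p) : G.Adj y p := by
  have h' := h.reflect
  rw [List.reverse_append] at h'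
  exact h'.attR (by simpa using hT) (by simpa using hu) (by simpa using hp) e

theorem MinBad.adj_unique {x y y' p q : V} {W : Set V} {l A B P : List V}
    (h : MinBad G x W l y A y' B P) (hp : p ∈ P) (hq : q ∈ P) (ep : G.Adj y p) (eq : G.Adj y q) :
    p = q := by
  have hi := h.ind
  cases P with
  | nil => simp at hp
  | cons a P =>
    have h1 : ∀ v ∈ a :: P, G.Adj y v → v = a := by
      intro v hv ev
      rcases List.mem_cons.1 hv with hv | hv
      · exact hv
      · exact absurd ev (hi.2.1 y (by simp) v (by simp [hv])).2
    rw [h1 p hp ep, h1 q hq eq]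

theorem MinBad.adj_unique' {x y y' p q : V} {W : Set V} {l A B P : List V}
    (h : MinBad G x W l y A y' B P) (hp : p ∈ P) (hq : q ∈ P) (ep : G.Adj y' p) (eq : G.Adj y' q) :
    p = q :=
  h.reflect.adj_unique (by simpa using hp) (by simpa using hq) ep eq

theorem MinBad.eq_singleton {x y y' v : V} {W : Set V} {l A B P : List V}
    (h : MinBad G x W l y A y' B P) (hv : v ∈ P) (e : G.Adj y v) (e' : G.Adj y' v) : P = [v] := by
  obtain ⟨S, T, rfl⟩ := List.append_of_mem hv
  have hi := h.ind
  have hS : S = [] := by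
    by_contra hS
    have : IndPath G (y :: (S ++ v :: (T ++ [y']))) := by simpa using hi
    exact (NE_of_indPath_cons this hS y (by simp) v (by simp)).2 e
  have hT : T = [] := by
    by_contra hT
    have : IndPath G (y' :: (T.reverse ++ v :: (S.reverse ++ [y]))) := by simpa using hi.reverse
    exact (NE_of_indPath_cons this (by simpa using hT) y' (by simp) v (by simp)).2 e'
  rw [hS, hT]; rfl

theorem MinBad.out {x y y' p : V} {W : Set V} {l A B P : List V}
    (h : MinBad G x W l y A y' B P) (hp : p ∈ P) : p ≠ y ∧ p ≠ y' ∧ p ∉ A ∧ p ∉ B := by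
  have := (h.bad.out p hp).2.1
  rw [h.bad.rot.mem_iff] at this
  simp at this; tauto

theorem MinBad.hole_of_not_att {x y y' : V} {W : Set V} {l A B P : List V}
    (h : MinBad G x W l y A y' B P) (hl : HoleL G l) (hA : ∀ z ∈ A, ∀ p ∈ P, ¬ G.Adj z p) :
    HoleL G (y :: A ++ y' :: P.reverse) := by
  refine (holeL_glue h.bad.nonempty.1 (by simpa using h.bad.ne)).2
    ⟨(h.bad.glue hl).1, by simpa using h.ind.reverse, ?_⟩
  rw [NE_reverse_right]
  exact fun z hz p hp => ⟨fun e => (h.out hp).2.2.1 (e ▸ hz), hA z hz p hp⟩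

/-- `R` is a path that starts at a neighbour of `x`, has an edge to `C`, and whose vertices have at
most one neighbour in `C`, which satisfies `Q`. -/
def Arm (G : SimpleGraph V) (x : V) (C R : List V) (Q : V → Prop) : Prop :=
  (x :: R).IsChain G.Adj ∧ (∀ w ∈ R, w ∉ C) ∧ (∃ w ∈ R, ∃ c ∈ C, G.Adj c w) ∧
    (∀ w ∈ R, ∀ c ∈ C, ∀ c' ∈ C, G.Adj c w → G.Adj c' w → c = c') ∧
    ∀ w ∈ R, ∀ c ∈ C, G.Adj c w → Q c

theorem Arm.congr {x : V} {C C' R : List V} {Q : V → Prop} (h : Arm G x C R Q)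
    (hC : ∀ v, v ∈ C' ↔ v ∈ C) : Arm G x C' R Q := by
  obtain ⟨h1, h2, h3, h4, h5⟩ := h
  refine ⟨h1, fun w hw => by rw [hC]; exact h2 w hw, ?_, ?_, ?_⟩
  · obtain ⟨w, hw, c, hc, e⟩ := h3
    exact ⟨w, hw, c, (hC c).2 hc, e⟩
  · intro w hw c hc c' hc'
    exact h4 w hw c ((hC c).1 hc) c' ((hC c').1 hc')
  · intro w hw c hc
    exact h5 w hw c ((hC c).1 hc)

/-- From the last spoke r' of the arc `B` the hole leads to y. By `MinBad.attL` this stretch sees P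
only in the neighbour of y on P, so its edges to the hole through `A` and P end at y or at that
neighbour. No vertex sees both, for lack of triangles. -/
theorem MinBad.armL (hT : TriFree G) {x y y' r' : V} {W : Set V} {l A T L P : List V}
    (h : MinBad G x W l y A y' (T ++ r' :: L) P) (hl : HoleL G l)
    (hsT : ∃ v ∈ T, G.Adj x v) (hr' : G.Adj x r') :
    Arm G x (y :: A ++ y' :: P.reverse) (r' :: L) (fun c => c = y ∨ (c ∈ P ∧ G.Adj y c)) := by
  have hnd := (h.bad.rot.holeL hl).nodup
  obtain ⟨iA, iB, nAB⟩ := h.bad.glue hl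
  have hT0 : T ≠ [] := by obtain ⟨t, ht, -⟩ := hsT; exact List.ne_nil_of_mem ht
  have hend : ∀ w ∈ r' :: L, ∀ c ∈ y :: A ++ y' :: P.reverse, G.Adj c w →
      c = y ∨ (c ∈ P ∧ G.Adj y c) := by
    intro w hw c hc e
    simp only [List.cons_append, List.mem_cons, List.mem_append, List.mem_reverse] at hc
    rcases hc with rfl | hc | rfl | hc
    · exact Or.inl rfl
    · exact absurd e (nAB c hc w (List.mem_append_right _ hw)).2
    · have : IndPath G (c :: (T ++ (r' :: L ++ [y]))) := by simpa using iB
      exact absurd e (NE_of_indPath_cons this hT0 c (by simp) w (List.mem_append_left _ hw)).2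
    · exact Or.inr ⟨hc, h.attL hsT hw hc e.symm⟩
  refine ⟨List.isChain_cons_cons.2 ⟨hr', ?_⟩, ?_, ?_, ?_, hend⟩
  · exact iB.isChain.infix ⟨y' :: T, [y], by simp⟩
  · intro w hw hc
    simp only [List.cons_append, List.mem_cons, List.mem_append, List.mem_reverse] at hc
    have hwB : w ∈ T ++ r' :: L := List.mem_append_right _ hw
    rcases hc with rfl | hc | rfl | hc
    · exact (List.nodup_cons.1 hnd).1 (List.mem_append_right A (List.mem_cons_of_mem _ hwB))
    · exact (nAB w hc w hwB).1 rfl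
    · exact (List.nodup_cons.1 iB.nodup).1 (List.mem_append_left _ hwB)
    · exact (h.out hc).2.2.2 hwB
  · obtain ⟨w, hw, e⟩ := adj_of_chain_concat (l := r' :: L) (u := y) (by simp)
      (iB.isChain.infix ⟨y' :: T, [], by simp⟩)
    exact ⟨w, hw, y, by simp, e⟩
  · intro w hw c hc c' hc' e e'
    rcases hend w hw c hc e with rfl | ⟨h1, h2⟩ <;> rcases hend w hw c' hc' e' with rfl | ⟨h3, h4⟩
    · rfl
    · exact absurd e (hT _ _ _ h4 e')
    · exact absurd e' (hT _ _ _ h2 e)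
    · exact h.adj_unique h1 h3 h2 h4

theorem MinBad.armR (hT : TriFree G) {x y y' r : V} {W : Set V} {l A T R P : List V}
    (h : MinBad G x W l y A y' (R ++ r :: T) P) (hl : HoleL G l)
    (hsT : ∃ v ∈ T, G.Adj x v) (hr : G.Adj x r) :
    Arm G x (y :: A ++ y' :: P.reverse) (r :: R.reverse)
      (fun c => c = y' ∨ (c ∈ P ∧ G.Adj y' c)) := by
  have h' := h.reflect
  have e : (R ++ r :: T).reverse = T.reverse ++ r :: R.reverse := by simp
  rw [e] at h'
  have := h'.armL hT hl (by simpa using hsT) hr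
  simp only [List.mem_reverse] at this
  exact this.congr (by intro v; simp; tauto)

/-- A sector is closed to a hole by x. Since x has at least three neighbours on `l`, the sector is
not the whole cycle, and its interior is nonempty because the two spokes would otherwise form a
triangle. -/
theorem Sec.hole (hT : TriFree G) {x c d : V} {l K : List V} (h : Sec G x l c K d)
    (hl : HoleL G l) (hx : x ∉ l) (h3 : 3 ≤ cnt G x l) : HoleL G (c :: K ++ d :: [x]) := by
  obtain ⟨hc, hd, hK, Q, hr⟩ := h
  have hQ : Q ≠ [] := by
    rintro rfl
    have h1 := hr.cnt_eq (G := G) (x := x)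
    have h2 : cnt G x (c :: K ++ [d]) ≤ 2 := by
      have := cnt_singleton_le (G := G) (x := x) (a := c)
      have := cnt_singleton_le (G := G) (x := x) (a := d)
      rw [cnt_append, cnt_cons, cnt_eq_zero.2 hK]; omega
    omega
  have hi : IndPath G (c :: K ++ [d]) := by
    have : HoleL G ((c :: K ++ [d]) ++ Q) := by simpa using hr.holeL hl
    exact this.indPath_left hQ
  have hK0 : K ≠ [] := by
    rintro rfl
    exact hT _ _ _ hc (by simpa using hi) hd
  have hcd : c ≠ d := by
    rintro rfl
    have := hi.nodup
    simp at this
  refine (holeL_glue hK0 (by simp)).2 ⟨hi, ⟨hd.symm, ?_, by simpa using hc⟩, ?_⟩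
  · intro u hu v hv
    obtain rfl : u = d := by simpa using hu
    obtain rfl : v = c := by simpa using hv
    exact ⟨hcd.symm, fun e => hT _ _ _ hd e hc⟩
  · intro u hu v hv
    obtain rfl : v = x := by simpa using hv
    exact ⟨fun e => hx (by rw [hr.mem_iff, ← e]; simp [hu]), fun e => hK u hu e.symm⟩

/-- The hole is the sector from r' to s closed by x. The connected set is v with the stretch of the
old hole from w to r. Its links are vy, vu and rx; v has no third neighbour in the sector because
the sector is good. -/
theorem MinBad.case_single (hT : TriFree G) (hI : ISK4Free G) {x y y' v s r r' u w : V} {W : Set V}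
    {l A₀ A₁ B₀ B₁ B₂ : List V} (hC : Ctx G x W l)
    (h : MinBad G x W l y (A₀ ++ s :: A₁) y' (B₀ ++ r :: (B₁ ++ r' :: B₂)) [v])
    (hu : u ∈ r' :: B₂) (eu : G.Adj u v) (hw : w ∈ B₀ ++ [r]) (ew : G.Adj w v)
    (hs : G.Adj x s) (hr : G.Adj x r) (hr' : G.Adj x r') (fB₀ : ∀ v ∈ B₀, ¬ G.Adj x v)
    (fB₂ : ∀ v ∈ B₂, ¬ G.Adj x v) (fA₀ : ∀ v ∈ A₀, ¬ G.Adj x v) (hy : ¬ G.Adj x y)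
    (hg : Good G x (r' :: (B₂ ++ y :: A₀) ++ [s])) : False := by
  obtain ⟨iA, iB, nAB⟩ := h.bad.glue hC.hole
  have hv := h.bad.out v (by simp)
  have hvo := h.out (p := v) (by simp)
  have hyv : G.Adj y v := by
    have := h.bad.chain
    simp at this; exact this.1
  have hrot : Rot l (r' :: (B₂ ++ y :: A₀) ++ s :: (A₁ ++ y' :: (B₀ ++ r :: B₁))) := by
    have h1 : Rot l ((y :: (A₀ ++ s :: A₁) ++ y' :: (B₀ ++ r :: B₁)) ++ (r' :: B₂)) := by
      simpa using h.bad.rot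
    simpa using h1.swap
  have hsec : Sec G x l r' (B₂ ++ y :: A₀) s := by
    refine ⟨hr', hs, ?_, _, hrot⟩
    intro t ht
    simp only [List.mem_append, List.mem_cons] at ht
    rcases ht with ht | rfl | ht
    exacts [fB₂ t ht, hy, fA₀ t ht]
  have hhole := hsec.hole hT hC.hole hC.notMem (by have := hC.four; omega)
  have n1 : NE G (y' :: B₀) (B₁ ++ r' :: (B₂ ++ [y])) := by
    have : IndPath G ((y' :: B₀) ++ r :: (B₁ ++ r' :: (B₂ ++ [y]))) := by simpa using iB
    exact this.ne
  have n2 : NE G (y' :: B₀ ++ r :: B₁) (B₂ ++ [y]) := by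
    have : IndPath G ((y' :: B₀ ++ r :: B₁) ++ r' :: (B₂ ++ [y])) := by simpa using iB
    exact this.ne
  have hrr : r ≠ r' := by
    have := iB.nodup
    rintro rfl
    simp at this; grind
  have n3 : NE G (B₀ ++ [r]) (r' :: (B₂ ++ y :: A₀) ++ [s]) := by
    intro a ha b hb
    have hb : b ∈ r' :: (B₂ ++ [y]) ∨ b ∈ A₀ ++ s :: A₁ := by
      simp at hb ⊢; tauto
    rcases hb with hb | hb
    · rcases List.mem_append.1 ha with ha | ha
      · exact n1 a (List.mem_cons_of_mem _ ha) b (List.mem_append_right _ hb)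
      · obtain rfl : a = r := by simpa using ha
        rcases List.mem_cons.1 hb with rfl | hb
        · exact ⟨hrr, fun e => hT _ _ _ hr e hr'⟩
        · exact n2 a (by simp) b hb
    · have := nAB b hb a (by simp at ha ⊢; tauto)
      exact ⟨this.1.symm, fun e => this.2 e.symm⟩
  obtain ⟨U₀, U₁, hU⟩ := List.append_of_mem hw
  have hUsub : ∀ t ∈ w :: U₁, t ∈ B₀ ++ [r] := fun t ht => by rw [hU]; exact List.mem_append_right _ ht
  have hrU : r ∈ w :: U₁ := by
    have : (B₀ ++ [r]).getLast? = some r := by simp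
    rw [hU, getLast?_append_cons] at this
    exact List.mem_of_mem_getLast? this
  have hD : Conn G {t | t ∈ v :: w :: U₁} := by
    refine conn_of_isChain (List.isChain_cons_cons.2 ⟨ew.symm, ?_⟩)
    have : (B₀ ++ [r]).IsChain G.Adj := iB.isChain.infix ⟨[y'], B₁ ++ r' :: B₂ ++ [y], by simp⟩
    rw [hU] at this
    exact this.infix ⟨U₀, [], by simp⟩
  have huy : u ≠ y := by
    rintro rfl
    have := iB.nodup
    simp at this hu; grind
  have huS : u ∈ r' :: (B₂ ++ y :: A₀) ++ [s] := by simp at hu ⊢; tauto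
  have hmem : ∀ t, t ∈ r' :: (B₂ ++ y :: A₀) ++ s :: [x] ↔ t ∈ r' :: (B₂ ++ y :: A₀) ++ [s] ∨ t = x := by
    intro t; simp; tauto
  have hxl : ∀ t ∈ r' :: (B₂ ++ y :: A₀) ++ [s], t ∈ l := by
    intro t ht
    rw [hrot.mem_iff]; simp at ht ⊢; tauto
  have hxU : ∀ t ∈ w :: U₁, t ∈ l := by
    intro t ht
    rw [h.bad.rot.mem_iff]
    have := hUsub t ht
    simp at this ⊢; tauto
  refine no_three_links hT hI hhole hD ?_ (a := y) (b := u) (c := x) (a' := v) (b' := v) (c' := r)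
    (by simp) ((hmem u).2 (Or.inl huS)) (by simp) (by simp) (by simp)
    (List.mem_cons_of_mem _ hrU) huy.symm ?_ ?_ hyv eu hr ?_
  · intro t ht ht'
    rcases List.mem_cons.1 ht' with rfl | ht'
    · rcases (hmem t).1 ht with h1 | h1
      · exact hv.2.1 (hxl t h1)
      · exact hv.2.2.1 h1
    · rcases (hmem t).1 ht with h1 | rfl
      · exact (n3 t (hUsub t ht') t h1).1 rfl
      · exact hC.notMem (hxU t ht')
  · rintro rfl; exact hC.notMem (hxl y (by simp))
  · rintro rfl; exact hC.notMem (hxl u huS)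
  · intro a ha b hb e
    rcases (hmem a).1 ha with ha | rfl
    · rcases List.mem_cons.1 hb with rfl | hb
      · by_cases h1 : a = y
        · exact Or.inl ⟨h1, rfl⟩
        by_cases h2 : a = u
        · exact Or.inr (Or.inl ⟨h2, rfl⟩)
        exact absurd ⟨a, ha, y, by simp, u, huS, h1, h2, huy.symm, e.symm, hyv.symm, eu.symm⟩
          (hg b hv.2.2.1 hv.2.2.2)
      · exact absurd e.symm (n3 b (hUsub b hb) a ha).2
    · rcases List.mem_cons.1 hb with rfl | hb
      · exact absurd e hv.2.2.2
      · rcases List.mem_append.1 (hUsub b hb) with h1 | h1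
        · exact absurd e (fB₀ b h1)
        · exact Or.inr (Or.inr ⟨rfl, by simpa using h1⟩)

/-- A bad sector requires `W` to be a single vertex, which is then a vertex of P with three
neighbours in the sector. This fails along any stretch on which P sees at most two vertices. The
sector condition of `AG` for the new holes is verified in this way. -/
theorem Ctx.good_of_two {x y y' : V} {W : Set V} {l A B P E : List V} (hC : Ctx G x W l)
    (h : MinBad G x W l y A y' B P) {l' : List V} (hr : Rot l l') (hE : E <:+: l') {p q : V}
    (ha : ∀ v ∈ P, ∀ z ∈ E, G.Adj v z → z = p ∨ z = q) {c d : V} {K : List V}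
    (hi : c :: K ++ [d] <:+: E) (hc : G.Adj x c) (hd : G.Adj x d) (hK : ∀ v ∈ K, ¬ G.Adj x v) :
    Good G x (c :: K ++ [d]) := by
  by_contra hng
  obtain ⟨v, rfl, hv⟩ := hC.good c K d (Sec.of_infix hr (hi.trans hE) hc hd hK) hng
  obtain ⟨p', hp'⟩ := List.exists_mem_of_ne_nil _ h.bad.ne
  obtain rfl : p' = v := (h.bad.out p' hp').1
  exact hv.false_of_two (fun a ha' e => ha p' hp' a (hi.subset ha') e)

/-- With three spokes on y A y', the hole formed by this arc and P would be an `AG` wheel without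
the spokes inside `B`, contrary to the choice of the wheel. -/
theorem MinBad.cnt_le_two {x y y' : V} {W : Set V} {l A B P : List V} (hC : Ctx G x W l)
    (h : MinBad G x W l y A y' B P) (hA : ∀ z ∈ A, ∀ p ∈ P, ¬ G.Adj z p) :
    cnt G x (y :: A ++ [y']) ≤ 2 := by
  by_contra hcon
  have hhole := h.hole_of_not_att hC.hole hA
  have hag : AG G x (y :: A ++ [y']) P.reverse := by
    refine ⟨by simpa using hhole, ?_, ?_, by omega, ?_⟩
    · intro hx
      simp only [List.cons_append, List.mem_append, List.mem_cons, List.mem_reverse] at hx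
      have hx' : x ∉ y :: A ++ y' :: B := by rw [← h.bad.rot.mem_iff]; exact hC.notMem
      rcases hx with hx | (hx | hx | hx) | hx
      · exact hx' (by simp [hx])
      · exact hx' (by simp [hx])
      · exact hx' (by simp [hx])
      · simp at hx
      · exact (h.bad.out x hx).2.2.1 rfl
    · intro v hv
      exact (h.bad.out v (List.mem_reverse.1 hv)).2.2.2
    · intro c K d hi hc hd hK
      refine hC.good_of_two h h.bad.rot (E := y :: A ++ [y']) (p := y) (q := y')
        ⟨[], B, by simp⟩ ?_ hi hc hd hK
      intro v hv z hz e
      simp only [List.cons_append, List.mem_append, List.mem_cons, List.not_mem_nil, or_false] at hz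
      rcases hz with hz | hz | hz
      · exact Or.inl hz
      · exact absurd e.symm (hA z hz v hv)
      · exact Or.inr hz
  have h1 := hC.min _ _ hag
  rw [h.bad.rot.cnt_eq] at h1
  have h2 := cnt_pos.2 h.bad.spokeB
  have e : cnt G x (y :: A ++ y' :: B) = cnt G x (y :: A ++ [y']) + cnt G x B := by
    rw [← cnt_append]; simp
  omega

-- The arc y A y' has at most two spokes, so `B` has at least two. From the first and the last spoke
-- of `B`, arms run back to y' and on to y. Two spokes on y A y' and a suitable arm contradict
-- `one_arm`. With a single spoke s, `two_arms` makes both arms end at the same vertex, which forces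
-- P to be one vertex, the case of `MinBad.case_single`.
set_option maxHeartbeats 400000 in
theorem MinBad.false_of_not_att (hT : TriFree G) (hI : ISK4Free G) {x y y' : V} {W : Set V}
    {l A B P : List V} (hC : Ctx G x W l) (h : MinBad G x W l y A y' B P)
    (hA : ∀ z ∈ A, ∀ p ∈ P, ¬ G.Adj z p) : False := by
  have h2 := h.cnt_le_two hC hA
  have hhole := h.hole_of_not_att hC.hole hA
  have hcB : 2 ≤ cnt G x B := by
    have h4 := hC.four
    rw [h.bad.rot.cnt_eq] at h4
    have e : cnt G x (y :: A ++ y' :: B) = cnt G x (y :: A ++ [y']) + cnt G x B := by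
      rw [← cnt_append]; simp
    omega
  obtain ⟨B₀, r, B', rfl, hr, fB₀⟩ := exists_first (p := G.Adj x) h.bad.spokeB
  have hB' : 0 < cnt G x B' := by
    rw [cnt_append, cnt_cons, cnt_singleton_of_adj hr, cnt_eq_zero.2 fB₀] at hcB; omega
  obtain ⟨B₁, r', B₂, rfl, hr', fB₂⟩ := exists_last (p := G.Adj x) (cnt_pos.1 hB')
  obtain ⟨A₀, s, A₁, rfl, hs, fA₀⟩ := exists_first (p := G.Adj x) h.bad.spokeA
  have hP : ∀ c ∈ P, ¬ G.Adj x c := fun c hc => (h.bad.out c hc).2.2.2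
  have armR := h.armR hT hC.hole ⟨r', by simp, hr'⟩ hr
  have armL : Arm G x (y :: (A₀ ++ s :: A₁) ++ y' :: P.reverse) (r' :: B₂)
      (fun c => c = y ∨ (c ∈ P ∧ G.Adj y c)) := by
    have e : B₀ ++ r :: (B₁ ++ r' :: B₂) = (B₀ ++ r :: B₁) ++ r' :: B₂ := by simp
    rw [e] at h
    exact h.armL hT hC.hole ⟨r, by simp, hr⟩ hr'
  have hxC : x ∉ y :: (A₀ ++ s :: A₁) ++ y' :: P.reverse := by
    intro hx
    have hx' := hC.notMem
    rw [h.bad.rot.mem_iff] at hx'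
    have hxP : x ∉ P := fun hx => (h.bad.out x hx).2.2.1 rfl
    simp only [List.cons_append, List.mem_append, List.mem_cons, List.mem_reverse] at hx hx'
    tauto
  have hmem : ∀ t ∈ y :: (A₀ ++ s :: A₁) ++ y' :: P.reverse, G.Adj x t →
      t = y ∨ t = s ∨ t ∈ A₁ ∨ t = y' := by
    intro t ht e
    simp only [List.cons_append, List.mem_append, List.mem_cons, List.mem_reverse] at ht
    rcases ht with ht | (ht | ht | ht) | ht | ht
    · exact Or.inl ht
    · exact absurd e (fA₀ t ht)
    · exact Or.inr (Or.inl ht)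
    · exact Or.inr (Or.inr (Or.inl ht))
    · exact Or.inr (Or.inr (Or.inr ht))
    · exact absurd e (hP t ht)
  -- Besides s at most one spoke remains: inside A₁, at y, at y', or nowhere. These are the four
  -- cases below.
  have e2 : cnt G x [y] + cnt G x A₁ + cnt G x [y'] ≤ 1 := by
    rw [List.cons_append, cnt_cons, cnt_append, cnt_append, cnt_cons (a := s),
      cnt_singleton_of_adj hs] at h2
    omega
  have sy := fun h => cnt_singleton_of_adj (G := G) (x := x) (a := y) h
  have sy' := fun h => cnt_singleton_of_adj (G := G) (x := x) (a := y') h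
  have hnd := (h.bad.rot.holeL hC.hole).nodup
  by_cases hA₁ : ∃ t ∈ A₁, G.Adj x t
  · have p1 := cnt_pos.2 hA₁
    have ny : ¬ G.Adj x y := fun h => by have := sy h; omega
    have ny' : ¬ G.Adj x y' := fun h => by have := sy' h; omega
    obtain ⟨X, s₂, Y, rfl, hs₂, fX⟩ := exists_first (p := G.Adj x) hA₁
    have fY : ∀ t ∈ Y, ¬ G.Adj x t := by
      rw [cnt_append, cnt_cons (a := s₂), cnt_singleton_of_adj hs₂] at e2
      exact cnt_eq_zero.1 (by omega)
    have hss : s ≠ s₂ := by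
      rintro rfl
      simp at hnd; grind
    refine one_arm hT hI hhole hxC (s₁ := s) (s₂ := s₂) (by simp) (by simp) hss hs hs₂ ?_ armL.1
      armL.2.1 armL.2.2.1 armL.2.2.2.1 ?_
    · intro t ht e
      rcases hmem t ht e with rfl | ht | ht | rfl
      · exact absurd e ny
      · exact Or.inl ht
      · simp only [List.mem_append, List.mem_cons] at ht
        rcases ht with ht | ht | ht
        · exact absurd e (fX t ht)
        · exact Or.inr ht
        · exact absurd e (fY t ht)
      · exact absurd e ny'
    · intro w hw c hc e
      have hc' : ¬ G.Adj x c := by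
        rcases armL.2.2.2.2 w hw c hc e with rfl | ⟨hc, -⟩
        · exact ny
        · exact hP c hc
      exact ⟨by rintro rfl; exact hc' hs, by rintro rfl; exact hc' hs₂⟩
  · push Not at hA₁
    have hys : y ≠ s := by rintro rfl; simp at hnd
    have hys' : y' ≠ s := by rintro rfl; simp at hnd; grind
    by_cases hy : G.Adj x y
    · have ny' : ¬ G.Adj x y' := fun h => by have := sy' h; have := sy hy; omega
      refine one_arm hT hI hhole hxC (s₁ := y) (s₂ := s) (by simp) (by simp) hys hy hs ?_ armR.1
        armR.2.1 armR.2.2.1 armR.2.2.2.1 ?_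
      · intro t ht e
        rcases hmem t ht e with ht | ht | ht | rfl
        · exact Or.inl ht
        · exact Or.inr ht
        · exact absurd e (hA₁ t ht)
        · exact absurd e ny'
      · intro w hw c hc e
        have hc' : ¬ G.Adj x c := by
          rcases armR.2.2.2.2 w hw c hc e with rfl | ⟨hc, -⟩
          · exact ny'
          · exact hP c hc
        exact ⟨by rintro rfl; exact hc' hy, by rintro rfl; exact hc' hs⟩
    by_cases hy' : G.Adj x y'
    · refine one_arm hT hI hhole hxC (s₁ := y') (s₂ := s) (by simp) (by simp) hys' hy' hs ?_ armL.1
        armL.2.1 armL.2.2.1 armL.2.2.2.1 ?_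
      · intro t ht e
        rcases hmem t ht e with rfl | ht | ht | ht
        · exact absurd e hy
        · exact Or.inr ht
        · exact absurd e (hA₁ t ht)
        · exact Or.inl ht
      · intro w hw c hc e
        have hc' : ¬ G.Adj x c := by
          rcases armL.2.2.2.2 w hw c hc e with rfl | ⟨hc, -⟩
          · exact hy
          · exact hP c hc
        exact ⟨by rintro rfl; exact hc' hy', by rintro rfl; exact hc' hs⟩
    have hcl : ∀ {c z : V}, ¬ G.Adj x z → c = z ∨ (c ∈ P ∧ G.Adj z c) → c ≠ s := by
      rintro c z hz (rfl | ⟨hc, -⟩) rfl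
      · exact hz hs
      · exact hP _ hc hs
    obtain ⟨e, he, ⟨u, hu, eu⟩, w, hw, ew⟩ := two_arms hT hI hhole hxC (s := s) (by simp) hs
      (fun t ht e => by
        rcases hmem t ht e with rfl | ht | ht | rfl
        · exact absurd e hy
        · exact ht
        · exact absurd e (hA₁ t ht)
        · exact absurd e hy')
      armL.1 armL.2.1 armL.2.2.1 armL.2.2.2.1
      (fun w hw c hc e => hcl hy (armL.2.2.2.2 w hw c hc e))
      armR.1 armR.2.1 armR.2.2.1 armR.2.2.2.1
      (fun w hw c hc e => hcl hy' (armR.2.2.2.2 w hw c hc e))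
    -- One arm ends at y or at its neighbour on P, the other at y' or at its neighbour on P. A
    -- common end is thus a vertex of P adjacent to both y and y', so it is all of P.
    have hne := (h.bad.glue hC.hole).1.nodup
    have hyy : y ≠ y' := by rintro rfl; simp at hne
    have hyn : ∀ p ∈ P, p ≠ y ∧ p ≠ y' := fun p hp => ⟨(h.out hp).1, (h.out hp).2.1⟩
    obtain ⟨heP, e1, e2⟩ : e ∈ P ∧ G.Adj y e ∧ G.Adj y' e := by
      rcases armL.2.2.2.2 u hu e he eu with rfl | ⟨h1, h2⟩ <;>
        rcases armR.2.2.2.2 w hw e he ew with rfl | ⟨h3, h4⟩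
      · exact absurd rfl hyy
      · exact absurd rfl (hyn _ h3).1
      · exact absurd rfl (hyn _ h1).2
      · exact ⟨h1, h2, h4⟩
    obtain rfl := h.eq_singleton heP e1 e2
    have hw' : w ∈ B₀ ++ [r] := by simp at hw ⊢; tauto
    -- Two sectors end at s. They are different, so at most one of them is bad, and reflection
    -- exchanges their roles.
    by_cases hg : Good G x (r' :: (B₂ ++ y :: A₀) ++ [s])
    · exact h.case_single hT hI hC hu eu.symm hw' ew.symm hs hr hr' fB₀ fB₂ fA₀ hy hg
    have hrot : Rot l (y :: (A₀ ++ s :: A₁) ++ y' :: (B₀ ++ r :: (B₁ ++ r' :: B₂))) := h.bad.rot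
    have hrot' : Rot l (r' :: (B₂ ++ y :: A₀) ++ s :: (A₁ ++ y' :: (B₀ ++ r :: B₁))) := by
      have h1 : Rot l ((y :: (A₀ ++ s :: A₁) ++ y' :: (B₀ ++ r :: B₁)) ++ (r' :: B₂)) := by
        simpa using hrot
      simpa using h1.swap
    have sec1 : Sec G x l r' (B₂ ++ y :: A₀) s := by
      refine ⟨hr', hs, ?_, A₁ ++ y' :: (B₀ ++ r :: B₁), hrot'⟩
      intro t ht
      simp only [List.mem_append, List.mem_cons] at ht
      rcases ht with ht | rfl | ht
      exacts [fB₂ t ht, hy, fA₀ t ht]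
    have sec2 : Sec G x l r (B₀.reverse ++ y' :: A₁.reverse) s := by
      refine ⟨hr, hs, ?_, A₀.reverse ++ y :: (B₂.reverse ++ r' :: B₁.reverse), ?_⟩
      · intro t ht
        simp only [List.mem_append, List.mem_cons, List.mem_reverse] at ht
        rcases ht with ht | rfl | ht
        exacts [fB₀ t ht, hy', hA₁ t ht]
      · have h1 : Rot l ((y' :: (A₁.reverse ++ s :: A₀.reverse) ++
            y :: (B₂.reverse ++ r' :: B₁.reverse)) ++ (r :: B₀.reverse)) := by
          simpa using hrot.reflect
        simpa using h1.swap
    have hg2 : Good G x (r :: (B₀.reverse ++ y' :: A₁.reverse) ++ [s]) := by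
      by_contra hg2
      have := hC.uniq _ _ _ _ _ _ sec1 sec2 hg hg2 (List.mem_cons_self)
      refine (List.nodup_cons.1 (hrot'.holeL hC.hole).nodup).1 ?_
      simp only [List.cons_append, List.mem_append, List.mem_cons, List.mem_reverse,
        List.not_mem_nil, or_false] at this ⊢
      have hrr : r' ≠ r := by
        have := (hrot'.holeL hC.hole).nodup
        rintro rfl
        simp at this
      rcases this with h1 | (h1 | h1 | h1) | h1
      · exact absurd h1 hrr
      · simp [h1]
      · simp [h1]
      · simp [h1]
      · simp [h1]
    have h' := h.reflect
    have e3 : (A₀ ++ s :: A₁).reverse = A₁.reverse ++ s :: A₀.reverse := by simp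
    have e4 : (B₀ ++ r :: (B₁ ++ r' :: B₂)).reverse =
      B₂.reverse ++ r' :: (B₁.reverse ++ r :: B₀.reverse) := by simp
    rw [e3, e4] at h'
    exact h'.case_single hT hI hC (u := w) (w := u) hw ew.symm (by simp at hu ⊢; tauto) eu.symm hs
      hr' hr (by simpa using fB₂) (by simpa using fB₀) (by simpa using hA₁) hy' hg2

/-- The first spoke r met from y' on, with y' itself counted. If y' is a spoke, then R is empty and
r = y'; the form y' :: R = R₀ ++ [r] covers both cases. -/
theorem exists_right_arm {x y' : V} {B : List V} (h : 0 < cnt G x [y'] + cnt G x B) :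
    ∃ R T R₀ r, B = R ++ T ∧ y' :: R = R₀ ++ [r] ∧ (∀ v ∈ R₀, ¬ G.Adj x v) ∧ G.Adj x r ∧
      cnt G x T + 1 = cnt G x [y'] + cnt G x B := by
  by_cases hy : G.Adj x y'
  · exact ⟨[], B, [], y', rfl, rfl, by simp, hy, by rw [cnt_singleton_of_adj hy, Nat.add_comm]⟩
  · have h0 := cnt_singleton_of_not_adj hy
    have hB : 0 < cnt G x B := by omega
    obtain ⟨B₀, r, T, rfl, hr, fB⟩ := exists_first (p := G.Adj x) (cnt_pos.1 hB)
    refine ⟨B₀ ++ [r], T, y' :: B₀, r, by simp, by simp, ?_, hr, ?_⟩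
    · intro v hv
      rcases List.mem_cons.1 hv with rfl | hv
      exacts [hy, fB v hv]
    · rw [h0, cnt_append, cnt_cons (a := r), cnt_singleton_of_adj hr, cnt_eq_zero.2 fB]
      omega

theorem MinBad.rot_arm {x y y' z r : V} {W : Set V} {l A₀ A₁ R R₀ T P : List V}
    (h : MinBad G x W l y (A₀ ++ z :: A₁) y' (R ++ T) P) (hR : y' :: R = R₀ ++ [r]) :
    Rot l (z :: (A₁ ++ R₀) ++ r :: (T ++ y :: A₀)) := by
  have h1 : Rot l ((y :: A₀) ++ (z :: A₁ ++ ((y' :: R) ++ T))) := by simpa using h.bad.rot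
  rw [hR] at h1
  simpa using h1.swap

theorem MinBad.not_att {x y y' z : V} {W : Set V} {l A₀ A₁ B P : List V}
    (h : MinBad G x W l y (A₀ ++ z :: A₁) y' B P) (hz : G.Adj x z) :
    (∀ t ∈ A₀, ∀ p ∈ P, ¬ G.Adj t p) ∧ (∀ t ∈ A₁, ∀ p ∈ P, ¬ G.Adj t p) := by
  constructor
  · intro t ht p hp e
    obtain ⟨X, Y, rfl⟩ := List.append_of_mem ht
    have e1 : X ++ t :: Y ++ z :: A₁ = X ++ t :: (Y ++ z :: A₁) := by simp
    rw [e1] at h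
    exact (h.att hp e).2 z (by simp) hz
  · intro t ht p hp e
    obtain ⟨X, Y, rfl⟩ := List.append_of_mem ht
    have e1 : A₀ ++ z :: (X ++ t :: Y) = (A₀ ++ z :: X) ++ t :: Y := by simp
    rw [e1] at h
    exact (h.att hp e).1 z (by simp) hz

theorem MinBad.ne_arm {x y y' : V} {W : Set V} {l A R T P : List V}
    (h : MinBad G x W l y A y' (R ++ T) P) (hl : HoleL G l) (hT : T ≠ []) :
    NE G (y' :: R) [y] := by
  obtain ⟨f, T, rfl⟩ := List.exists_cons_of_ne_nil hT
  have : IndPath G ((y' :: R) ++ f :: (T ++ [y])) := by simpa using (h.bad.glue hl).2.1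
  exact this.ne.mono (by simp) (by simp)

theorem MinBad.att_arm {x y y' u p : V} {W : Set V} {l A R T P : List V}
    (h : MinBad G x W l y A y' (R ++ T) P) (hT : ∃ v ∈ T, G.Adj x v) (hu : u ∈ y' :: R)
    (hp : p ∈ P) (e : G.Adj u p) : G.Adj y' p := by
  rcases List.mem_cons.1 hu with rfl | hu
  · exact e
  · exact h.attR hT hu hp e

theorem MinBad.exists_adj' {x y y' : V} {W : Set V} {l A B P : List V}
    (h : MinBad G x W l y A y' B P) : ∃ p ∈ P, G.Adj y' p :=
  adj_of_chain_concat h.bad.ne (h.bad.chain.infix ⟨[y], [], by simp⟩)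

/-- Since z has the same neighbours on P as y', it can replace y' as an end of the induced path
through P. -/
theorem MinBad.hole_left {x y y' z : V} {W : Set V} {l A₀ A₁ B P : List V}
    (h : MinBad G x W l y (A₀ ++ z :: A₁) y' B P) (hl : HoleL G l) (hz : G.Adj x z)
    (hyz : ¬ G.Adj y z) (hq : ∃ q ∈ P, G.Adj z q) (hzq : ∀ p ∈ P, G.Adj z p → G.Adj y' p) :
    HoleL G (y :: A₀ ++ z :: P.reverse) := by
  obtain ⟨iA, -, -⟩ := h.bad.glue hl
  have hA₀ : A₀ ≠ [] := by
    rintro rfl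
    exact hyz iA.1
  have iA' : IndPath G ((y :: A₀ ++ [z]) ++ (A₁ ++ [y'])) := by simpa using iA
  refine (holeL_glue hA₀ (by simpa using h.bad.ne)).2 ⟨iA'.left, ?_, ?_⟩
  · have : IndPath G (y :: P ++ [z]) := by
      refine indPath_replace_last h.ind ?_
      intro p hp
      have hnd := iA.nodup
      rcases List.mem_cons.1 hp with rfl | hp
      · have hyy : ¬ G.Adj p y' := (NE_of_indPath_cons iA (by simp) p (by simp) y' (by simp)).2
        refine ⟨by tauto, ?_⟩
        rintro rfl; simp at hnd
      · refine ⟨⟨fun e => (hzq p hp e.symm).symm, fun e => ?_⟩, ?_⟩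
        · obtain ⟨q, hq, e'⟩ := hq
          rw [h.adj_unique' hp hq e.symm (hzq q hq e')]
          exact e'.symm
        · rintro rfl; exact (h.out hp).2.2.1 (by simp)
    simpa using this.reverse
  · rw [NE_reverse_right]
    intro t ht p hp
    exact ⟨fun e => (h.out hp).2.2.1 (by simp [← e, ht]), (h.not_att hz).1 t ht p hp⟩

theorem MinBad.arm_left (hT : TriFree G) {x y y' z r : V} {W : Set V} {l A₀ A₁ R R₀ T P : List V}
    (h : MinBad G x W l y (A₀ ++ z :: A₁) y' (R ++ T) P) (hl : HoleL G l)
    (hq : ∃ q ∈ P, G.Adj z q ∧ G.Adj y' q) (hsT : ∃ v ∈ T, G.Adj x v)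
    (hR : y' :: R = R₀ ++ [r]) (hr : G.Adj x r) :
    Arm G x (y :: A₀ ++ z :: P.reverse) (r :: R₀.reverse) (fun c => c ∈ P ∧ G.Adj y' c) := by
  obtain ⟨iA, iB, nAB⟩ := h.bad.glue hl
  have hmem : ∀ w, w ∈ r :: R₀.reverse ↔ w ∈ y' :: R := by intro w; rw [hR]; simp; tauto
  have hnA : ∀ c ∈ y :: A₀ ++ [z], ∀ w ∈ y' :: R, c ≠ w ∧ ¬ G.Adj c w := by
    intro c hc w hw
    have hc' : c = y ∨ c ∈ A₀ ∨ c = z := by simpa using hc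
    rcases hc' with rfl | hc' | rfl
    · have hT0 : T ≠ [] := by obtain ⟨t, ht, -⟩ := hsT; exact List.ne_nil_of_mem ht
      have := h.ne_arm hl hT0 w hw c (by simp)
      exact ⟨this.1.symm, fun e => this.2 e.symm⟩
    · rcases List.mem_cons.1 hw with rfl | hw
      · have : IndPath G ((y :: A₀) ++ z :: (A₁ ++ [w])) := by simpa using iA
        exact this.ne c (by simp [hc']) w (by simp)
      · exact nAB c (by simp [hc']) w (by simp [hw])
    · rcases List.mem_cons.1 hw with rfl | hw
      · obtain ⟨q, hq, e1, e2⟩ := hq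
        refine ⟨?_, fun e => hT _ _ _ e e2 e1⟩
        have := iA.nodup
        rintro rfl; simp at this; grind
      · exact nAB c (by simp) w (by simp [hw])
  have hend : ∀ w ∈ r :: R₀.reverse, ∀ c ∈ y :: A₀ ++ z :: P.reverse, G.Adj c w →
      c ∈ P ∧ G.Adj y' c := by
    intro w hw c hc e
    rw [hmem] at hw
    have hc' : c ∈ y :: A₀ ++ [z] ∨ c ∈ P := by simp at hc ⊢; tauto
    rcases hc' with hc' | hc'
    · exact absurd e (hnA c hc' w hw).2
    · exact ⟨hc', h.att_arm hsT hw hc' e.symm⟩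
  refine ⟨List.isChain_cons_cons.2 ⟨hr, ?_⟩, ?_, ?_, ?_, hend⟩
  · have : r :: R₀.reverse = (y' :: R).reverse := by rw [hR]; simp
    rw [this]
    exact chain_reverse (iB.isChain.infix ⟨[], T ++ [y], by simp⟩)
  · intro w hw hc
    rw [hmem] at hw
    have hc' : w ∈ y :: A₀ ++ [z] ∨ w ∈ P := by simp at hc ⊢; tauto
    rcases hc' with hc' | hc'
    · exact (hnA w hc' w hw).1 rfl
    · have := h.out hc'
      rcases List.mem_cons.1 hw with hw | hw
      · exact this.2.1 hw
      · exact this.2.2.2 (by simp [hw])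
  · obtain ⟨p, hp, e⟩ := h.exists_adj'
    exact ⟨y', (hmem y').2 (by simp), p, by simp [hp], e.symm⟩
  · intro w hw c hc c' hc' e e'
    have h1 := hend w hw c hc e
    have h2 := hend w hw c' hc' e'
    exact h.adj_unique' h1.1 h2.1 h1.2 h2.2

theorem MinBad.notMem_left {x y y' z : V} {W : Set V} {l A₀ A₁ B P : List V}
    (h : MinBad G x W l y (A₀ ++ z :: A₁) y' B P) (hx : x ∉ l) :
    x ∉ y :: A₀ ++ z :: P.reverse := by
  intro hx'
  rw [h.bad.rot.mem_iff] at hx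
  have hxP : x ∉ P := fun hx => (h.bad.out x hx).2.2.1 rfl
  simp only [List.cons_append, List.mem_append, List.mem_cons, List.mem_reverse] at hx hx'
  tauto

/-- On the hole y A₀ z P the only neighbours of x are y and z. The stretch of the old hole from r
back to y' is an arm that ends in P, so `one_arm` applies. -/
theorem MinBad.case_spoke (hT : TriFree G) (hI : ISK4Free G) {x y y' z r : V} {W : Set V}
    {l A₀ A₁ R R₀ T P : List V} (hC : Ctx G x W l)
    (h : MinBad G x W l y (A₀ ++ z :: A₁) y' (R ++ T) P) (hy : G.Adj x y) (hz : G.Adj x z)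
    (fA₀ : ∀ v ∈ A₀, ¬ G.Adj x v) (hq : ∃ q ∈ P, G.Adj z q)
    (hzq : ∀ p ∈ P, G.Adj z p → G.Adj y' p) (hsT : ∃ v ∈ T, G.Adj x v)
    (hR : y' :: R = R₀ ++ [r]) (hr : G.Adj x r) : False := by
  have hP : ∀ c ∈ P, ¬ G.Adj x c := fun c hc => (h.bad.out c hc).2.2.2
  have hhole := h.hole_left hC.hole hz (fun e => hT _ _ _ hy e hz) hq hzq
  have arm := h.arm_left hT hC.hole (by
    obtain ⟨q, hq, e⟩ := hq; exact ⟨q, hq, e, hzq q hq e⟩) hsT hR hr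
  refine one_arm hT hI hhole (h.notMem_left hC.notMem) (s₁ := y) (s₂ := z) (by simp) (by simp) ?_
    hy hz ?_ arm.1 arm.2.1 arm.2.2.1 arm.2.2.2.1 ?_
  · have := hhole.nodup
    rintro rfl; simp at this
  · intro s hs e
    simp only [List.cons_append, List.mem_append, List.mem_cons, List.mem_reverse] at hs
    rcases hs with hs | hs | hs | hs
    · exact Or.inl hs
    · exact absurd e (fA₀ s hs)
    · exact Or.inr hs
    · exact absurd e (hP s hs)
  · intro w hw c hc e
    have hc' := hP c (arm.2.2.2.2 w hw c hc e).1
    exact ⟨by rintro rfl; exact hc' hy, by rintro rfl; exact hc' hz⟩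

/-- On the hole y A₀ z v the only neighbour of x is z. The arm from r' ends at y, because it does
not see v, and the arm from r ends at v; so they have no common end, contrary to `two_arms`. -/
theorem MinBad.case_unattached (hT : TriFree G) (hI : ISK4Free G) {x y y' z r r' v : V} {W : Set V}
    {l A₀ A₁ R R₀ F L : List V} (hC : Ctx G x W l)
    (h : MinBad G x W l y (A₀ ++ z :: A₁) y' (R ++ (F ++ r' :: L)) [v]) (hz : G.Adj x z)
    (fA₀ : ∀ v ∈ A₀, ¬ G.Adj x v) (hzv : G.Adj z v) (hyv : G.Adj y v) (hy'v : G.Adj y' v)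
    (hsF : ∃ v ∈ F, G.Adj x v) (hR : y' :: R = R₀ ++ [r]) (hr : G.Adj x r) (hr' : G.Adj x r')
    (hy : ¬ G.Adj x y) (hL : ∀ u ∈ r' :: L, ¬ G.Adj u v) : False := by
  obtain ⟨iA, iB, nAB⟩ := h.bad.glue hC.hole
  have hP : ∀ c ∈ [v], ¬ G.Adj x c := fun c hc => (h.bad.out c hc).2.2.2
  have hhole := h.hole_left hC.hole hz (fun e => hT _ _ _ hyv hzv.symm e) ⟨v, by simp, hzv⟩
    (by simpa using fun _ => hy'v)
  have arm := h.arm_left hT hC.hole ⟨v, by simp, hzv, hy'v⟩ ⟨r', by simp, hr'⟩ hR hr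
  have hyz : y ≠ z := by
    have := hhole.nodup
    rintro rfl; simp at this
  have hend : ∀ w ∈ r' :: L, ∀ c ∈ y :: A₀ ++ z :: [v].reverse, G.Adj c w → c = y := by
    intro w hw c hc e
    have hwB : w ∈ R ++ (F ++ r' :: L) := by simp at hw ⊢; tauto
    simp only [List.cons_append, List.mem_append, List.mem_cons, List.mem_reverse,
      List.not_mem_nil, or_false] at hc
    rcases hc with hc | hc | rfl | rfl
    · exact hc
    · exact absurd e (nAB c (by simp [hc]) w hwB).2
    · exact absurd e (nAB c (by simp) w hwB).2
    · exact absurd e.symm (hL w hw)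
  obtain ⟨e, he, ⟨u, hu, eu⟩, w, hw, ew⟩ := two_arms hT hI hhole (h.notMem_left hC.notMem)
    (s := z) (R := r' :: L) (by simp) hz
    (by
      intro s hs e
      simp only [List.cons_append, List.mem_append, List.mem_cons, List.mem_reverse] at hs
      rcases hs with rfl | hs | hs | hs
      · exact absurd e hy
      · exact absurd e (fA₀ s hs)
      · exact hs
      · exact absurd e (hP s (by simpa using hs)))
    (List.isChain_cons_cons.2 ⟨hr', iB.isChain.infix ⟨y' :: (R ++ F), [y], by simp⟩⟩)
    (by
      intro w hw hc
      have hwB : w ∈ R ++ (F ++ r' :: L) := by simp at hw ⊢; tauto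
      have hnd := iB.nodup
      simp only [List.cons_append, List.mem_append, List.mem_cons, List.mem_reverse,
        List.not_mem_nil, or_false] at hc
      rcases hc with rfl | hc | rfl | rfl
      · exact (List.nodup_append.1 hnd).2.2 w (List.mem_cons_of_mem _ hwB) w (by simp) rfl
      · exact (nAB w (by simp [hc]) w hwB).1 rfl
      · exact (nAB w (by simp) w hwB).1 rfl
      · exact (h.out (p := w) (by simp)).2.2.2 hwB)
    (by
      obtain ⟨w, hw, e⟩ := adj_of_chain_concat (l := r' :: L) (u := y) (by simp)
        (iB.isChain.infix ⟨y' :: (R ++ F), [], by simp⟩)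
      exact ⟨w, hw, y, by simp, e⟩)
    (fun w hw c hc c' hc' e e' => (hend w hw c hc e).trans (hend w hw c' hc' e').symm)
    (fun w hw c hc e => (hend w hw c hc e) ▸ hyz)
    arm.1 arm.2.1 arm.2.2.1 arm.2.2.2.1 (fun w hw c hc e => by
      have := (arm.2.2.2.2 w hw c hc e).1
      rintro rfl
      exact hP c this hz)
  obtain rfl := hend u hu e he eu
  exact (h.out (arm.2.2.2.2 w hw e he ew).1).1 rfl

/-- The part of P between p and q links two vertices separated by spokes, so by minimality it is all
of P, and p, q are its ends in one order or the other. -/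
theorem MinBad.ends_of_sep {x y y' u w p q : V} {W : Set V} {l A B P X Y : List V}
    (h : MinBad G x W l y A y' B P) (hr : Rot l (u :: X ++ w :: Y)) (hX : ∃ v ∈ X, G.Adj x v)
    (hY : ∃ v ∈ Y, G.Adj x v) (hp : p ∈ P) (hq : q ∈ P) (ep : G.Adj u p) (eq : G.Adj w q) :
    (G.Adj y p ∧ G.Adj y' q) ∨ (G.Adj y q ∧ G.Adj y' p) := by
  have hch := h.bad.chain
  have key : ∀ {S M T : List V} {p q : V}, P = S ++ (p :: M ++ q :: T) → (p :: M ++ [q]) ⊆ P →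
      P.length ≤ (p :: M ++ [q]).length → G.Adj y p ∧ G.Adj y' q := by
    rintro S M T p q rfl - hle
    have hS : S = [] := by simp at hle; exact List.length_eq_zero_iff.1 (by omega)
    have hT : T = [] := by simp at hle; exact List.length_eq_zero_iff.1 (by omega)
    subst hS hT
    have h1 : ([y, p]).IsChain G.Adj := hch.infix ⟨[], M ++ [q] ++ [y'], by simp⟩
    have h2 : ([q, y']).IsChain G.Adj := hch.infix ⟨y :: p :: M, [], by simp⟩
    exact ⟨by simpa using h1, by simpa [SimpleGraph.adj_comm] using h2⟩
  have hcP : P.IsChain G.Adj := hch.infix ⟨[y], [y'], by simp⟩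
  obtain ⟨S, T, hS⟩ := List.append_of_mem hp
  have hq' := hq
  rw [hS] at hq'
  rcases List.mem_append.1 hq' with hq' | hq'
  · obtain ⟨S, M, rfl⟩ := List.append_of_mem hq'
    have e : P = S ++ (q :: M ++ p :: T) := by simpa using hS
    have hsub : q :: M ++ [p] ⊆ P := by rw [e]; intro v; simp; tauto
    right
    exact key e hsub (h.length_le hr hX hY hsub
      (hcP.infix ⟨S, T, by rw [e]; simp⟩) (by simp) (by simp) ep eq)
  rcases List.mem_cons.1 hq' with rfl | hq'
  · have hle := h.length_le hr hX hY (M := [q]) (by simpa using hq) (by simp) (by simp) (by simp)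
      ep eq
    rw [hS] at hle
    have hS0 : S = [] := by simp at hle; exact List.length_eq_zero_iff.1 (by omega)
    have hT0 : T = [] := by simp at hle; exact List.length_eq_zero_iff.1 (by omega)
    subst hS0 hT0
    rw [hS] at hch
    simp at hch
    exact Or.inl ⟨hch.1, hch.2.symm⟩
  · obtain ⟨M, T, rfl⟩ := List.append_of_mem hq'
    have e : P = S ++ (p :: M ++ q :: T) := by simpa using hS
    have hsub : p :: M ++ [q] ⊆ P := by rw [e]; intro v; simp; tauto
    left
    exact key e hsub (h.length_le hr hX hY hsub
      (hcP.infix ⟨S, T, by rw [e]; simp⟩) (by simp) (by simp) ep eq)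

theorem MinBad.rot_far {x y y' z w : V} {W : Set V} {l A₀ A₁ R F₀ F₁ L P : List V}
    (h : MinBad G x W l y (A₀ ++ z :: A₁) y' (R ++ (F₀ ++ w :: F₁ ++ L)) P) :
    Rot l (z :: (A₁ ++ y' :: R ++ F₀) ++ w :: (F₁ ++ (L ++ y :: A₀))) := by
  have h1 : Rot l ((y :: A₀) ++ (z :: A₁ ++ y' :: (R ++ (F₀ ++ w :: F₁ ++ L)))) := by
    simpa using h.bad.rot
  simpa using h1.swap

/-- The vertices z and w are separated by the spokes r and r', so every neighbour of z on P is the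
end next to y'. If y were not a spoke, y and w would be separated by z and r', and y and y' would
have a common neighbour on P. So y is a spoke, and `MinBad.case_spoke` applies. -/
theorem MinBad.case_far (hT : TriFree G) (hI : ISK4Free G) {x y y' z r r' w p q : V} {W : Set V}
    {l A₀ A₁ R R₀ F L L₀ P : List V} (hC : Ctx G x W l)
    (h : MinBad G x W l y (A₀ ++ z :: A₁) y' (R ++ (F ++ L)) P) (hz : G.Adj x z)
    (fA₀ : ∀ v ∈ A₀, ¬ G.Adj x v) (hcom : ∀ v ∈ P, G.Adj y v → ¬ G.Adj y' v)
    (hsF : ∃ v ∈ F, G.Adj x v) (hR : y' :: R = R₀ ++ [r]) (hr : G.Adj x r)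
    (hL : y :: L.reverse = L₀ ++ [r']) (hr' : G.Adj x r') (hq : q ∈ P) (ezq : G.Adj z q)
    (hw : w ∈ F) (hp : p ∈ P) (ewp : G.Adj w p) (ep : G.Adj y p) : False := by
  obtain ⟨F₀, F₁, rfl⟩ := List.append_of_mem hw
  have hrR : r ∈ y' :: R := by rw [hR]; simp
  have hrL : r' ∈ y :: L.reverse := by rw [hL]; simp
  have hzq : ∀ q' ∈ P, G.Adj z q' → G.Adj y' q' := by
    intro q' hq' e
    rcases h.ends_of_sep h.rot_far ⟨r, by simp at hrR ⊢; tauto, hr⟩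
      ⟨r', by simp at hrL ⊢; tauto, hr'⟩ hq' hp e ewp with h1 | h1
    · exact absurd h1.2 (hcom p hp ep)
    · exact h1.2
  have hy : G.Adj x y := by
    by_contra hy
    have hrL : r' ∈ L := by
      rcases List.mem_cons.1 hrL with rfl | h1
      · exact absurd hr' hy
      · simpa using h1
    obtain ⟨t, ht, et⟩ := adj_of_chain_cons (u := y) h.bad.ne
      (h.bad.chain.infix ⟨[], [y'], by simp⟩)
    have hrot : Rot l (y :: (A₀ ++ z :: A₁ ++ y' :: R ++ F₀) ++ w :: (F₁ ++ L)) := by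
      simpa using h.bad.rot
    rcases h.ends_of_sep hrot ⟨z, by simp, hz⟩ ⟨r', by simp [hrL], hr'⟩ ht hp et ewp with h1 | h1
    · exact hcom p hp ep h1.2
    · exact hcom t ht et h1.2
  exact h.case_spoke hT hI hC hy hz fA₀ ⟨q, hq, ezq⟩ hzq
    (by obtain ⟨f, hf, e⟩ := hsF; exact ⟨f, List.mem_append_left _ hf, e⟩) hR hr

/-- Take the attached vertices s and t nearest to `F` on its two sides. They have the same
neighbours on P as y' and y, so the stretch from s through `F` to t forms a hole with P. It keeps r,
r' and a spoke in `F` but loses z, so it is an `AG` wheel with fewer spokes. -/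
theorem MinBad.case_near {x y y' z r r' : V} {W : Set V}
    {l A₀ A₁ R R₀ F L L₀ P : List V} (hC : Ctx G x W l)
    (h : MinBad G x W l y (A₀ ++ z :: A₁) y' (R ++ (F ++ L)) P) (hz : G.Adj x z)
    (hsF : ∃ v ∈ F, G.Adj x v) (hR : y' :: R = R₀ ++ [r]) (hr : G.Adj x r)
    (hL : y :: L.reverse = L₀ ++ [r']) (hr' : G.Adj x r')
    (hF : ∀ w ∈ F, ∀ p ∈ P, ¬ G.Adj w p) : False := by
  obtain ⟨iA, iB, nAB⟩ := h.bad.glue hC.hole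
  have hF0 : F ≠ [] := by obtain ⟨t, ht, -⟩ := hsF; exact List.ne_nil_of_mem ht
  have h' := h.reflect
  have e1 : (R ++ (F ++ L)).reverse = L.reverse ++ (F.reverse ++ R.reverse) := by simp
  rw [e1] at h'
  have hsFL : ∃ v ∈ F ++ L, G.Adj x v := by
    obtain ⟨f, hf, e⟩ := hsF; exact ⟨f, List.mem_append_left _ hf, e⟩
  have hsFR : ∃ v ∈ F.reverse ++ R.reverse, G.Adj x v := by
    obtain ⟨f, hf, e⟩ := hsF; exact ⟨f, by simp [hf], e⟩
  obtain ⟨R₁, s, R₂, hs, ⟨ps, hps, es⟩, hR₂⟩ := exists_last (p := fun v => ∃ p ∈ P, G.Adj v p)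
    (l := y' :: R) ⟨y', by simp, h.exists_adj'⟩
  obtain ⟨L₁, t, L₂, ht, ⟨pt, hpt, et⟩, hL₂⟩ := exists_last (p := fun v => ∃ p ∈ P, G.Adj v p)
    (l := y :: L.reverse) ⟨y, by simp, by
      obtain ⟨p, hp, e⟩ := h'.exists_adj'; exact ⟨p, by simpa using hp, e⟩⟩
  have hLy : L ++ [y] = L₂.reverse ++ t :: L₁.reverse := by
    have := congrArg List.reverse ht
    simpa using this
  have eB : y' :: (R ++ (F ++ L)) ++ [y] =
      R₁ ++ (s :: (R₂ ++ F ++ L₂.reverse) ++ [t] ++ L₁.reverse) := by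
    have : y' :: (R ++ (F ++ L)) ++ [y] = (y' :: R) ++ F ++ (L ++ [y]) := by simp
    rw [this, hs, hLy]; simp
  have iM : IndPath G (s :: (R₂ ++ F ++ L₂.reverse) ++ [t]) :=
    iB.infix ⟨R₁, L₁.reverse, by rw [eB]; simp⟩
  have hst : NE G [s] [t] := by
    have : IndPath G (s :: ((R₂ ++ F ++ L₂.reverse) ++ [t])) := by simpa using iM
    exact NE_of_indPath_cons this (by simp [hF0])
  have hsR : s ∈ y' :: R := by rw [hs]; simp
  have htL : t ∈ y :: L.reverse := by rw [ht]; simp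
  have hys : NE G [y] [s] :=
    ((h.ne_arm hC.hole (by simp [hF0])).mono (by simpa using hsR) (by simp)).symm
  have hyy : NE G [y] [y'] := NE_of_indPath_cons iA (by simp)
  have e's : G.Adj y' ps := h.att_arm hsFL hsR hps es
  have et' : G.Adj y pt := h'.att_arm hsFR htL (by simpa using hpt) et
  have hout : ∀ p ∈ P, p ∉ y' :: R ∧ p ∉ y :: L.reverse ∧ p ∉ F := by
    intro p hp
    have := h.out hp
    simp only [List.mem_append, List.mem_cons, List.mem_reverse] at this ⊢
    tauto
  have i1 : IndPath G (y :: P ++ [s]) := by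
    refine indPath_replace_last h.ind ?_
    intro p hp
    rcases List.mem_cons.1 hp with rfl | hp
    · have a1 := hys p (by simp) s (by simp)
      have a2 := hyy p (by simp) y' (by simp)
      exact ⟨by tauto, a1.1⟩
    · refine ⟨⟨fun e => (h.att_arm hsFL hsR hp e.symm).symm, fun e => ?_⟩, ?_⟩
      · rw [h.adj_unique' hp hps e.symm e's]; exact es.symm
      · rintro rfl; exact (hout p hp).1 hsR
  have i2 : IndPath G (t :: (P ++ [s])) := by
    refine indPath_replace_head (w := y) (by simpa using i1) ?_
    intro p hp
    rcases List.mem_append.1 hp with hp | hp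
    · refine ⟨⟨fun e => h'.att_arm hsFR htL (by simpa using hp) e, fun e => ?_⟩, ?_⟩
      · rw [h.adj_unique hp hpt e et']; exact et
      · rintro rfl; exact (hout p hp).2.1 htL
    · obtain rfl : p = s := by simpa using hp
      have a1 := hys y (by simp) p (by simp)
      have a2 := hst p (by simp) t (by simp)
      exact ⟨⟨fun e => absurd e.symm a2.2, fun e => absurd e a1.2⟩, a2.1⟩
  have hMat : ∀ v ∈ R₂ ++ F ++ L₂.reverse, ∀ p ∈ P, ¬ G.Adj v p := by
    intro v hv p hp e
    simp only [List.mem_append, List.mem_reverse] at hv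
    rcases hv with (hv | hv) | hv
    · exact hR₂ v hv ⟨p, hp, e⟩
    · exact hF v hv p hp e
    · exact hL₂ v hv ⟨p, hp, e⟩
  have hMB : ∀ v ∈ s :: (R₂ ++ F ++ L₂.reverse) ++ [t], v ∈ y' :: (R ++ (F ++ L)) ++ [y] := by
    intro v hv
    rw [eB]; simp only [List.mem_append] at hv ⊢; tauto
  have hMl : ∀ v ∈ s :: (R₂ ++ F ++ L₂.reverse) ++ [t], v ∈ l := by
    intro v hv
    have := hMB v hv
    rw [h.bad.rot.mem_iff]
    simp only [List.cons_append, List.mem_append, List.mem_cons, List.not_mem_nil] at this ⊢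
    tauto
  have hhole : HoleL G (s :: (R₂ ++ F ++ L₂.reverse) ++ t :: P) := by
    refine (holeL_glue (by simp [hF0]) h.bad.ne).2 ⟨iM, by simpa using i2, ?_⟩
    intro v hv p hp
    refine ⟨?_, hMat v hv p hp⟩
    rintro rfl
    exact (h.bad.out v hp).2.1 (hMl v (by simp only [List.cons_append, List.mem_cons, List.mem_append] at hv ⊢; tauto))
  have hrot : Rot l (A₀ ++ z :: A₁ ++ (y' :: (R ++ (F ++ L)) ++ [y])) := by
    have : Rot l ([y] ++ (A₀ ++ z :: A₁ ++ y' :: (R ++ (F ++ L)))) := by simpa using h.bad.rot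
    simpa using this.swap
  have c1 : 0 < cnt G x (s :: R₂) := cnt_pos.2 ⟨r, by
    have e : y' :: R = R₁ ++ (s :: R₂) := hs
    have : (y' :: R).getLast? = some r := by rw [hR]; simp
    rw [e, getLast?_append_cons] at this
    exact List.mem_of_mem_getLast? this, hr⟩
  have c2 : 0 < cnt G x (t :: L₂) := cnt_pos.2 ⟨r', by
    have : (y :: L.reverse).getLast? = some r' := by rw [hL]; simp
    rw [ht, getLast?_append_cons] at this
    exact List.mem_of_mem_getLast? this, hr'⟩
  have c3 := cnt_pos.2 hsF
  have cE : cnt G x (s :: (R₂ ++ F ++ L₂.reverse) ++ [t]) =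
      cnt G x (s :: R₂) + cnt G x F + cnt G x (t :: L₂) := by
    rw [List.cons_append, cnt_cons (a := s), cnt_cons (a := s) (l := R₂), cnt_cons (a := t)]
    simp only [cnt_append, cnt_reverse]
    omega
  have hag : AG G x (s :: (R₂ ++ F ++ L₂.reverse) ++ [t]) P := by
    refine ⟨by simpa using hhole, ?_, fun v hv => (h.bad.out v hv).2.2.2, by omega, ?_⟩
    · intro hx
      rcases List.mem_append.1 hx with hx | hx
      · exact hC.notMem (hMl x hx)
      · exact (h.bad.out x hx).2.2.1 rfl
    · intro c K d hi hc hd hK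
      refine hC.good_of_two h hrot (E := s :: (R₂ ++ F ++ L₂.reverse) ++ [t]) (p := s) (q := t)
        ⟨A₀ ++ z :: A₁ ++ R₁, L₁.reverse, ?_⟩ ?_ hi hc hd hK
      · rw [eB]; simp
      · intro v hv u hu e
        have hu' : u = s ∨ u ∈ R₂ ++ F ++ L₂.reverse ∨ u = t := by
          simp only [List.cons_append, List.mem_append, List.mem_cons, List.not_mem_nil,
            or_false] at hu ⊢
          tauto
        rcases hu' with hu' | hu' | hu'
        · exact Or.inl hu'
        · exact absurd e.symm (hMat u hu' v hv)
        · exact Or.inr hu'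
  have hle := hC.min _ _ hag
  rw [hrot.cnt_eq, eB] at hle
  have hcz := cnt_singleton_of_adj hz
  have e2 : cnt G x (A₀ ++ z :: A₁ ++ (R₁ ++ (s :: (R₂ ++ F ++ L₂.reverse) ++ [t] ++ L₁.reverse))) =
      cnt G x A₀ + (1 + cnt G x A₁) + (cnt G x R₁ +
      (cnt G x (s :: (R₂ ++ F ++ L₂.reverse) ++ [t]) + cnt G x L₁)) := by
    rw [cnt_append, cnt_append, cnt_cons (a := z), hcz, cnt_append, cnt_append (m := L₁.reverse),
      cnt_reverse]
  omega

/-- If neither y nor y' is a spoke and v has a neighbour in `L` and another in `R`, then v has three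
neighbours in each of the two sectors ending at z: z, y and the one in `L`, and z, y' and the one in
`R`. Two different bad sectors are excluded. The remaining cases are `MinBad.case_spoke` and
`MinBad.case_unattached`, up to reflection. -/
theorem MinBad.case_single_att (hT : TriFree G) (hI : ISK4Free G) {x y y' z r r' v : V} {W : Set V}
    {l A₀ A₁ R R₀ F L L₀ : List V} (hC : Ctx G x W l)
    (h : MinBad G x W l y (A₀ ++ z :: A₁) y' (R ++ (F ++ L)) [v]) (hz : G.Adj x z)
    (fA₀ : ∀ v ∈ A₀, ¬ G.Adj x v) (fA₁ : ∀ v ∈ A₁, ¬ G.Adj x v) (hzv : G.Adj z v)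
    (hyv : G.Adj y v) (hy'v : G.Adj y' v)
    (hsF : ∃ v ∈ F, G.Adj x v) (hR : y' :: R = R₀ ++ [r]) (hr : G.Adj x r)
    (fR₀ : ∀ v ∈ R₀, ¬ G.Adj x v) (hL : y :: L.reverse = L₀ ++ [r']) (hr' : G.Adj x r')
    (fL₀ : ∀ v ∈ L₀, ¬ G.Adj x v) : False := by
  have h' := h.reflect
  have e1 : (R ++ (F ++ L)).reverse = L.reverse ++ (F.reverse ++ R.reverse) := by simp
  have e2 : (A₀ ++ z :: A₁).reverse = A₁.reverse ++ z :: A₀.reverse := by simp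
  rw [e1, e2] at h'
  have h' : MinBad G x W l y' (A₁.reverse ++ z :: A₀.reverse) y
    (L.reverse ++ (F.reverse ++ R.reverse)) [v] := h'
  have hsFL : ∃ v ∈ F ++ L, G.Adj x v := by
    obtain ⟨f, hf, e⟩ := hsF; exact ⟨f, List.mem_append_left _ hf, e⟩
  have hsFR : ∃ v ∈ F.reverse ++ R.reverse, G.Adj x v := by
    obtain ⟨f, hf, e⟩ := hsF; exact ⟨f, by simp [hf], e⟩
  have hsF' : ∃ v ∈ F.reverse, G.Adj x v := by simpa using hsF
  have fA₁' : ∀ v ∈ A₁.reverse, ¬ G.Adj x v := by simpa using fA₁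
  by_cases hy : G.Adj x y
  · exact h.case_spoke hT hI hC hy hz fA₀ ⟨v, by simp, hzv⟩ (by simpa using fun _ => hy'v) hsFL hR hr
  by_cases hy' : G.Adj x y'
  · exact h'.case_spoke hT hI hC hy' hz fA₁' ⟨v, by simp, hzv⟩ (by simpa using fun _ => hyv) hsFR
      hL hr'
  have arm : ∀ {y r : V} {L L₀ : List V}, ¬ G.Adj x y → G.Adj x r → y :: L.reverse = L₀ ++ [r] →
      ∃ L', L = r :: L' ∧ y ∈ L₀ := by
    intro y r L L₀ hy hr hL
    have hLe : L ≠ [] := by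
      rintro rfl
      have h1 : y ∈ L₀ ++ [r] := by rw [← hL]; simp
      have h2 := congrArg List.length hL
      simp at h2
      subst h2
      have h3 : y = r := by simpa using h1
      exact hy (h3 ▸ hr)
    obtain ⟨a, L', rfl⟩ := List.exists_cons_of_ne_nil hLe
    have h1 : (y :: L'.reverse) ++ [a] = L₀ ++ [r] := by rw [← hL]; simp
    obtain ⟨h2, h3⟩ := List.append_inj' h1 rfl
    obtain rfl : a = r := by simpa using h3
    exact ⟨L', rfl, by rw [← h2]; simp⟩
  obtain ⟨L', hL', hyL₀⟩ := arm hy hr' hL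
  obtain ⟨R', hR', hyR₀⟩ := arm (L := R.reverse) hy' hr (by simpa using hR)
  by_cases k1 : ∀ u ∈ L, ¬ G.Adj u v
  · subst hL'
    exact h.case_unattached hT hI hC hz fA₀ hzv hyv hy'v hsF hR hr hr' hy k1
  by_cases k2 : ∀ u ∈ R, ¬ G.Adj u v
  · rw [hR'] at h'
    exact h'.case_unattached hT hI hC hz fA₁' hzv hy'v hyv hsF' hL hr' hr hy'
      (by rw [← hR']; simpa using k2)
  push Not at k1 k2
  obtain ⟨u, hu, eu⟩ := k1
  obtain ⟨w, hw, ew⟩ := k2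
  have hrot := h.rot_arm hR
  have hrot' := h'.rot_arm hL
  have sec1 : Sec G x l z (A₁ ++ R₀) r := ⟨hz, hr, by
    intro t ht
    rcases List.mem_append.1 ht with ht | ht
    exacts [fA₁ t ht, fR₀ t ht], _, hrot⟩
  have sec2 : Sec G x l z (A₀.reverse ++ L₀) r' := ⟨hz, hr', by
    intro t ht
    rcases List.mem_append.1 ht with ht | ht
    exacts [fA₀ t (by simpa using ht), fL₀ t ht], _, hrot'⟩
  have hv := h.bad.out v (by simp)
  have hnd := (h.bad.rot.holeL hC.hole).nodup
  have three : ∀ {y r u : V} {R R₀ X : List V}, y :: R = R₀ ++ [r] → y ∉ R → z ∉ y :: R → u ∈ R →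
      G.Adj y v → G.Adj u v → Three G v (z :: (X ++ R₀) ++ [r]) := by
    intro y r u R R₀ X hR h1 h2 hu e1 e2
    have hm : ∀ t ∈ y :: R, t ∈ z :: (X ++ R₀) ++ [r] := by
      intro t ht
      rw [hR] at ht
      simp only [List.cons_append, List.mem_append, List.mem_cons] at ht ⊢
      tauto
    refine ⟨z, by simp, y, hm y (by simp), u, hm u (by simp [hu]), ?_, ?_, ?_, hzv.symm, e1.symm,
      e2.symm⟩
    · rintro rfl; exact h2 (by simp)
    · rintro rfl; exact h2 (by simp [hu])
    · rintro rfl; exact h1 hu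
  have n1 : y' ∉ R ∧ z ∉ y' :: R ∧ y ∉ L.reverse ∧ z ∉ y :: L.reverse ∧ y ∉ z :: (A₁ ++ (y' :: R)) := by
    simp only [List.cons_append, List.nodup_cons, List.mem_append, List.mem_cons, not_or,
      List.nodup_append] at hnd
    simp only [List.mem_append, List.mem_cons, List.mem_reverse, not_or]
    grind
  have t1 := three (X := A₁) hR n1.1 n1.2.1 hw hy'v ew
  have t2 := three (X := A₀.reverse) hL n1.2.2.1 n1.2.2.2.1 (by simpa using hu) hyv eu
  have hsub := hC.uniq _ _ _ _ _ _ sec2 sec1 (fun hg => hg v hv.2.2.1 hv.2.2.2 t2)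
    (fun hg => hg v hv.2.2.1 hv.2.2.2 t1)
  have hyS : y ∈ z :: (A₁ ++ R₀) ++ [r] := hsub (by simp [hyL₀])
  apply n1.2.2.2.2
  rw [hR]
  simpa using hyS

/-- Suppose some vertex z of `A` is attached; it is then the only spoke inside `A`. Cutting off the
first spokes met from y' and from y leaves a middle part of `B` that still contains a spoke, as
there are at least four. The cases are: y and y' have a common neighbour on P, the middle part sees
P, or it does not. -/
theorem MinBad.elim (hT : TriFree G) (hI : ISK4Free G) {x y y' : V} {W : Set V}
    {l A B P : List V} (hC : Ctx G x W l) (h : MinBad G x W l y A y' B P) : False := by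
  by_cases hA : ∀ z ∈ A, ∀ p ∈ P, ¬ G.Adj z p
  · exact h.false_of_not_att hT hI hC hA
  push Not at hA
  obtain ⟨z, hzA, q, hq, ezq⟩ := hA
  obtain ⟨A₀, A₁, rfl⟩ := List.append_of_mem hzA
  obtain ⟨fA₀, fA₁⟩ := h.att hq ezq
  have hz : G.Adj x z := by
    obtain ⟨a, ha, e⟩ := h.bad.spokeA
    rcases List.mem_append.1 ha with ha | ha
    · exact absurd e (fA₀ a ha)
    · rcases List.mem_cons.1 ha with rfl | ha
      · exact e
      · exact absurd e (fA₁ a ha)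
  have h4 := hC.four
  rw [h.bad.rot.cnt_eq] at h4
  have e0 : cnt G x (y :: (A₀ ++ z :: A₁) ++ y' :: B) =
      cnt G x [y] + 1 + cnt G x [y'] + cnt G x B := by
    rw [List.cons_append, cnt_cons, cnt_append, cnt_append, cnt_cons (a := z), cnt_cons (a := y'),
      cnt_singleton_of_adj hz, cnt_eq_zero.2 fA₀, cnt_eq_zero.2 fA₁]
    omega
  have l1 := cnt_singleton_le (G := G) (x := x) (a := y)
  have l2 := cnt_singleton_le (G := G) (x := x) (a := y')
  obtain ⟨R, T, R₀, r, rfl, hR, fR₀, hr, hcT⟩ := exists_right_arm (G := G) (x := x) (y' := y')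
    (B := B) (by omega)
  obtain ⟨L, F, L₀, r', hTL, hL, fL₀, hr', hcF⟩ := exists_right_arm (G := G) (x := x) (y' := y)
    (B := T.reverse) (by rw [cnt_reverse]; omega)
  obtain rfl : T = F.reverse ++ L.reverse := by
    have := congrArg List.reverse hTL
    simpa using this
  have hcF' : 0 < cnt G x F.reverse := by
    rw [cnt_reverse]
    rw [cnt_reverse] at hcF
    omega
  have hsF := cnt_pos.1 hcF'
  have hL' : y :: L.reverse.reverse = L₀ ++ [r'] := by simpa using hL
  by_cases hcom : ∃ v ∈ P, G.Adj y v ∧ G.Adj y' v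
  · obtain ⟨v, hv, e1, e2⟩ := hcom
    obtain rfl := h.eq_singleton hv e1 e2
    obtain rfl : q = v := by simpa using hq
    exact h.case_single_att hT hI hC hz fA₀ fA₁ ezq e1 e2 hsF hR hr fR₀ hL' hr' fL₀
  push Not at hcom
  by_cases hF : ∀ w ∈ F.reverse, ∀ p ∈ P, ¬ G.Adj w p
  · exact h.case_near hC hz hsF hR hr hL' hr' hF
  push Not at hF
  obtain ⟨w, hw, p, hp, ewp⟩ := hF
  obtain ⟨F₀, F₁, hF01⟩ := List.append_of_mem hw
  have hrR : r ∈ y' :: R := by rw [hR]; simp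
  have hrL : r' ∈ y :: L := by rw [hL]; simp
  have hfar := h
  rw [hF01] at hfar
  rcases h.ends_of_sep hfar.rot_far ⟨r, by simp at hrR ⊢; tauto, hr⟩
      ⟨r', by simp at hrL ⊢; tauto, hr'⟩ hq hp ezq ewp with ⟨h1, h2⟩ | ⟨h1, h2⟩
  · have h' := h.reflect
    have e1 : (R ++ (F.reverse ++ L.reverse)).reverse = L ++ (F ++ R.reverse) := by simp
    have e2 : (A₀ ++ z :: A₁).reverse = A₁.reverse ++ z :: A₀.reverse := by simp
    rw [e1, e2] at h'
    exact h'.case_far hT hI hC hz (by simpa using fA₁)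
      (fun v hv e e' => hcom v (by simpa using hv) e' e) (by simpa using hsF) hL hr'
      (by simpa using hR) hr (q := q) (p := p) (w := w) (by simpa using hq) ezq (by simpa using hw)
      (by simpa using hp) ewp h2
  · exact h.case_far hT hI hC hz fA₀ hcom hsF hR hr hL' hr' hq ezq hw hp ewp h1

theorem Ctx.not_bad (hT : TriFree G) (hI : ISK4Free G) {x y y' : V} {W : Set V}
    {l A B P : List V} (hC : Ctx G x W l) : ¬ Bad G x W l y A y' B P := by
  intro h
  obtain ⟨y, A, y', B, P, h⟩ := h.exists_minBad hC.hole
  exact h.elim hT hI hC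

/-! ### Existence of a wheel all of whose sectors are good -/

theorem three_le_cnt {x : V} {l : List V} (h : Three G x l) : 3 ≤ cnt G x l := by
  classical
  obtain ⟨a, ha, b, hb, c, hc, hab, hac, hbc, ea, eb, ec⟩ := h
  have h1 : [a, b, c] ⊆ l.filter (fun v => decide (G.Adj x v)) := by
    intro v hv
    simp only [List.mem_cons, List.not_mem_nil, or_false] at hv
    rcases hv with rfl | rfl | rfl <;> simp [*]
  have h2 : [a, b, c].Nodup := by simp [hab, hac, hbc]
  have h3 := (h2.subperm h1).length_le
  rw [← List.countP_eq_length_filter] at h3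
  simpa [cnt] using h3

theorem exists_split_three {x : V} {l : List V} (h : 3 ≤ cnt G x l) :
    ∃ L₀ a M b L₁, l = L₀ ++ a :: (M ++ b :: L₁) ∧ G.Adj x a ∧ G.Adj x b ∧
      (∀ v ∈ L₀, ¬ G.Adj x v) ∧ (∀ v ∈ L₁, ¬ G.Adj x v) ∧ cnt G x l = cnt G x M + 2 := by
  obtain ⟨L₀, a, T, rfl, ha, f₀⟩ := exists_first (p := G.Adj x) (cnt_pos.1 (by omega : 0 < cnt G x l))
  have h1 : cnt G x (L₀ ++ a :: T) = cnt G x T + 1 := by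
    rw [cnt_append, cnt_cons, cnt_singleton_of_adj ha, cnt_eq_zero.2 f₀]; omega
  obtain ⟨M, b, L₁, rfl, hb, f₁⟩ := exists_last (p := G.Adj x) (cnt_pos.1 (by omega : 0 < cnt G x T))
  refine ⟨L₀, a, M, b, L₁, rfl, ha, hb, f₀, f₁, ?_⟩
  rw [h1, cnt_append, cnt_cons (a := b), cnt_singleton_of_adj hb, cnt_eq_zero.2 f₁]

theorem three_of_cnt {x : V} {l : List V} (hl : l.Nodup) (h : 3 ≤ cnt G x l) : Three G x l := by
  obtain ⟨L₀, a, M, b, L₁, rfl, ha, hb, -, -, hc⟩ := exists_split_three h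
  obtain ⟨m, hm, em⟩ := cnt_pos.1 (by omega : 0 < cnt G x M)
  refine ⟨a, by simp, m, by simp [hm], b, by simp, ?_, ?_, ?_, ha, em, hb⟩ <;> rintro rfl <;>
    simp only [List.nodup_cons, List.mem_append, List.mem_cons, not_or, List.nodup_append] at hl <;>
    grind

theorem IndPath.not_three {l : List V} (h : IndPath G l) {v : V} (hv : v ∈ l) :
    ¬ Three G v l := by
  intro h3
  obtain ⟨A, B, rfl⟩ := List.append_of_mem hv
  -- The only candidates are the predecessor and the successor of v. The default value v occurs at
  -- an end of the path, where that side has no vertex at all.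
  refine h3.false_of_two (p := A.getLast?.getD v) (q := B.head?.getD v) ?_
  intro a ha e
  rcases List.mem_append.1 ha with ha | ha
  · obtain ⟨X, Y, rfl⟩ := List.append_of_mem ha
    have h1 : IndPath G (X ++ (a :: (Y ++ v :: B))) := by simpa using h
    have hY : Y = [] := by
      by_contra hY
      exact (NE_of_indPath_cons h1.right hY a (by simp) v (by simp)).2 e.symm
    subst hY
    left; simp
  · rcases List.mem_cons.1 ha with rfl | ha
    · exact absurd rfl e.ne
    · obtain ⟨X, Y, rfl⟩ := List.append_of_mem ha
      have hX : X = [] := by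
        by_contra hX
        exact (NE_of_indPath_cons h.right hX v (by simp) a (by simp)).2 e
      subst hX
      right; simp

/-- Take a wheel with the shortest hole. If v has three neighbours in a sector, that sector closed
by x is the hole of a wheel with centre v. By minimality only one vertex of the old hole lies off
the sector; it is a spoke, and with x and an end of the sector it forms a triangle. -/
theorem exists_ag (hT : TriFree G) {x₀ : V} {l₀ : List V} (hl₀ : HoleL G l₀) (hx₀ : x₀ ∉ l₀)
    (h3₀ : 3 ≤ cnt G x₀ l₀) : ∃ x l, AG G x l [] := by
  classical
  have hQ : ∃ n x l, HoleL G l ∧ x ∉ l ∧ 3 ≤ cnt G x l ∧ l.length = n :=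
    ⟨_, x₀, l₀, hl₀, hx₀, h3₀, rfl⟩
  obtain ⟨x, l, hl, hx, h3, hlen⟩ := Nat.find_spec hQ
  refine ⟨x, l, by simpa using hl, by simpa using hx, by simp, h3, ?_⟩
  intro c K d hi hc hd hK v hvx hv h
  have hs := Sec.of_infix (Rot.refl l) hi hc hd hK
  have hh := hs.hole hT hl hx h3
  have hi' : IndPath G (c :: K ++ [d]) := by
    have : HoleL G ((c :: K ++ [d]) ++ [x]) := by simpa using hh
    exact this.indPath_left (by simp)
  have hvC : v ∉ c :: K ++ d :: [x] := by
    intro hvC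
    have : v ∈ c :: K ++ [d] ∨ v = x := by simp at hvC ⊢; tauto
    rcases this with h1 | h1
    · exact hi'.not_three h1 h
    · exact hvx h1
  have hmin := Nat.find_min' hQ ⟨v, _, hh, hvC, three_le_cnt (h.mono (by intro t; simp; tauto)), rfl⟩
  rw [← hlen] at hmin
  obtain ⟨-, -, -, Q, hr⟩ := hs
  have h1 := hr.length_eq
  have h2 := hr.cnt_eq (G := G) (x := x)
  have l1 := cnt_singleton_le (G := G) (x := x) (a := c)
  have l2 := cnt_singleton_le (G := G) (x := x) (a := d)
  rw [cnt_append (l := c :: K), cnt_cons (a := c), cnt_eq_zero.2 hK, cnt_cons (a := d)] at h2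
  obtain ⟨q, hq, eq⟩ := cnt_pos.1 (by omega : 0 < cnt G x Q)
  have hQ1 : Q.length = 1 := by
    have := List.length_pos_of_mem hq
    simp at h1 hmin
    omega
  obtain ⟨s, rfl⟩ := List.length_eq_one_iff.1 hQ1
  obtain rfl : q = s := by simpa using hq
  have h5 : HoleL G ([d, q] ++ (c :: K)) := (hr.holeL hl).swap
  exact hT _ _ _ hd (by simpa using h5.indPath_left (by simp)) eq

theorem AG.exists_min {x : V} {E P : List V} (h : AG G x E P) :
    ∃ E P, AG G x E P ∧ (∀ E' P', AG G x E' P' → cnt G x E ≤ cnt G x E') ∧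
      ∀ E' P', AG G x E' P' → cnt G x E' ≤ cnt G x E → (E ++ P).length ≤ (E' ++ P').length := by
  classical
  have h1 : ∃ n E P, AG G x E P ∧ cnt G x E = n := ⟨_, E, P, h, rfl⟩
  have h2 : ∃ m E P, AG G x E P ∧ cnt G x E = Nat.find h1 ∧ (E ++ P).length = m := by
    obtain ⟨E, P, h, e⟩ := Nat.find_spec h1
    exact ⟨_, E, P, h, e, rfl⟩
  obtain ⟨E, P, h, e, e'⟩ := Nat.find_spec h2
  have k1 : ∀ E' P', AG G x E' P' → cnt G x E ≤ cnt G x E' := fun E' P' h' => by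
    rw [e]; exact Nat.find_min' h1 ⟨E', P', h', rfl⟩
  refine ⟨E, P, h, k1, fun E' P' h' hle => ?_⟩
  rw [e']
  exact Nat.find_min' h2 ⟨E', P', h', (le_antisymm hle (k1 _ _ h')).trans e, rfl⟩

/-- A centre with exactly three spokes is itself a connected set with three links. -/
theorem four_le_cnt (hT : TriFree G) (hI : ISK4Free G) {x : V} {l : List V} (hl : HoleL G l)
    (hx : x ∉ l) (h3 : 3 ≤ cnt G x l) : 4 ≤ cnt G x l := by
  by_contra hcon
  have hnd := hl.nodup
  obtain ⟨L₀, a, M, b, L₁, rfl, ha, hb, f₀, f₁, hc⟩ := exists_split_three h3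
  obtain ⟨M₀, m, M₁, rfl, hm, fM₀⟩ := exists_first (p := G.Adj x) (cnt_pos.1 (by omega : 0 < cnt G x M))
  have fM₁ : ∀ v ∈ M₁, ¬ G.Adj x v := by
    have e : cnt G x (M₀ ++ m :: M₁) = 1 + cnt G x M₁ := by
      rw [cnt_append, cnt_cons, cnt_singleton_of_adj hm, cnt_eq_zero.2 fM₀]; omega
    exact cnt_eq_zero.1 (by omega)
  have hne : a ≠ m ∧ a ≠ b ∧ m ≠ b := by
    simp only [List.nodup_cons, List.mem_append, List.mem_cons, not_or, List.nodup_append] at hnd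
    grind
  refine no_three_links hT hI hl (conn_singleton (a := x)) (by rintro v hv rfl; exact hx hv)
    (a := a) (b := m) (c := b) (by simp) (by simp) (by simp) rfl rfl rfl hne.1 hne.2.1 hne.2.2
    ha.symm hm.symm hb.symm ?_
  rintro u hu v rfl e
  simp only [List.mem_append, List.mem_cons] at hu
  rcases hu with hu | hu | (hu | hu | hu) | hu | hu
  · exact absurd e.symm (f₀ u hu)
  · exact Or.inl ⟨hu, rfl⟩
  · exact absurd e.symm (fM₀ u hu)
  · exact Or.inr (Or.inl ⟨hu, rfl⟩)
  · exact absurd e.symm (fM₁ u hu)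
  · exact Or.inr (Or.inr ⟨hu, rfl⟩)
  · exact absurd e.symm (f₁ u hu)

theorem tail_eq_of_isRotated {a : V} {m m' : List V} (hn : (a :: m).Nodup)
    (h : (a :: m) ~r (a :: m')) : m = m' := by
  obtain ⟨n, hle, h⟩ := List.isRotated_iff_mod.1 h
  rw [List.rotate_eq_drop_append_take hle] at h
  have hn' := hn
  rw [← List.take_append_drop n (a :: m)] at hn'
  have htd := List.take_append_drop n (a :: m)
  generalize List.take n (a :: m) = X at *
  generalize List.drop n (a :: m) = Y at *
  cases Y with
  | nil => simp at h htd; rw [h] at htd; simpa using htd.symm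
  | cons b Y =>
    obtain ⟨rfl, h⟩ := List.cons.inj h
    cases X with
    | nil => simp at h htd; rw [← h, htd]
    | cons b' X =>
      obtain ⟨rfl, -⟩ := List.cons.inj htd
      simp at hn'

theorem first_prefix {p : V → Prop} {K Q Y R : List V} {d s : V} (h : Y ++ s :: R = K ++ d :: Q)
    (hs : p s) (hK : ∀ v ∈ K, ¬ p v) : ∃ T, Y ++ [s] = K ++ [d] ++ T := by
  rcases List.append_eq_append_iff.1 h with ⟨as, rfl, h2⟩ | ⟨bs, rfl, h2⟩
  · cases as with
    | nil => simp at h2; exact ⟨[], by simp [h2.1]⟩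
    | cons a as =>
      obtain ⟨rfl, -⟩ := List.cons.inj h2
      exact absurd hs (hK s (by simp))
  · cases bs with
    | nil => simp at h2; exact ⟨[], by simp [h2.1]⟩
    | cons a as =>
      obtain ⟨rfl, -⟩ := List.cons.inj h2
      exact ⟨as ++ [s], by simp⟩

/-- A sector that starts before the last spoke s' of the path stays inside it and is good by
assumption. The only other one runs from s' around through `P` to the first spoke s. -/
theorem AG.special_aux {x s s' c d : V} {E₀ E₁ E₂ P K Q : List V}
    (h : AG G x (E₀ ++ s :: (E₁ ++ s' :: E₂)) P) (hs : G.Adj x s) (hs' : G.Adj x s')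
    (f₀ : ∀ v ∈ E₀, ¬ G.Adj x v) (f₂ : ∀ v ∈ E₂, ¬ G.Adj x v) (hc : G.Adj x c) (hd : G.Adj x d)
    (hK : ∀ v ∈ K, ¬ G.Adj x v)
    (hr : (E₀ ++ s :: (E₁ ++ s' :: E₂) ++ P) ~r (c :: K ++ d :: Q)) :
    Good G x (c :: K ++ [d]) ∨ c :: K ++ [d] = s' :: (E₂ ++ P ++ E₀) ++ [s] := by
  have hnd := h.hole.nodup
  have hr1 : (E₀ ++ s :: (E₁ ++ s' :: E₂) ++ P) ~r (s :: E₁ ++ s' :: (E₂ ++ P ++ E₀)) := by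
    have := List.isRotated_append (l := E₀) (l' := s :: (E₁ ++ s' :: E₂) ++ P)
    simpa using this
  have hN : ∀ v ∈ E₂ ++ P ++ E₀, ¬ G.Adj x v := by
    intro v hv
    simp only [List.mem_append] at hv
    rcases hv with (hv | hv) | hv
    exacts [f₂ v hv, h.free v hv, f₀ v hv]
  have hr2 := hr1.symm.trans hr
  have hnd1 := hr1.nodup_iff.1 hnd
  have hcm : c ∈ s :: E₁ ++ s' :: (E₂ ++ P ++ E₀) := hr2.mem_iff.2 (by simp)
  rcases List.mem_append.1 hcm with hcm | hcm
  · left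
    obtain ⟨X, Y, hXY⟩ := List.append_of_mem hcm
    rw [hXY] at hr2 hnd1
    have hr3 : (X ++ c :: Y ++ s' :: (E₂ ++ P ++ E₀)) ~r
        (c :: (Y ++ s' :: ((E₂ ++ P ++ E₀) ++ X))) := by
      have := List.isRotated_append (l := X) (l' := c :: Y ++ s' :: (E₂ ++ P ++ E₀))
      simpa using this
    have e := tail_eq_of_isRotated (hr3.nodup_iff.1 hnd1) (hr3.symm.trans hr2)
    obtain ⟨T, hT⟩ := first_prefix (p := G.Adj x) e hs' hK
    refine h.good c K d ⟨E₀ ++ X, T ++ E₂, ?_⟩ hc hd hK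
    have e1 : E₀ ++ s :: (E₁ ++ s' :: E₂) = E₀ ++ (s :: E₁) ++ [s'] ++ E₂ := by simp
    rw [e1, hXY]
    have e2 : E₀ ++ (X ++ c :: Y) ++ [s'] ++ E₂ = E₀ ++ X ++ c :: (Y ++ [s']) ++ E₂ := by simp
    rw [e2, hT]
    simp
  · rcases List.mem_cons.1 hcm with rfl | hcm
    · right
      have hr3 : (s :: E₁ ++ c :: (E₂ ++ P ++ E₀)) ~r
          (c :: ((E₂ ++ P ++ E₀) ++ s :: E₁)) := List.isRotated_append
      have e := tail_eq_of_isRotated (hr3.nodup_iff.1 hnd1) (hr3.symm.trans hr2)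
      rcases List.append_eq_append_iff.1 e with ⟨as, e1, h2⟩ | ⟨bs, e1, h2⟩
      · cases as with
        | nil => simp at h2 e1; simp [e1, h2.1]
        | cons a as =>
          obtain ⟨rfl, -⟩ := List.cons.inj h2
          exact absurd hs (hK s (by rw [e1]; simp))
      · cases bs with
        | nil => simp at h2 e1; simp [e1, h2.1]
        | cons a as =>
          obtain ⟨rfl, -⟩ := List.cons.inj h2
          exact absurd hd (hN d (by rw [e1]; simp))
    · exact absurd hc (hN c hcm)

theorem AG.exists_special {x : V} {E P : List V} (h : AG G x E P) :
    ∃ Z : List V, ∀ c K d, Sec G x (E ++ P) c K d →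
      Good G x (c :: K ++ [d]) ∨ ∀ v, v ∈ c :: K ++ [d] ↔ v ∈ Z := by
  obtain ⟨E₀, s, E₁, s', E₂, rfl, hs, hs', f₀, f₂, -⟩ := exists_split_three h.three
  refine ⟨s' :: (E₂ ++ P ++ E₀) ++ [s], ?_⟩
  rintro c K d ⟨hc, hd, hK, Q, hr | hr⟩
  · rcases h.special_aux hs hs' f₀ f₂ hc hd hK hr with h1 | h1
    · exact Or.inl h1
    · exact Or.inr fun v => by rw [h1]
  · have hr1 : Rot (E₀ ++ s :: (E₁ ++ s' :: E₂) ++ P).reverse (c :: K ++ d :: Q) := Or.inl hr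
    have hr' : (E₀ ++ s :: (E₁ ++ s' :: E₂) ++ P) ~r (d :: K.reverse ++ c :: Q.reverse) := by
      have h1 := hr.reverse
      rw [List.reverse_reverse] at h1
      have e : (c :: K ++ d :: Q).reverse = Q.reverse ++ (d :: K.reverse ++ [c]) := by simp
      rw [e] at h1
      simpa using h1.trans List.isRotated_append
    have hm : ∀ v, v ∈ c :: K ++ [d] ↔ v ∈ d :: K.reverse ++ [c] := by intro v; simp; tauto
    rcases h.special_aux hs hs' f₀ f₂ hd hc (by simpa using hK) hr' with h1 | h1
    · exact Or.inl (h1.mono fun v hv => (hm v).1 hv)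
    · exact Or.inr fun v => by rw [hm, h1]

/-- The hole is chosen with the fewest spokes and then shortest. A vertex u with three neighbours in
the exceptional sector either has a neighbour off that sector, and is then a bad one-vertex path, or
can replace the part of the sector between its first and last neighbours. The latter keeps all
spokes and removes the exceptional sector, so by minimal length only one vertex is replaced, which
gives a triangle. -/
theorem AG.all_good (hT : TriFree G) (hI : ISK4Free G) {x : V} {E P : List V} (h : AG G x E P)
    (h1 : ∀ E' P', AG G x E' P' → cnt G x E ≤ cnt G x E')
    (h2 : ∀ E' P', AG G x E' P' → cnt G x E' ≤ cnt G x E → (E ++ P).length ≤ (E' ++ P').length)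
    {c d : V} {K : List V} (hs : Sec G x (E ++ P) c K d) : Good G x (c :: K ++ [d]) := by
  obtain ⟨Z, hZ⟩ := h.exists_special
  intro u hux hu hu3
  have hng : ¬ Good G x (c :: K ++ [d]) := fun hg => hg u hux hu hu3
  have hcE : cnt G x (E ++ P) = cnt G x E := by rw [cnt_append, cnt_eq_zero.2 h.free]; omega
  have h3 : 3 ≤ cnt G x (E ++ P) := hcE ▸ h.three
  have hSZ := (hZ c K d hs).resolve_left hng
  have hnd := h.hole.nodup
  -- Every bad sector has the vertex set Z of the given one, so u is the required witness for each
  -- of them.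
  have hC : Ctx G x {u} (E ++ P) := by
    refine ⟨h.hole, h.notMem, four_le_cnt hT hI h.hole h.notMem h3, fun E' P' h' => hcE ▸ h1 E' P' h',
      ?_, ?_⟩
    · intro c' K' d' hs' hg'
      have := (hZ c' K' d' hs').resolve_left hg'
      exact ⟨u, rfl, hu3.mono fun v hv => (this v).2 ((hSZ v).1 hv)⟩
    · intro c₁ K₁ d₁ c₂ K₂ d₂ s₁ s₂ g₁ g₂ v hv
      exact ((hZ _ _ _ s₂).resolve_left g₂ v).2 (((hZ _ _ _ s₁).resolve_left g₁ v).1 hv)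
  have hh := hs.hole hT h.hole h.notMem h3
  have hi' : IndPath G (c :: K ++ [d]) := by
    have : HoleL G ((c :: K ++ [d]) ++ [x]) := by simpa using hh
    exact this.indPath_left (by simp)
  obtain ⟨hc, hd, hK, Q, hr⟩ := hs
  have hK0 : K ≠ [] := by
    rintro rfl
    exact hT _ _ _ hc (by simpa using hi') hd
  have h2c := hr.cnt_eq (G := G) (x := x)
  rw [cnt_append (l := c :: K), cnt_cons (a := c), cnt_eq_zero.2 hK, cnt_cons (a := d),
    cnt_singleton_of_adj hc, cnt_singleton_of_adj hd] at h2c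
  obtain ⟨q, hq, eq⟩ := cnt_pos.1 (by omega : 0 < cnt G x Q)
  have hQ0 : Q ≠ [] := List.ne_nil_of_mem hq
  have hhr := hr.holeL h.hole
  obtain ⟨-, -, nKQ⟩ := (holeL_glue hK0 hQ0).1 hhr
  have hul : u ∉ E ++ P := by
    rw [hr.mem_iff]
    intro hu'
    have : u ∈ c :: K ++ [d] ∨ u ∈ Q := by simp at hu' ⊢; tauto
    rcases this with h' | h'
    · exact hi'.not_three h' hu3
    · refine hu3.false_of_two (p := c) (q := d) ?_
      intro a ha e
      have ha : a = c ∨ a ∈ K ∨ a = d := by simpa using ha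
      rcases ha with ha | ha | ha
      · exact Or.inl ha
      · exact absurd e.symm (nKQ a ha u h').2
      · exact Or.inr ha
  obtain ⟨Z₀, a, M, b, Z₁, hS, ea, eb, f₀, f₁, hcM⟩ := exists_split_three (three_le_cnt hu3)
  have hcu := three_le_cnt hu3
  obtain ⟨m, hm, em⟩ := cnt_pos.1 (by omega : 0 < cnt G u M)
  have hndS := hi'.nodup
  have hndS' := hndS
  rw [hS] at hndS'
  have hmc : m ≠ c := by
    rintro rfl
    cases Z₀ with
    | nil =>
      obtain ⟨rfl, -⟩ := List.cons.inj hS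
      simp [hm] at hndS'
    | cons z Z₀ =>
      obtain ⟨rfl, -⟩ := List.cons.inj hS
      simp [hm] at hndS'
  have hmd : m ≠ d := by
    rintro rfl
    have h' : (c :: K ++ [m]).getLast? = some m := by rw [getLast?_append_cons]; rfl
    rw [hS, getLast?_append_cons, ← List.cons_append, getLast?_append_cons] at h'
    have hmZ := List.mem_of_mem_getLast? h'
    have := (List.nodup_append.1 (List.nodup_cons.1 (List.nodup_append.1 hndS').2.1).2).2.2
    exact this m hm m hmZ rfl
  have hmS : m ∈ c :: K ++ [d] := by rw [hS]; simp [hm]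
  have hmK : m ∈ K := by simp [hmc, hmd] at hmS; exact hmS
  -- The middle neighbour m is inner in the sector, so the sector ends c and d are spokes inside the
  -- two arcs between m and w.
  by_cases hw : ∃ w ∈ Q, G.Adj u w
  · obtain ⟨w, hw, ew⟩ := hw
    obtain ⟨K₀, K₁, rfl⟩ := List.append_of_mem hmK
    obtain ⟨Q₀, Q₁, rfl⟩ := List.append_of_mem hw
    have hrot : Rot (E ++ P) (m :: (K₁ ++ d :: Q₀) ++ w :: (Q₁ ++ c :: K₀)) := by
      have h' : Rot (E ++ P) ((c :: K₀) ++ (m :: K₁ ++ d :: (Q₀ ++ w :: Q₁))) := by simpa using hr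
      simpa using h'.swap
    exact hC.not_bad hT hI (P := [u]) ⟨hrot, ⟨d, by simp, hd⟩, ⟨c, by simp, hc⟩, by simp,
      by simpa using ⟨by simpa using hul, hux, hu⟩, by simp [em.symm, ew]⟩
  push Not at hw
  have hrot : Rot (E ++ P) (a :: M ++ b :: (Z₁ ++ Q ++ Z₀)) := by
    have e1 : c :: K ++ d :: Q = (c :: K ++ [d]) ++ Q := by simp
    rw [e1, hS] at hr
    have h' : Rot (E ++ P) (Z₀ ++ (a :: M ++ b :: (Z₁ ++ Q))) := by simpa using hr
    simpa using h'.swap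
  have hM0 : M ≠ [] := List.ne_nil_of_mem hm
  obtain ⟨iM, iN, nMN⟩ := (holeL_glue (A := M) (B := Z₁ ++ Q ++ Z₀) hM0 (by simp [hQ0])).1
    (hrot.holeL h.hole)
  have hab : NE G [a] [b] := NE_of_indPath_cons iM hM0
  have hoN : ∀ v ∈ Z₁ ++ Q ++ Z₀, ¬ G.Adj u v := by
    intro v hv
    simp only [List.mem_append] at hv
    rcases hv with (hv | hv) | hv
    exacts [f₁ v hv, hw v hv, f₀ v hv]
  have hmem : ∀ v ∈ b :: (Z₁ ++ Q ++ Z₀) ++ [a], v ∈ E ++ P ∧ v ∉ M := by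
    intro v hv
    have hv' : v = a ∨ v ∈ b :: (Z₁ ++ Q ++ Z₀) := by
      simp only [List.cons_append, List.mem_append, List.mem_cons, List.not_mem_nil,
        or_false] at hv ⊢
      tauto
    have hndr := (hrot.holeL h.hole).nodup
    refine ⟨?_, ?_⟩
    · rw [hrot.mem_iff]
      rcases hv' with rfl | hv'
      · simp
      · exact List.mem_append_right _ hv'
    · intro hvM
      rcases hv' with rfl | hv'
      · simp [hvM] at hndr
      · exact (List.nodup_append.1 hndr).2.2 v (List.mem_cons_of_mem _ hvM) v hv' rfl
  have hhole : HoleL G (b :: (Z₁ ++ Q ++ Z₀) ++ a :: [u]) := by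
    refine (holeL_glue (by simp [hQ0]) (by simp)).2 ⟨iN, ⟨ea.symm, hab, by simpa using eb⟩, ?_⟩
    intro v hv t ht
    obtain rfl : t = u := by simpa using ht
    refine ⟨?_, fun e => hoN v hv e.symm⟩
    rintro rfl
    exact hul (hmem v (by
      simp only [List.cons_append, List.mem_append, List.mem_cons] at hv ⊢; tauto)).1
  have hMK : ∀ v ∈ M, ¬ G.Adj x v := by
    intro v hv e
    have hvS : v ∈ c :: K ++ [d] := by rw [hS]; simp [hv]
    have hv' : v = c ∨ v ∈ K ∨ v = d := by simpa using hvS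
    rcases hv' with rfl | hv' | rfl
    · cases Z₀ with
      | nil =>
        obtain ⟨rfl, -⟩ := List.cons.inj hS
        simp [hv] at hndS'
      | cons z Z₀ =>
        obtain ⟨rfl, -⟩ := List.cons.inj hS
        simp [hv] at hndS'
    · exact hK v hv' e
    · have h' : (c :: K ++ [v]).getLast? = some v := by rw [getLast?_append_cons]; rfl
      rw [hS, getLast?_append_cons, ← List.cons_append, getLast?_append_cons] at h'
      have hmZ := List.mem_of_mem_getLast? h'
      have := (List.nodup_append.1 (List.nodup_cons.1 (List.nodup_append.1 hndS').2.1).2).2.2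
      exact this v hv v hmZ rfl
  have hcE' : cnt G x (b :: (Z₁ ++ Q ++ Z₀) ++ [a]) = cnt G x (E ++ P) := by
    rw [hrot.cnt_eq, List.cons_append, List.cons_append, cnt_cons (a := a), cnt_append (l := M),
      cnt_eq_zero.2 hMK, ← List.cons_append, cnt_append]
    omega
  have hrotE : Rot (E ++ P) (b :: (Z₁ ++ Q ++ Z₀) ++ [a] ++ M) := by
    have h' : Rot (E ++ P) ((a :: M) ++ (b :: (Z₁ ++ Q ++ Z₀))) := hrot
    simpa using h'.swap
  have hag : AG G x (b :: (Z₁ ++ Q ++ Z₀) ++ [a]) [u] := by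
    refine ⟨by simpa using hhole, ?_, by simpa using hu, by omega, ?_⟩
    · intro hx
      rcases List.mem_append.1 hx with hx | hx
      · exact h.notMem (hmem x hx).1
      · exact hux ((List.mem_singleton.1 hx).symm)
    · intro c' K' d' hi hc' hd' hK'
      have hs' := Sec.of_infix hrotE (hi.trans ⟨[], M, by simp⟩) hc' hd' hK'
      -- A sector on the retained stretch misses m, so it is not the exceptional one.
      refine (hZ _ _ _ hs').resolve_right fun hZ' => ?_
      exact (hmem m (hi.subset ((hZ' m).2 ((hSZ m).1 hmS)))).2 hm
  have hlen := h2 _ _ hag (by omega)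
  rw [hrot.length_eq] at hlen
  have hM1 : M.length = 1 := by
    have := List.length_pos_iff.2 hM0
    simp at hlen; omega
  obtain ⟨m', rfl⟩ := List.length_eq_one_iff.1 hM1
  obtain rfl : m = m' := by simpa using hm
  exact hT _ _ _ ea iM.1 em

theorem exists_ctx (hT : TriFree G) (hI : ISK4Free G) {x₀ : V} {l₀ : List V} (hl₀ : HoleL G l₀)
    (hx₀ : x₀ ∉ l₀) (h3₀ : 3 ≤ cnt G x₀ l₀) : ∃ x l, Ctx G x Set.univ l := by
  obtain ⟨x, l, h⟩ := exists_ag hT hl₀ hx₀ h3₀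
  obtain ⟨E, P, h, h1, h2⟩ := h.exists_min
  have hcE : cnt G x (E ++ P) = cnt G x E := by rw [cnt_append, cnt_eq_zero.2 h.free]; omega
  have hg := fun c K d (hs : Sec G x (E ++ P) c K d) => h.all_good hT hI h1 h2 hs
  exact ⟨x, E ++ P, h.hole, h.notMem, four_le_cnt hT hI h.hole h.notMem (hcE ▸ h.three),
    fun E' P' h' => hcE ▸ h1 E' P' h', fun c K d hs hn => absurd (hg c K d hs) hn,
    fun c K d _ _ _ hs _ hn => absurd (hg c K d hs) hn⟩

/-! ### Sectors and the separation -/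

theorem indPath_of_getElem? {l : List V} (hnd : l.Nodup)
    (h : ∀ i j u v, l[i]? = some u → l[j]? = some v → i < j → (G.Adj u v ↔ j = i + 1)) :
    IndPath G l := by
  induction l with
  | nil => simp
  | cons a l ih =>
    cases l with
    | nil => simp
    | cons b l =>
      refine indPath_cons_cons.2 ⟨?_, ?_, ih hnd.tail ?_⟩
      · exact (h 0 1 a b (by simp) (by simp) (by omega)).2 rfl
      · intro u hu v hv
        obtain rfl : u = a := by simpa using hu
        obtain ⟨k, hk⟩ := List.mem_iff_getElem?.1 hv
        refine ⟨?_, fun e => ?_⟩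
        · rintro rfl
          simp [hv] at hnd
        · have := (h 0 (k + 2) u v (by simp) (by simpa using hk) (by omega)).1 e
          omega
      · intro i j u v hi hj hij
        have := h (i + 1) (j + 1) u v (by simpa using hi) (by simpa using hj) (by omega)
        rw [this]; omega

theorem holeL_of_getElem? {l : List V} (hnd : l.Nodup) (h4 : 4 ≤ l.length)
    (h : ∀ i j u v, l[i]? = some u → l[j]? = some v → i < j →
      (G.Adj u v ↔ j = i + 1 ∨ (i = 0 ∧ j + 1 = l.length))) : HoleL G l := by
  obtain ⟨a, b, t, rfl⟩ : ∃ a b t, l = a :: b :: t := by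
    match l, h4 with
    | a :: b :: t, _ => exact ⟨a, b, t, rfl⟩
  have ht : t ≠ [] := by rintro rfl; simp at h4
  obtain ⟨m, c, rfl⟩ : ∃ m c, t = m ++ [c] := ⟨_, _, (List.dropLast_append_getLast ht).symm⟩
  refine ⟨a, b, m, c, rfl, ?_, indPath_of_getElem? hnd.tail ?_, ?_, ?_, ?_⟩
  · rintro rfl; simp at h4
  · intro i j u v hi hj hij
    have := h (i + 1) (j + 1) u v (by simpa using hi) (by simpa using hj) (by omega)
    rw [this]; omega
  · exact (h 0 1 a b (by simp) (by simp) (by omega)).2 (Or.inl rfl)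
  · refine ((h 0 (m.length + 2) a c (by simp) (by simp) (by omega)).2 (Or.inr ⟨rfl, ?_⟩)).symm
    simp
  · intro u hu v hv
    obtain rfl : u = a := by simpa using hu
    obtain ⟨k, hk⟩ := List.mem_iff_getElem?.1 hv
    refine ⟨?_, fun e => ?_⟩
    · rintro rfl
      simp [hv] at hnd
    · have hkl : k < m.length := (List.getElem?_eq_some_iff.1 hk).1
      have := (h 0 (k + 2) u v (by simp)
        (by simpa [List.getElem?_append_left hkl] using hk) (by omega)).1 e
      simp at this
      omega

theorem IsHole.exists_holeL {H : Set V} (h : IsHole G H) :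
    ∃ l, HoleL G l ∧ ∀ v, v ∈ l ↔ v ∈ H := by
  obtain ⟨n, hn, ⟨e⟩⟩ := h
  obtain ⟨n, rfl⟩ : ∃ k, n = k + 4 := ⟨n - 4, by omega⟩
  let f : Fin (n + 4) → V := fun i => (e.symm i).1
  have hf : Function.Injective f := Subtype.val_injective.comp e.symm.injective
  refine ⟨List.ofFn f, holeL_of_getElem? (List.nodup_ofFn.2 hf) (by simp) ?_, ?_⟩
  · intro i j u v hi hj hij
    rw [List.getElem?_ofFn] at hi hj
    split_ifs at hi hj with h1 h2
    obtain rfl := Option.some.inj hi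
    obtain rfl := Option.some.inj hj
    have e0 : G.Adj (f ⟨i, h1⟩) (f ⟨j, h2⟩) ↔
        (SimpleGraph.cycleGraph (n + 4)).Adj ⟨i, h1⟩ ⟨j, h2⟩ := e.symm.map_adj_iff
    rw [e0, SimpleGraph.cycleGraph_adj', Fin.sub_def, Fin.sub_def]
    simp only [List.length_ofFn]
    have e1 : (n + 4 - i + j) % (n + 4) = j - i := by
      have : n + 4 - i + j = (j - i) + (n + 4) := by omega
      rw [this, Nat.add_mod_right, Nat.mod_eq_of_lt (by omega)]
    have e2 : (n + 4 - j + i) % (n + 4) = n + 4 - j + i := Nat.mod_eq_of_lt (by omega)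
    rw [e1, e2]
    omega
  · intro v
    rw [List.mem_ofFn]
    constructor
    · rintro ⟨i, rfl⟩
      exact (e.symm i).2
    · intro hv
      exact ⟨e ⟨v, hv⟩, by simp [f]⟩

theorem NE.chain_side {A B L : List V} (h : NE G A B) (hL : L.IsChain G.Adj)
    (hm : ∀ v ∈ L, v ∈ A ∨ v ∈ B) : (∀ v ∈ L, v ∈ A) ∨ ∀ v ∈ L, v ∈ B := by
  induction L with
  | nil => simp
  | cons u L ih =>
    cases L with
    | nil => simpa using hm
    | cons w L =>
      have e : G.Adj u w := hL.rel
      have hu := hm u (by simp)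
      rcases ih hL.tail (fun v hv => hm v (List.mem_cons_of_mem _ hv)) with h1 | h1
      · left
        have hu' : u ∈ A := hu.resolve_right fun h' => (h w (h1 w (by simp)) u h').2 e.symm
        intro v hv
        rcases List.mem_cons.1 hv with rfl | hv
        exacts [hu', h1 v hv]
      · right
        have hu' : u ∈ B := hu.resolve_left fun h' => (h u h' w (h1 w (by simp))).2 e
        intro v hv
        rcases List.mem_cons.1 hv with rfl | hv
        exacts [hu', h1 v hv]

/-- Removing an inner vertex from an induced path disconnects its ends, so a chain between the ends
inside the path passes through every vertex. -/
theorem IndPath.subset_of_chain {a b : V} {I L : List V} (h : IndPath G (a :: I ++ [b]))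
    (hL : (a :: L ++ [b]).IsChain G.Adj) (hm : ∀ v ∈ L, v ∈ I) : ∀ v ∈ I, v ∈ L := by
  intro i hi
  by_contra hiL
  obtain ⟨I₁, I₂, rfl⟩ := List.append_of_mem hi
  have h1 : IndPath G ((a :: I₁) ++ i :: (I₂ ++ [b])) := by simpa using h
  have hne := h1.ne
  have hall : ∀ v ∈ a :: L ++ [b], v ∈ a :: I₁ ∨ v ∈ I₂ ++ [b] := by
    intro v hv
    have hv : v = a ∨ v ∈ L ∨ v = b := by simpa using hv
    rcases hv with rfl | hv | rfl
    · simp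
    · have hvi : v ≠ i := by rintro rfl; exact hiL hv
      have := hm v hv
      simp only [List.mem_append, List.mem_cons, hvi, false_or] at this
      rcases this with h' | h' <;> simp [h']
    · simp
  rcases hne.chain_side hL hall with h' | h'
  · exact (hne b (h' b (by simp)) b (by simp)).1 rfl
  · exact (hne a (by simp) a (h' a (by simp))).1 rfl

/-- The interior of the walk stays within one of the two open arcs between its ends, since no edge
joins them, and then fills that arc. Reversal of the list puts this arc first. -/
theorem IsSector.exists_arc (hT : TriFree G) {l : List V} (hl : HoleL G l) {x a b : V}
    {S : G.Walk a b} (h : IsSector G {v | v ∈ l} x S) :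
    ∃ I J, Rot l (a :: I ++ b :: J) ∧ I ≠ [] ∧ J ≠ [] ∧ NE G I J ∧
      ∀ v, v ∈ S.support ↔ v = a ∨ v ∈ I ∨ v = b := by
  obtain ⟨hp, hab, hS, ha, hb, -⟩ := h
  have hnab : ¬ G.Adj a b := hT _ _ _ ha.symm |> fun h e => h hb e
  obtain ⟨L, eL, hc, hn⟩ := Walk.exists_interior S hp hab
  have hL0 : L ≠ [] := by
    rintro rfl
    exact hnab (by simpa using hc)
  rw [eL] at hS ⊢
  have facts : ∀ I J, Rot l (a :: I ++ b :: J) → I ≠ [] ∧ J ≠ [] ∧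
      IndPath G (a :: I ++ [b]) ∧ NE G I J := by
    intro I J hr
    have hh := hr.holeL hl
    have h4 := hh.four_le
    have hI : I ≠ [] := by
      rintro rfl
      have h' : HoleL G ([a, b] ++ J) := by simpa using hh
      exact hnab (by simpa using h'.indPath_left (by rintro rfl; simp at h4))
    have hJ : J ≠ [] := by
      rintro rfl
      have h' : HoleL G ([b, a] ++ I) := by
        have : HoleL G ((a :: I) ++ [b]) := hh
        simpa using this.swap
      exact hnab (by simpa using (h'.indPath_left hI).reverse)
    obtain ⟨h1, -, h3⟩ := (holeL_glue hI hJ).1 hh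
    exact ⟨hI, hJ, h1, h3⟩
  have key : ∀ I J, Rot l (a :: I ++ b :: J) → (∀ v ∈ L, v ∈ I) →
      ∃ I J, Rot l (a :: I ++ b :: J) ∧ I ≠ [] ∧ J ≠ [] ∧ NE G I J ∧
        ∀ v, v ∈ a :: L ++ [b] ↔ v = a ∨ v ∈ I ∨ v = b := by
    intro I J hr hLI
    obtain ⟨h1, h2, h3, h4⟩ := facts I J hr
    refine ⟨I, J, hr, h1, h2, h4, fun v => ?_⟩
    have : v ∈ L ↔ v ∈ I := ⟨hLI v, h3.subset_of_chain hc hLI v⟩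
    simp [this]
  obtain ⟨X, Y, rfl⟩ := List.append_of_mem (show a ∈ l from hS a (by simp))
  have hr : Rot (X ++ a :: Y) (a :: (Y ++ X)) := by
    simpa using (Rot.refl (X ++ a :: Y)).swap
  have hbm : b ∈ Y ++ X := by
    have := hr.mem_iff.1 (show b ∈ X ++ a :: Y from hS b (by simp))
    exact (List.mem_cons.1 this).resolve_left hab.symm
  obtain ⟨I, J, hIJ⟩ := List.append_of_mem hbm
  rw [hIJ] at hr
  have hr' : Rot (X ++ a :: Y) (a :: I ++ b :: J) := hr
  obtain ⟨-, -, -, hne⟩ := facts I J hr'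
  have hchain : L.IsChain G.Adj := hc.infix ⟨[a], [b], by simp⟩
  have hmem : ∀ v ∈ L, v ∈ I ∨ v ∈ J := by
    intro v hv
    have h1 := hr.mem_iff.1 (show v ∈ X ++ a :: Y from hS v (by simp [hv]))
    have h2 : v ≠ a := by
      rintro rfl
      simp [hv] at hn
    have h3 : v ≠ b := by
      rintro rfl
      simp only [List.cons_append, List.nodup_cons, List.nodup_append] at hn
      exact hn.2.2.2 v hv v (by simp) rfl
    simpa [h2, h3] using h1
  rcases hne.chain_side hchain hmem with h | h
  · exact key I J hr' h
  · refine key J.reverse I.reverse ?_ (by simpa using h)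
    have h' : Rot (X ++ a :: Y) ((b :: I.reverse) ++ (a :: J.reverse)) := hr'.reflect
    exact h'.swap

/-- A walk from I to J that avoids the cut contains a piece between its last visit to I and the next
visit to J. This piece avoids the hole and N[x], and the spokes a and b lie inside the two arcs
between its ends, so it would be a bad path. -/
theorem Ctx.separates (hT : TriFree G) (hI : ISK4Free G) {x : V} {l : List V}
    (hC : Ctx G x Set.univ l) {a b : V} {I J : List V} (hr : Rot l (a :: I ++ b :: J))
    (hne : NE G I J) (ha : G.Adj x a) (hb : G.Adj x b) {u v : V} (hu : u ∈ I) (hv : v ∈ J)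
    (p : G.Walk u v) : ∃ w ∈ p.support, w ∈ wheelCut G {v | v ∈ l} x a b := by
  by_contra! hcon
  have hchain := p.isChain_adj_support
  have hlast : p.support.getLast? = some v := by
    rw [List.getLast?_eq_some_getLast (by simp), p.getLast_support]
  have hst := p.start_mem_support
  generalize p.support = T at *
  obtain ⟨T₁, i, T₂, rfl, hi, fT₂⟩ := exists_last (p := (· ∈ I)) ⟨u, hst, hu⟩
  rw [getLast?_append_cons] at hlast
  have hvT : v ∈ T₂ := by
    rcases List.mem_cons.1 (List.mem_of_mem_getLast? hlast) with rfl | h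
    · exact absurd rfl (hne v hi v hv).1
    · exact h
  obtain ⟨Q, j, T₃, rfl, hj, fQ⟩ := exists_first (p := (· ∈ J)) ⟨v, hvT, hv⟩
  have hc : (i :: Q ++ [j]).IsChain G.Adj := hchain.infix ⟨T₁, T₃, by simp⟩
  obtain ⟨I₁, I₂, rfl⟩ := List.append_of_mem hi
  obtain ⟨J₁, J₂, rfl⟩ := List.append_of_mem hj
  have hrot : Rot l (i :: (I₂ ++ b :: J₁) ++ j :: (J₂ ++ a :: I₁)) := by
    have h' : Rot l ((a :: I₁) ++ (i :: (I₂ ++ b :: J₁) ++ j :: J₂)) := by simpa using hr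
    simpa using h'.swap
  refine hC.not_bad hT hI (P := Q) ⟨hrot, ⟨b, by simp, hb⟩, ⟨a, by simp, ha⟩, ?_, ?_, hc⟩
  · rintro rfl
    exact (hne i hi j hj).2 (by simpa using hc)
  · intro w hw
    have hwc := hcon w (by simp [hw])
    have hwa : w ≠ a := by rintro rfl; exact hwc (by simp [wheelCut])
    have hwb : w ≠ b := by rintro rfl; exact hwc (by simp [wheelCut])
    have hwI := fT₂ w (by simp [hw])
    have hwJ := fQ w hw
    have hwl : w ∉ l := by
      rw [hr.mem_iff]
      intro h
      rcases List.mem_append.1 h with h | h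
      · rcases List.mem_cons.1 h with h | h
        exacts [hwa h, hwI h]
      · rcases List.mem_cons.1 h with h | h
        exacts [hwb h, hwJ h]
    refine ⟨trivial, hwl, ?_, fun e => ?_⟩
    · rintro rfl
      exact hwc (Or.inl ⟨by simp, hwl⟩)
    · exact hwc (Or.inl ⟨Or.inr e, hwl⟩)

/-- The given wheel serves only to obtain a minimal one, and it is the minimal wheel that
decomposes. Sector ends belong to the cut, so only the interiors have to be separated; both
interiors are nonempty, which makes the separator a cutset. -/
theorem hasWheelDecomposition_of_isWheel [Finite V] (hT : TriFree G) (hI : ISK4Free G)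
    {H : Set V} {x : V} (h : IsWheel G H x) : HasWheelDecomposition G := by
  obtain ⟨hH, hx, h3⟩ := h
  obtain ⟨l₀, hl₀, hm⟩ := hH.exists_holeL
  obtain ⟨p, hp, q, hq, r, hr, hpq, hpr, hqr⟩ := exists_three_of_ncard h3
  obtain ⟨x, l, hC⟩ := exists_ctx hT hI hl₀ (by rwa [hm])
    (three_le_cnt ⟨p, (hm p).2 hp.1, q, (hm q).2 hq.1, r, (hm r).2 hr.1, hpq, hpr, hqr,
      hp.2, hq.2, hr.2⟩)
  obtain ⟨p, hp, q, hq, r, hr, hpq, hpr, hqr, ep, eq, er⟩ :=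
    three_of_cnt hC.hole.nodup (le_trans (by norm_num) hC.four)
  refine ⟨{v | v ∈ l}, x, hC.hole.isWheel hC.notMem hp hq hr hpq hpr hqr ep eq er, ?_⟩
  intro a b S hS
  obtain ⟨I, J, hrot, hI0, hJ0, hne, hsupp⟩ := hS.exists_arc hT hC.hole
  have hnd := (hrot.holeL hC.hole).nodup
  have hsep := fun u hu v hv =>
    hC.separates hT hI hrot hne hS.2.2.2.1 hS.2.2.2.2.1 (u := u) (v := v) hu hv
  have hcut : ∀ w ∈ I ++ J, w ∉ wheelCut G {v | v ∈ l} x a b := by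
    intro w hw
    have hwl : w ∈ l := by
      rw [hrot.mem_iff]
      rcases List.mem_append.1 hw with h | h <;> simp [h]
    have hwa : w ≠ a := by
      rintro rfl
      rcases List.mem_append.1 hw with h | h <;> simp [h] at hnd
    have hwb : w ≠ b := by
      rintro rfl
      rw [List.nodup_append] at hnd
      rcases List.mem_append.1 hw with h | h
      · exact hnd.2.2 w (by simp [h]) w (by simp) rfl
      · simp [h] at hnd
    rintro (h | h | h)
    · exact h.2 hwl
    · exact hwa h
    · exact hwb h
  refine ⟨fun hpre => ?_, ?_⟩
  · obtain ⟨u, hu⟩ := List.exists_mem_of_ne_nil I hI0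
    obtain ⟨v, hv⟩ := List.exists_mem_of_ne_nil J hJ0
    obtain ⟨p⟩ := hpre ⟨u, hcut u (by simp [hu])⟩ ⟨v, hcut v (by simp [hv])⟩
    let f : G.induce (wheelCut G {v | v ∈ l} x a b)ᶜ →g G := ⟨Subtype.val, fun h => h⟩
    obtain ⟨w, hw, hwc⟩ := hsep u hu v hv (p.map f)
    rw [SimpleGraph.Walk.support_map] at hw
    obtain ⟨t, -, rfl⟩ := List.mem_map.1 hw
    exact t.2 hwc
  · rintro u hu v ⟨hvl, hvS⟩ p
    have hu : u = a ∨ u ∈ I ∨ u = b := (hsupp u).1 hu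
    rcases hu with rfl | hu | rfl
    · exact ⟨u, p.start_mem_support, by simp [wheelCut]⟩
    · refine hsep u hu v ?_ p
      have h1 : ¬ (v = a ∨ v ∈ I ∨ v = b) := fun h => hvS ((hsupp v).2 h)
      push Not at h1
      have h2 := hrot.mem_iff.1 (show v ∈ l from hvl)
      simpa [h1.1, h1.2.1, h1.2.2] using h2
    · exact ⟨u, p.start_mem_support, by simp [wheelCut]⟩

end ISK4

theorem mainTheorem2 {V : Type*} [Finite V] (G : SimpleGraph V)
    (hG₃ : G.CliqueFree 3) (hG₄ : ISK4.ISK4Free G) :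
    ISK4.SeriesParallel G ∨ ISK4.IsCompleteBipartite G ∨
      ISK4.HasCliqueCutsetLE G 2 ∨ ISK4.HasWheelDecomposition G := by
  have hT := ISK4.triFree_of_cliqueFree hG₃
  by_cases hW : ∃ H x, ISK4.IsWheel G H x
  · obtain ⟨H, x, h⟩ := hW
    exact Or.inr (Or.inr (Or.inr (ISK4.hasWheelDecomposition_of_isWheel hT hG₄ h)))
  · push Not at hW
    rcases ISK4.seriesParallel_or_hasK33 hT hG₄ hW with h | h
    · exact Or.inl h
    · rcases ISK4.HasK33.bipartite_or_cutset hT hG₄ h with h | h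
      · exact Or.inr (Or.inl h)
      · exact Or.inr (Or.inr (Or.inl h))
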